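/- Conventions. A locally convex algebra is a complete (Hausdorff) locally convex complex vector space with a jointly continuous associative multiplication; morphisms are continuous algebra homomorphisms, $\otimes_\pi$ is the completed projective tensor product. $\mathcal K^\infty$ is the algebra of matrices $(a_{ij})_{i,j\in\mathbb N}$ with $\|a\|_{m,n}=\sum_{i,j}(1+i)^m(1+j)^n|a_{ij}|<\infty$ for all $m,n$, and $\mathcal T^\infty=\mathcal K^\infty\oplus C^\infty(S^1)$ is the smooth Toeplitz algebra, with the multiplication of the operators $k+T_f$ on $\ell^2(\mathbb N)$; $S,\bar S\in\mathcal T^\infty$ are the shift and its adjoint and $e=1-S\bar S$. For a locally convex algebra $B$, $ZB$ is the algebra of smooth functions $[0,1]\to B$ all of whose derivatives of order $\ge 1$ vanish at the endpoints. A functor $H$ from locally convex algebras to abelian groups is *split exact* if it maps every extension of locally convex algebras that is split by a continuous homomorphism to a short exact sequence; *diffotopy invariant* if $H(ev_t):H(ZB)\to H(B)$ is independent of $t\in[0,1]$ for all $B$; *$\mathcal K^\infty$-stable* if $b\mapsto e\otimes b$ induces an isomorphism $H(B)\to H(\mathcal K^\infty\otimes_\pi B)$ for all $B$. If $\alpha,\bar\alpha:B\to\hat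 C$ are homomorphisms and $C\subseteq\hat C$ is a closed subalgebra with $(\alpha-\bar\alpha)(B)\subseteq C$, $\alpha(B)C\subseteq C$, $C\alpha(B)\subseteq C$ (a *quasihomomorphism*), then a split exact $H$ yields $H(\alpha,\bar\alpha):H(B)\to H(C)$, the unique homomorphism whose composition with the map induced by the inclusion $C\to\{(b,x)\in B\times\hat C: x-\alpha(b)\in C\}$, $x\mapsto(0,x)$, is $H(\mathrm{id},\alpha)-H(\mathrm{id},\bar\alpha)$. Setting. Let $A$ be a unital $C^*$-algebra, $E$ a full right Hilbert $A$-module with an injective representation of $A$ by adjointable operators, $\mathcal O_E$ its Pimsner algebra and $\xi\mapsto S_\xi$ the canonical map $E\to\mathcal O_E$. Let $D\subseteq\mathcal O_E$ be a self-adjoint subalgebra with unit $1_A$ that is a locally convex algebra for some topology, such that $\mathcal A:=D\cap A$ is complete in the topology of $D$. Put $\mathcal E=\{\xi\in E: S_\xi\in D\}$ and $\bar S_\xi=S_\xi^*$. Let $\mathcal T^\infty_D$ be the closed subalgebra of $D\otimes_\pi\mathcal T^\infty$ generated by $\mathcal A\otimes 1$, $\{S_\xi\otimes S:\xi\in\mathcal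 E\}$ and $\{\bar S_\xi\otimes\bar S:\xi\in\mathcal E\}$, and $\iota:\mathcal A\to\mathcal T^\infty_D$, $a\mapsto a\otimes 1$. Let $\alpha:\mathcal T^\infty_D\to D\otimes_\pi\mathcal T^\infty$ be the inclusion, $\bar\alpha(x)=(1\otimes S)x(1\otimes\bar S)$, and let $C$ be the smallest closed subalgebra of $D\otimes_\pi\mathcal T^\infty$ that contains $(\alpha-\bar\alpha)(\mathcal T^\infty_D)$ and is stable under left and right multiplication by $\mathcal T^\infty_D$, so that $(\alpha,\bar\alpha)$ is a quasihomomorphism from $\mathcal T^\infty_D$ to $C$. Let $\iota_C:\mathcal A\to C$, $a\mapsto a\otimes e$. $D$ is *tame* if there are an integer $l\ge1$ and, for each degree $n\ge1$, $l$ tuples $\xi=(\xi_1,\dots,\xi_n)\in\mathcal E^n$, such that, with $S_\xi=S_{\xi_1}\cdots S_{\xi_n}$ and $\bar S_\xi=S_\xi^*$, for every $n$ the $l$ products $S_\xi\bar S_\xi$ of degree $n$ sum to $1$, and such that, when the tuples are listed by increasing degree as $\xi^{(0)},\xi^{(1)},\dots$, the sequences $p(S_{\xi^{(i)}})$ and $p(\bar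 S_{\xi^{(i)}})$ are of at most polynomial growth in $i$ for every continuous seminorm $p$ on $D$. Theorem. Let $H$ be a split exact functor from locally convex algebras to abelian groups and $y:=H(\alpha,\bar\alpha):H(\mathcal T^\infty_D)\to H(C)$. (i) If $H(\iota_C):H(\mathcal A)\to H(C)$ is right invertible, then $y$ is right invertible. (ii) If $H$ is diffotopy invariant and $\mathcal K^\infty$-stable and $D$ is tame, then $y$ is left invertible. (iii) If $H$ is diffotopy invariant and $\mathcal K^\infty$-stable and $D$ is tame, then $H(\iota):H(\mathcal A)\to H(\mathcal T^\infty_D)$ is an isomorphism. -/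

import Mathlib

open Topology CategoryTheory Filter
open scoped unitInterval TensorProduct ENNReal

set_option linter.unusedSectionVars false

universe u v w

/-- A *locally convex algebra*: a complete Hausdorff locally convex complex vector space with a
jointly continuous (associative, not necessarily unital) multiplication. -/
class IsLCAlg (A : Type*) [NonUnitalRing A] [Module ℂ A] [UniformSpace A] : Prop extends
  IsScalarTower ℂ A A, SMulCommClass ℂ A A, IsUniformAddGroup A, ContinuousMul A,
  ContinuousSMul ℂ A, LocallyConvexSpace ℝ A, CompleteSpace A, T2Space A

instance (priority := 100) IsLCAlg.isTopologicalRing (A : Type*) [NonUnitalRing A] [Module ℂ A]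
    [UniformSpace A] [IsLCAlg A] : IsTopologicalRing A where

/-- The objects of the category of locally convex algebras. -/
structure LCAlg where
  carrier : Type u
  [ring : NonUnitalRing carrier]
  [module : Module ℂ carrier]
  [uniform : UniformSpace carrier]
  [isLCAlg : IsLCAlg carrier]

namespace LCAlg

instance : CoeSort LCAlg.{u} (Type u) := ⟨carrier⟩

attribute [instance] ring module uniform isLCAlg

/-- The morphisms of locally convex algebras: continuous homomorphisms of (non-unital) complex
algebras. -/
structure Hom (A B : LCAlg.{u}) where
  toAlgHom : A →ₙₐ[ℂ] B
  cont : Continuous toAlgHom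

instance : Category LCAlg.{u} where
  Hom := Hom
  id A := ⟨NonUnitalAlgHom.id ℂ A, continuous_id⟩
  comp f g := ⟨g.toAlgHom.comp f.toAlgHom, g.cont.comp f.cont⟩

/-- The underlying map of a morphism. -/
def ap {A B : LCAlg.{u}} (f : A ⟶ B) : A → B := Hom.toAlgHom f

/-- Construct a morphism. -/
def mkHom {A B : LCAlg.{u}} (f : A →ₙₐ[ℂ] B) (hf : Continuous f) : A ⟶ B := (⟨f, hf⟩ : Hom A B)

section
variable {A B : LCAlg.{u}} (f : A ⟶ B)
theorem ap_mul (x y : A) : ap f (x * y) = ap f x * ap f y := map_mul (Hom.toAlgHom f) x y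
theorem ap_add (x y : A) : ap f (x + y) = ap f x + ap f y := map_add (Hom.toAlgHom f) x y
theorem ap_smul (c : ℂ) (x : A) : ap f (c • x) = c • ap f x := map_smul (Hom.toAlgHom f) c x
theorem ap_zero : ap f 0 = 0 := map_zero (Hom.toAlgHom f)
theorem ap_continuous : Continuous (ap f) := Hom.cont f
end

end LCAlg

section general
variable {A : Type*} [NonUnitalRing A] [Module ℂ A] [UniformSpace A]

/-- An algebra with the initial uniformity for a map onto a complete subset is again such. -/
theorem IsLCAlg.of_inducing {A : Type*} [NonUnitalRing A] [Module ℂ A] [IsScalarTower ℂ A A]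
    [SMulCommClass ℂ A A] [UniformSpace A] [ContinuousMul A]
    {F : Type*} [AddCommGroup F] [Module ℂ F] [UniformSpace F] [IsUniformAddGroup F]
    [ContinuousSMul ℂ F] [LocallyConvexSpace ℝ F] [T2Space F]
    (f : A →ₗ[ℂ] F) (hf : IsUniformInducing f) (hinj : Function.Injective f)
    (hc : IsComplete (Set.range f)) : IsLCAlg A where
  toIsUniformAddGroup := hf.isUniformAddGroup f
  toContinuousSMul := hf.isInducing.continuousSMul continuous_id (map_smul f _ _)
  toLocallyConvexSpace :=
    Topology.IsInducing.locallyConvexSpace (f := f.restrictScalars ℝ) hf.isInducing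
  toCompleteSpace := (completeSpace_iff_isComplete_range hf).2 hc
  toT2Space := (IsEmbedding.mk hf.isInducing hinj).t2Space

theorem continuousSMul_real (E : Type*) [AddCommGroup E] [Module ℂ E] [TopologicalSpace E]
    [ContinuousSMul ℂ E] : ContinuousSMul ℝ E :=
  IsScalarTower.continuousSMul ℂ

/-- In a locally convex space the topology is given by the continuous seminorms. -/
theorem polynormable_of_locallyConvex (E : Type*) [AddCommGroup E] [Module ℂ E]
    [TopologicalSpace E] [IsTopologicalAddGroup E] [ContinuousSMul ℂ E] [LocallyConvexSpace ℝ E] :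
    PolynormableSpace ℂ E := by
  open scoped ComplexOrder in
  have := continuousSMul_real E
  have : LocallyConvexSpace ℂ E := by
    refine LocallyConvexSpace.ofBasisZero ℂ E _ _ (LocallyConvexSpace.convex_basis_zero ℝ E) ?_
    intro s hs
    exact convex_of_nonneg_surjective_algebraMap _
        (fun _ hz => RCLike.nonneg_iff_exists_ofReal.mp hz) hs.2
  infer_instance
end general

namespace LCAlg

/-- A closed subalgebra of a locally convex algebra, with the subspace topology. -/
abbrev ofClosed (B : LCAlg.{u}) (S : NonUnitalSubalgebra ℂ B) (hS : IsClosed (S : Set B)) :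
    LCAlg.{u} :=
  haveI : ContinuousMul S :=
    IsInducing.continuousMul (NonUnitalSubalgebraClass.subtype S) IsInducing.subtypeVal
  haveI : IsLCAlg S := IsLCAlg.of_inducing S.toSubmodule.subtype (isUniformInducing_val (S : Set B))
    Subtype.val_injective (by
      have : Set.range S.toSubmodule.subtype = (S : Set B) := Subtype.range_coe
      rw [this]; exact hS.isComplete)
  ⟨S⟩

/-- The inclusion of a closed subalgebra. -/
def incl (B : LCAlg.{u}) (S : NonUnitalSubalgebra ℂ B) (hS : IsClosed (S : Set B)) :
    ofClosed B S hS ⟶ B :=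
  mkHom (NonUnitalSubalgebraClass.subtype S) continuous_subtype_val

/-- Restricting the range of a morphism to a closed subalgebra. -/
def codRestrict {A B : LCAlg.{u}} (f : A ⟶ B) (S : NonUnitalSubalgebra ℂ B)
    (hS : IsClosed (S : Set B)) (h : ∀ a, ap f a ∈ S) : A ⟶ ofClosed B S hS :=
  mkHom (NonUnitalAlgHom.codRestrict (Hom.toAlgHom f) S h) ((Hom.cont f).subtype_mk h)

instance (A B : LCAlg.{u}) : IsLCAlg (A × B) where

/-- The product of two locally convex algebras. -/
abbrev prod (A B : LCAlg.{u}) : LCAlg.{u} := ⟨A × B⟩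

end LCAlg

/-- A functor `H` from locally convex algebras to abelian groups is *split exact* if it maps every
extension of locally convex algebras `0 → A → B → C → 0` (so `i` is a homeomorphism onto the kernel
of `q`) that is split by a morphism `s : C ⟶ B` to a short exact sequence. -/
def SplitExact (H : LCAlg.{u} ⥤ AddCommGrpCat.{v}) : Prop :=
  ∀ (A B C : LCAlg.{u}) (i : A ⟶ B) (q : B ⟶ C) (s : C ⟶ B),
    IsEmbedding (LCAlg.ap i) → (∀ b, LCAlg.ap q b = 0 ↔ b ∈ Set.range (LCAlg.ap i)) →
    s ≫ q = 𝟙 C →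
    Function.Injective (H.map i) ∧ Function.Exact (H.map i) (H.map q) ∧
      Function.Surjective (H.map q)

/-- A *quasihomomorphism* `(α, β) : A ⇉ B̂ ⊵ B`, for a closed subalgebra `B` of `B̂`. -/
structure QuasiHom (A Bhat : LCAlg.{u}) where
  B : NonUnitalSubalgebra ℂ Bhat
  isClosed : IsClosed (B : Set Bhat)
  α : A ⟶ Bhat
  β : A ⟶ Bhat
  sub_mem : ∀ a, LCAlg.ap α a - LCAlg.ap β a ∈ B
  mul_mem_left : ∀ a, ∀ b ∈ B, LCAlg.ap α a * b ∈ B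
  mul_mem_right : ∀ a, ∀ b ∈ B, b * LCAlg.ap α a ∈ B

namespace QuasiHom
open LCAlg
variable {A Bhat : LCAlg.{u}} (Q : QuasiHom A Bhat)

/-- The ideal `B`, as a locally convex algebra. -/
abbrev target : LCAlg.{u} := LCAlg.ofClosed Bhat Q.B Q.isClosed

/-- The subalgebra `{(a, x) | x - α a ∈ B}` of `A × B̂`. -/
def extSub : NonUnitalSubalgebra ℂ (A × Bhat) where
  carrier := {p | p.2 - ap Q.α p.1 ∈ Q.B}
  add_mem' {p q} hp hq := by
    have := Q.B.add_mem hp hq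
    have e : (p + q).2 - ap Q.α (p + q).1 = (p.2 - ap Q.α p.1) + (q.2 - ap Q.α q.1) := by
      rw [Prod.fst_add, Prod.snd_add, ap_add]; abel
    rw [Set.mem_ofPred_eq, e]; exact this
  zero_mem' := by
    rw [Set.mem_ofPred_eq, Prod.fst_zero, Prod.snd_zero, ap_zero, sub_zero]
    exact Q.B.zero_mem
  mul_mem' {p q} hp hq := by
    have := Q.B.add_mem (Q.B.add_mem (Q.mul_mem_left p.1 _ hq) (Q.mul_mem_right q.1 _ hp))
      (Q.B.mul_mem hp hq)
    have e : (p * q).2 - ap Q.α (p * q).1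
        = ap Q.α p.1 * (q.2 - ap Q.α q.1) + (p.2 - ap Q.α p.1) * ap Q.α q.1
          + (p.2 - ap Q.α p.1) * (q.2 - ap Q.α q.1) := by
      rw [Prod.fst_mul, Prod.snd_mul, ap_mul]; noncomm_ring
    rw [Set.mem_ofPred_eq, e]; exact this
  smul_mem' c p hp := by
    rw [Set.mem_ofPred_eq, Prod.smul_fst, Prod.smul_snd, ap_smul, ← smul_sub]
    exact Q.B.smul_mem c hp

theorem isClosed_extSub : IsClosed (Q.extSub : Set (A × Bhat)) := by
  have : Continuous fun p : A × Bhat => p.2 - ap Q.α p.1 :=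
    continuous_snd.sub ((ap_continuous Q.α).comp continuous_fst)
  exact Q.isClosed.preimage this

/-- The extension of `A` by `B` defined by the quasihomomorphism. -/
abbrev ext : LCAlg.{u} := LCAlg.ofClosed (LCAlg.prod A Bhat) Q.extSub Q.isClosed_extSub

/-- The inclusion `B ⟶ ext`, `b ↦ (0, b)`. -/
def extIncl : Q.target ⟶ Q.ext :=
  codRestrict (mkHom (B := LCAlg.prod A Bhat)
    ((NonUnitalAlgHom.inr ℂ A Bhat).comp (NonUnitalSubalgebraClass.subtype Q.B))
    (Continuous.prodMk continuous_const continuous_subtype_val)) _ Q.isClosed_extSub (by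
      intro b
      change (b.1 : Bhat) - ap Q.α 0 ∈ Q.B
      rw [ap_zero, sub_zero]
      exact b.2)

/-- The projection `ext ⟶ A`. -/
def extProj : Q.ext ⟶ A :=
  mkHom ((NonUnitalAlgHom.fst ℂ A Bhat).comp (NonUnitalSubalgebraClass.subtype Q.extSub))
    (continuous_fst.comp continuous_subtype_val)

/-- The section `a ↦ (a, α a)`. -/
def secα : A ⟶ Q.ext :=
  codRestrict (mkHom (B := LCAlg.prod A Bhat)
    ((NonUnitalAlgHom.id ℂ A).prod (Hom.toAlgHom Q.α)) (continuous_id.prodMk (Hom.cont Q.α)))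
    _ Q.isClosed_extSub (by
      intro a
      change ap Q.α a - ap Q.α a ∈ Q.B
      rw [sub_self]
      exact Q.B.zero_mem)

/-- The section `a ↦ (a, β a)`. -/
def secβ : A ⟶ Q.ext :=
  codRestrict (mkHom (B := LCAlg.prod A Bhat)
    ((NonUnitalAlgHom.id ℂ A).prod (Hom.toAlgHom Q.β)) (continuous_id.prodMk (Hom.cont Q.β)))
    _ Q.isClosed_extSub (by
      intro a
      change ap Q.β a - ap Q.α a ∈ Q.B
      rw [← neg_sub]
      exact neg_mem (Q.sub_mem a))

theorem secα_proj : Q.secα ≫ Q.extProj = 𝟙 A := rfl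
theorem secβ_proj : Q.secβ ≫ Q.extProj = 𝟙 A := rfl

theorem exact_of_splitExact {H : LCAlg.{u} ⥤ AddCommGrpCat.{v}} (hH : SplitExact H) :
    Function.Injective (H.map Q.extIncl) ∧ Function.Exact (H.map Q.extIncl) (H.map Q.extProj) ∧
      Function.Surjective (H.map Q.extProj) := by
  refine hH _ _ _ Q.extIncl Q.extProj Q.secα ?_ ?_ Q.secα_proj
  · refine IsEmbedding.of_comp (ap_continuous Q.extIncl)
      (g := fun p : Q.extSub => (p : A × Bhat).2) ?_ ?_
    · exact continuous_snd.comp continuous_subtype_val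
    · exact (IsEmbedding.subtypeVal : IsEmbedding (Subtype.val : Q.B → Bhat))
  · intro b
    constructor
    · intro h
      have h' : (b.1 : A × Bhat).1 = 0 := h
      have hb : (b.1 : A × Bhat).2 - ap Q.α (b.1 : A × Bhat).1 ∈ Q.B := b.2
      rw [h', ap_zero, sub_zero] at hb
      refine ⟨⟨_, hb⟩, ?_⟩
      apply Subtype.ext
      exact Prod.ext h'.symm rfl
    · rintro ⟨a, rfl⟩
      rfl

theorem exists_lift {H : LCAlg.{u} ⥤ AddCommGrpCat.{v}} (hH : SplitExact H) (x : H.obj A) :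
    ∃ y : H.obj Q.target, H.map Q.extIncl y = H.map Q.secα x - H.map Q.secβ x :=
  ((Q.exact_of_splitExact hH).2.1 _).1 (by
    rw [map_sub, ← ConcreteCategory.comp_apply, ← ConcreteCategory.comp_apply,
      ← H.map_comp, ← H.map_comp, Q.secα_proj, Q.secβ_proj, sub_self])

/-- The homomorphism `H(α, β) : H(A) ⟶ H(B)` induced by a quasihomomorphism under a split exact
functor: the unique `y` with `H(B ⟶ ext) ∘ y = H(id, α) - H(id, β)`. -/
noncomputable def map (H : LCAlg.{u} ⥤ AddCommGrpCat.{v}) (hH : SplitExact H) :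
    H.obj A ⟶ H.obj Q.target :=
  AddCommGrpCat.ofHom (AddMonoidHom.mk' (fun x => (Q.exists_lift hH x).choose) (by
    intro x y
    apply (Q.exact_of_splitExact hH).1
    refine (Q.exists_lift hH (x + y)).choose_spec.trans ?_
    rw [map_add (ConcreteCategory.hom (H.map Q.extIncl)), (Q.exists_lift hH x).choose_spec,
      (Q.exists_lift hH y).choose_spec, map_add, map_add]
    abel))

theorem map_extIncl (H : LCAlg.{u} ⥤ AddCommGrpCat.{v}) (hH : SplitExact H) :
    Q.map H hH ≫ H.map Q.extIncl = H.map Q.secα - H.map Q.secβ := by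
  ext x
  exact (Q.exists_lift hH x).choose_spec

/-- For a set `X` and a set `Y` in `B`, the smallest closed subalgebra of `B` that contains `Y` and
is stable under left and right multiplication by `X`. -/
def stableHull (B : LCAlg.{u}) (X Y : Set B) : NonUnitalSubalgebra ℂ B :=
  sInf {S | IsClosed (S : Set B) ∧ Y ⊆ S ∧ ∀ x ∈ X, ∀ y ∈ S, x * y ∈ S ∧ y * x ∈ S}

theorem isClosed_stableHull (B : LCAlg.{u}) (X Y : Set B) :
    IsClosed (stableHull B X Y : Set B) := by
  rw [stableHull, NonUnitalAlgebra.coe_sInf]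
  exact isClosed_biInter fun S hS => hS.1

/-- The quasihomomorphism associated to a pair `α, β : A ⟶ B̂`, with `B` the smallest closed
`α(A)`-stable subalgebra that contains `(α - β)(A)`. -/
def associated (α β : A ⟶ Bhat) : QuasiHom A Bhat where
  B := stableHull Bhat (Set.range (ap α)) (Set.range fun a => ap α a - ap β a)
  isClosed := isClosed_stableHull _ _ _
  α := α
  β := β
  sub_mem a := NonUnitalAlgebra.mem_sInf.2 fun _ hS => hS.2.1 ⟨a, rfl⟩
  mul_mem_left a b hb := NonUnitalAlgebra.mem_sInf.2 fun S hS =>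
    (hS.2.2 _ ⟨a, rfl⟩ b (NonUnitalAlgebra.mem_sInf.1 hb S hS)).1
  mul_mem_right a b hb := NonUnitalAlgebra.mem_sInf.2 fun S hS =>
    (hS.2.2 _ ⟨a, rfl⟩ b (NonUnitalAlgebra.mem_sInf.1 hb S hS)).2

end QuasiHom

section
variable (E : Type*) [AddCommGroup E] [Module ℂ E] [UniformSpace E] [IsUniformAddGroup E]
    [ContinuousSMul ℂ E]

instance instIsUniformAddGroupPath : IsUniformAddGroup C(I, E) :=
  ContinuousMap.isUniformEmbedding_toUniformOnFunIsCompact.isUniformInducing.isUniformAddGroup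
    (⟨⟨_, rfl⟩, fun _ _ => rfl⟩ : C(I, E) →+ UniformOnFun I E {K | IsCompact K})

instance instLocallyConvexSpacePath [LocallyConvexSpace ℝ E] : LocallyConvexSpace ℝ C(I, E) :=
  haveI := continuousSMul_real E
  ContinuousMap.instLocallyConvexSpace

variable {E}

/-- The continuous function `g : [0,1] → E` is the derivative of `f : [0,1] → E` (one-sided at the
endpoints). -/
def HasPathDeriv (f g : C(I, E)) : Prop :=
  ∀ t : I, Tendsto (fun s : I => (((s : ℝ) - t : ℝ) : ℂ)⁻¹ • (f s - f t)) (𝓝[≠] t) (𝓝 (g t))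

theorem HasPathDeriv.mean_value {f g : C(I, E)} (h : HasPathDeriv f g) (p : Seminorm ℂ E)
    (hp : Continuous p) {a b : I} (hab : a ≤ b) (v : E) {ε : ℝ}
    (hε : ∀ r ∈ Set.Icc a b, p (g r - v) ≤ ε) :
    p (f b - f a - (((b : ℝ) - a : ℝ) : ℂ) • v) ≤ ε * ((b : ℝ) - a) := by
  let P : ℝ → I := Set.projIcc 0 1 zero_le_one
  have hP : ∀ x : I, P x = x := fun x => Set.projIcc_val _ x
  have hPc : Continuous P := continuous_projIcc
  let k : ℝ → E := fun r => f (P r) - f a - ((r - a : ℝ) : ℂ) • v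
  have hk : Continuous k := by fun_prop
  refine le_of_forall_pos_le_add fun δ hδ => ?_
  have key := image_le_of_liminf_slope_right_lt_deriv_boundary (f := fun r => p (k r))
    (f' := fun _ => ε) (a := (a : ℝ)) (b := b) (B := fun r => (ε + δ) * (r - a))
    (B' := fun _ => ε + δ) (hp.comp hk).continuousOn ?_ ?_ ?_ ?_
    (Set.right_mem_Icc.2 (show (a : ℝ) ≤ b from hab))
  · simp only [k, hP] at key
    have hb1 : (b : ℝ) - a ≤ 1 := by linarith [b.2.2, a.2.1]
    nlinarith
  · intro x hx r hr
    have hx01 : x ∈ Set.Icc (0 : ℝ) 1 := ⟨a.2.1.trans hx.1, hx.2.le.trans b.2.2⟩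
    let x' : I := ⟨x, hx01⟩
    have hPx : P x = x' := hP x'
    have t1 : Tendsto P (𝓝[>] x) (𝓝[≠] x') := by
      refine tendsto_nhdsWithin_iff.2 ⟨?_, ?_⟩
      · rw [← hPx]; exact (hPc.tendsto x).mono_left nhdsWithin_le_nhds
      · filter_upwards [Ioo_mem_nhdsGT hx.2] with z hz
        have : P z = ⟨z, hx01.1.trans hz.1.le, hz.2.le.trans b.2.2⟩ := hP ⟨z, _⟩
        rw [Set.mem_compl_singleton_iff, this]
        exact fun e => hz.1.ne' (congrArg Subtype.val e)
    have t2 := (hp.tendsto _).comp (((h x').comp t1).sub_const v)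
    have t3 : ∀ᶠ z in 𝓝[>] x, p ((((P z : ℝ) - x : ℝ) : ℂ)⁻¹ • (f (P z) - f x') - v) < r :=
      t2.eventually_lt_const (lt_of_le_of_lt (hε x' ⟨hx.1, hx.2.le⟩) hr)
    refine Eventually.frequently ?_
    filter_upwards [t3, Ioo_mem_nhdsGT hx.2] with z hz hz2
    have hPz : (P z : ℝ) = z := by
      have : P z = ⟨z, hx01.1.trans hz2.1.le, hz2.2.le.trans b.2.2⟩ := hP ⟨z, _⟩
      rw [this]
    have hpos : 0 < z - x := sub_pos.2 hz2.1
    rw [hPz] at hz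
    refine lt_of_le_of_lt ?_ hz
    have e : k z - k x = ((z - x : ℝ) : ℂ) • ((((z - x : ℝ)) : ℂ)⁻¹ • (f (P z) - f x') - v) := by
      have hne : ((z - x : ℝ) : ℂ) ≠ 0 := by exact_mod_cast hpos.ne'
      rw [smul_sub, smul_inv_smul₀ hne]
      simp only [k, hPx]
      have : ((z - x : ℝ) : ℂ) = ((z - a : ℝ) : ℂ) - ((x - a : ℝ) : ℂ) := by push_cast; ring
      rw [this, sub_smul]
      abel
    have e2 : p (k z) - p (k x) ≤ (z - x) * p ((((z - x : ℝ)) : ℂ)⁻¹ • (f (P z) - f x') - v) := by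
      refine (le_abs_self _).trans ((abs_sub_map_le_sub p _ _).trans ?_)
      rw [e, map_smul_eq_mul, Complex.norm_real, Real.norm_of_nonneg hpos.le]
    rw [slope_def_field, div_le_iff₀ hpos, mul_comm]
    exact e2
  · simp [k, hP]
  · intro x
    simpa using ((hasDerivAt_id x).sub_const (a : ℝ)).const_mul (ε + δ)
  · intro x _ _
    simpa using hδ

theorem HasPathDeriv.of_mean_value [LocallyConvexSpace ℝ E] {f g : C(I, E)}
    (h : ∀ p : Seminorm ℂ E, Continuous p → ∀ a b : I, a ≤ b → ∀ v : E, ∀ ε : ℝ,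
      (∀ r ∈ Set.Icc a b, p (g r - v) ≤ ε) →
        p (f b - f a - (((b : ℝ) - a : ℝ) : ℂ) • v) ≤ ε * ((b : ℝ) - a)) :
    HasPathDeriv f g := by
  intro t
  have hpoly := polynormable_of_locallyConvex E
  rw [(PolynormableSpace.withSeminorms ℂ E).tendsto_nhds]
  rintro ⟨p, hp⟩ ε hε
  have c : Continuous fun s => p (g s - g t) := hp.comp (by fun_prop)
  have hnhds : {s | p (g s - g t) < ε / 2} ∈ 𝓝 t :=
    (isOpen_lt c continuous_const).mem_nhds (by simpa using hε)
  obtain ⟨δ, hδ, hball⟩ := Metric.mem_nhds_iff.1 hnhds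
  filter_upwards [self_mem_nhdsWithin, nhdsWithin_le_nhds (Metric.ball_mem_nhds t hδ)] with s hs hs2
  have hst : (s : ℝ) - t ≠ 0 := sub_ne_zero.2 fun e => hs (Subtype.ext e)
  have hstc : (((s : ℝ) - t : ℝ) : ℂ) ≠ 0 := by exact_mod_cast hst
  have e : (((s : ℝ) - t : ℝ) : ℂ)⁻¹ • (f s - f t) - g t
      = (((s : ℝ) - t : ℝ) : ℂ)⁻¹ • (f s - f t - (((s : ℝ) - t : ℝ) : ℂ) • g t) := by
    rw [smul_sub _ (f s - f t), inv_smul_smul₀ hstc]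
  have main : p (f s - f t - (((s : ℝ) - t : ℝ) : ℂ) • g t) ≤ ε / 2 * |(s : ℝ) - t| := by
    have hd : |(s : ℝ) - t| < δ := hs2
    rcases le_total t s with hle | hle
    · rw [abs_of_nonneg (sub_nonneg.2 (show (t : ℝ) ≤ s from hle))] at hd ⊢
      refine h p hp t s hle (g t) (ε / 2) fun r hr => (hball ?_ : p (g r - g t) < ε / 2).le
      have h1 : (t : ℝ) ≤ r := hr.1
      have h2 : (r : ℝ) ≤ s := hr.2
      change |(r : ℝ) - t| < δ
      rw [abs_of_nonneg (by linarith)]; linarith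
    · rw [abs_of_nonpos (sub_nonpos.2 (show (s : ℝ) ≤ t from hle))] at hd ⊢
      have := h p hp s t hle (g t) (ε / 2) fun r hr => by
        refine (hball ?_ : p (g r - g t) < ε / 2).le
        have h1 : (s : ℝ) ≤ r := hr.1
        have h2 : (r : ℝ) ≤ t := hr.2
        change |(r : ℝ) - t| < δ
        rw [abs_of_nonpos (by linarith)]; linarith
      rw [← map_neg_eq_map]
      convert this using 2
      · have : (((t : ℝ) - s : ℝ) : ℂ) = -(((s : ℝ) - t : ℝ) : ℂ) := by push_cast; ring
        rw [this, neg_smul]; abel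
      · ring
  change p ((((s : ℝ) - t : ℝ) : ℂ)⁻¹ • (f s - f t) - g t) < ε
  rw [e, map_smul_eq_mul, norm_inv, Complex.norm_real, Real.norm_eq_abs]
  have := mul_le_mul_of_nonneg_left main (inv_nonneg.2 (abs_nonneg ((s : ℝ) - t)))
  have hne := (abs_pos.2 hst).ne'
  rw [show |(s : ℝ) - t|⁻¹ * (ε / 2 * |(s : ℝ) - t|) = ε / 2 by field_simp] at this
  linarith

theorem isClosed_hasPathDeriv [LocallyConvexSpace ℝ E] :
    IsClosed {q : C(I, E) × C(I, E) | HasPathDeriv q.1 q.2} := by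
  have : {q : C(I, E) × C(I, E) | HasPathDeriv q.1 q.2} =
      ⋂ (p : Seminorm ℂ E) (_ : Continuous p) (a : I) (b : I) (_ : a ≤ b) (v : E) (η : ℝ)
        (w : ℝ) (_ : 0 < w),
        {q : C(I, E) × C(I, E) | ∀ r ∈ Set.Icc a b, p (q.2 r - v) < η + w}ᶜ ∪
        {q : C(I, E) × C(I, E) | p (q.1 b - q.1 a - (((b : ℝ) - a : ℝ) : ℂ) • v)
          ≤ (η + w) * ((b : ℝ) - a)} := by
    ext ⟨f, g⟩
    simp only [Set.mem_iInter]
    constructor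
    · intro h p hp a b hab v η w hw
      by_cases hc : ∀ r ∈ Set.Icc a b, p (g r - v) < η + w
      · exact Or.inr (h.mean_value p hp hab v fun r hr => (hc r hr).le)
      · exact Or.inl hc
    · intro h
      refine HasPathDeriv.of_mean_value fun p hp a b hab v ε hε => ?_
      refine le_of_forall_pos_le_add fun w hw => ?_
      rcases h p hp a b hab v ε w hw with h1 | h1
      · exact absurd (fun r hr => lt_of_le_of_lt (hε r hr) (by linarith)) h1
      · have h2 : p (f b - f a - (((b : ℝ) - a : ℝ) : ℂ) • v) ≤ (ε + w) * ((b : ℝ) - a) := h1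
        have hb1 : (b : ℝ) - a ≤ 1 := by linarith [b.2.2, a.2.1]
        nlinarith
  rw [this]
  refine isClosed_iInter fun p => isClosed_iInter fun hp => isClosed_iInter fun a =>
    isClosed_iInter fun b => isClosed_iInter fun hab => isClosed_iInter fun v =>
    isClosed_iInter fun η => isClosed_iInter fun w => isClosed_iInter fun hw =>
    IsClosed.union ?_ ?_
  · rw [isClosed_compl_iff]
    have hU : IsOpen {x : E | p (x - v) < η + w} :=
      isOpen_lt (hp.comp (by fun_prop)) continuous_const
    exact (ContinuousMap.isOpen_setOfPred_mapsTo isCompact_Icc hU).preimage continuous_snd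
  · have cb : ∀ t : I, Continuous fun q : C(I, E) × C(I, E) => q.1 t := fun t =>
      (continuous_eval_const t).comp continuous_fst
    exact isClosed_le (hp.comp (((cb b).sub (cb a)).sub continuous_const)) continuous_const

theorem HasPathDeriv.unique [T2Space E] {f g g' : C(I, E)} (h : HasPathDeriv f g)
    (h' : HasPathDeriv f g') : g = g' := by
  ext t
  have : (𝓝[≠] t).NeBot := ConnectedSpace.neBot_nhdsWithin_compl_of_nontrivial_of_t1space t
  exact tendsto_nhds_unique (h t) (h' t)

theorem HasPathDeriv.add {f g f' g' : C(I, E)} (h : HasPathDeriv f g) (h' : HasPathDeriv f' g') :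
    HasPathDeriv (f + f') (g + g') := by
  intro t
  refine ((h t).add (h' t)).congr fun s => ?_
  rw [← smul_add]; congr 1
  simp only [ContinuousMap.add_apply]; abel

theorem HasPathDeriv.smul {f g : C(I, E)} (h : HasPathDeriv f g) (c : ℂ) :
    HasPathDeriv (c • f) (c • g) := by
  intro t
  refine ((h t).const_smul c).congr fun s => ?_
  rw [smul_comm]; congr 1
  simp only [ContinuousMap.smul_apply, smul_sub]

theorem HasPathDeriv.zero : HasPathDeriv (0 : C(I, E)) 0 := by
  intro t
  simpa using tendsto_const_nhds

end

namespace LCAlg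
variable (B : LCAlg.{u})

theorem _root_.HasPathDeriv.mul {B : LCAlg.{u}} {f g f' g' : C(I, B)} (h : HasPathDeriv f g)
    (h' : HasPathDeriv f' g') : HasPathDeriv (f * f') (g * f' + f * g') := by
  intro t
  have c : Tendsto (fun s => f' s) (𝓝[≠] t) (𝓝 (f' t)) :=
    (f'.continuous.tendsto t).mono_left nhdsWithin_le_nhds
  refine (((h t).mul c).add ((h' t).const_mul (f t))).congr fun s => ?_
  rw [smul_mul_assoc, mul_smul_comm, ← smul_add]; congr 1
  simp only [ContinuousMap.mul_apply]; noncomm_ring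

/-- The smooth functions `[0,1] → B` all of whose derivatives of order at least one vanish at the
endpoints; a function is given together with its derivatives `F 0 = f, F 1 = f', …`. The topology
is that of uniform convergence of all derivatives. -/
def smoothPaths : Submodule ℂ (ℕ → C(I, B)) where
  carrier := {F | ∀ n, HasPathDeriv (F n) (F (n + 1)) ∧ F (n + 1) 0 = 0 ∧ F (n + 1) 1 = 0}
  add_mem' {F G} hF hG n := ⟨(hF n).1.add (hG n).1, by
    simp [(hF n).2.1, (hG n).2.1], by simp [(hF n).2.2, (hG n).2.2]⟩
  zero_mem' n := ⟨HasPathDeriv.zero, rfl, rfl⟩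
  smul_mem' c F hF n := ⟨(hF n).1.smul c, by simp [(hF n).2.1], by simp [(hF n).2.2]⟩

theorem isClosed_smoothPaths : IsClosed (smoothPaths B : Set (ℕ → C(I, B))) := by
  have : (smoothPaths B : Set (ℕ → C(I, B))) = ⋂ n,
      {F : ℕ → C(I, B) | HasPathDeriv (F n) (F (n + 1))} ∩
        ({F | F (n + 1) 0 = 0} ∩ {F | F (n + 1) 1 = 0}) := by
    ext F; simp [smoothPaths]
  rw [this]
  refine isClosed_iInter fun n => IsClosed.inter ?_ (IsClosed.inter ?_ ?_)
  · exact isClosed_hasPathDeriv.preimage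
      (f := fun F : ℕ → C(I, B) => (F n, F (n + 1))) (by fun_prop)
  · exact isClosed_eq ((continuous_eval_const _).comp (continuous_apply _)) continuous_const
  · exact isClosed_eq ((continuous_eval_const _).comp (continuous_apply _)) continuous_const

variable {B}

/-- The derivatives of a product (Leibniz rule): `(FG)^(n+1) = (F'G)^(n) + (FG')^(n)`. -/
def leibniz : ℕ → (ℕ → C(I, B)) → (ℕ → C(I, B)) → C(I, B)
  | 0, F, G => F 0 * G 0
  | n + 1, F, G => leibniz n (fun k => F (k + 1)) G + leibniz n F (fun k => G (k + 1))

theorem leibniz_continuous (n : ℕ) :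
    Continuous fun p : (ℕ → C(I, B)) × (ℕ → C(I, B)) => leibniz n p.1 p.2 := by
  induction n with
  | zero =>
    exact ((continuous_apply (A := fun _ : ℕ => C(I, B)) 0).comp continuous_fst).mul
      ((continuous_apply (A := fun _ : ℕ => C(I, B)) 0).comp continuous_snd)
  | succ n ih =>
    exact (ih.comp (f := fun p : (ℕ → C(I, B)) × (ℕ → C(I, B)) => (fun k => p.1 (k + 1), p.2))
      (by fun_prop)).add
      (ih.comp (f := fun p : (ℕ → C(I, B)) × (ℕ → C(I, B)) => (p.1, fun k => p.2 (k + 1)))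
      (by fun_prop))

theorem leibniz_deriv (n : ℕ) (F G : ℕ → C(I, B)) (hF : ∀ k, HasPathDeriv (F k) (F (k + 1)))
    (hG : ∀ k, HasPathDeriv (G k) (G (k + 1))) :
    HasPathDeriv (leibniz n F G) (leibniz (n + 1) F G) := by
  induction n generalizing F G with
  | zero => exact (hF 0).mul (hG 0)
  | succ n ih => exact (ih _ _ (fun k => hF (k + 1)) hG).add (ih _ _ hF fun k => hG (k + 1))

theorem leibniz_zero_left (n : ℕ) (F G : ℕ → C(I, B)) (t : I) (h : ∀ k, F k t = 0) :
    leibniz n F G t = 0 := by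
  induction n generalizing F G with
  | zero => simp [leibniz, h]
  | succ n ih =>
    simp [leibniz, ih (fun k => F (k + 1)) G fun k => h (k + 1), ih F (fun k => G (k + 1)) h]

theorem leibniz_zero_right (n : ℕ) (F G : ℕ → C(I, B)) (t : I) (h : ∀ k, G k t = 0) :
    leibniz n F G t = 0 := by
  induction n generalizing F G with
  | zero => simp [leibniz, h]
  | succ n ih =>
    simp [leibniz, ih F (fun k => G (k + 1)) fun k => h (k + 1), ih (fun k => F (k + 1)) G h]

instance : Mul (smoothPaths B) where
  mul F G := ⟨fun n => leibniz n F G, fun n =>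
    ⟨leibniz_deriv n _ _ (fun k => (F.2 k).1) fun k => (G.2 k).1, by
      simp [leibniz, leibniz_zero_left n (fun k => F.1 (k + 1)) G 0 fun k => (F.2 k).2.1,
        leibniz_zero_right n F (fun k => G.1 (k + 1)) 0 fun k => (G.2 k).2.1], by
      simp [leibniz, leibniz_zero_left n (fun k => F.1 (k + 1)) G 1 fun k => (F.2 k).2.2,
        leibniz_zero_right n F (fun k => G.1 (k + 1)) 1 fun k => (G.2 k).2.2]⟩⟩

theorem smoothPaths_ext {F G : smoothPaths B} (h : F.1 0 = G.1 0) : F = G := by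
  apply Subtype.ext
  funext n
  induction n with
  | zero => exact h
  | succ n ih => exact (F.2 n).1.unique (ih ▸ (G.2 n).1)

instance : NonUnitalRing (smoothPaths B) where
  __ := (inferInstance : AddCommGroup (smoothPaths B))
  zero_mul F := smoothPaths_ext (zero_mul (F.1 0))
  mul_zero F := smoothPaths_ext (mul_zero (F.1 0))
  mul_assoc F G K := smoothPaths_ext (mul_assoc (F.1 0) (G.1 0) (K.1 0))
  left_distrib F G K := smoothPaths_ext (mul_add (F.1 0) (G.1 0) (K.1 0))
  right_distrib F G K := smoothPaths_ext (add_mul (F.1 0) (G.1 0) (K.1 0))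

instance : IsScalarTower ℂ (smoothPaths B) (smoothPaths B) :=
  ⟨fun c F G => smoothPaths_ext (smul_mul_assoc c (F.1 0) (G.1 0))⟩

instance : SMulCommClass ℂ (smoothPaths B) (smoothPaths B) :=
  ⟨fun c F G => smoothPaths_ext (mul_smul_comm c (F.1 0) (G.1 0)).symm⟩

instance : ContinuousMul (smoothPaths B) where
  continuous_mul := Continuous.subtype_mk (continuous_pi fun n => (leibniz_continuous n).comp
    ((continuous_subtype_val.comp continuous_fst).prodMk
      (continuous_subtype_val.comp continuous_snd))) _

instance : IsLCAlg (smoothPaths B) :=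
  IsLCAlg.of_inducing (smoothPaths B).subtype (isUniformInducing_val _) Subtype.val_injective
    (by
      have : Set.range (smoothPaths B).subtype = (smoothPaths B : Set (ℕ → C(I, B))) :=
        Subtype.range_coe
      rw [this]; exact (isClosed_smoothPaths B).isComplete)

variable (B)

/-- The locally convex algebra `ZB`. -/
abbrev Z : LCAlg.{u} := ⟨smoothPaths B⟩

/-- The evaluation `ZB ⟶ B` at `t ∈ [0,1]`. -/
def ev (t : I) : Z B ⟶ B :=
  mkHom
    { toFun := fun F => F.1 0 t
      map_smul' := fun _ _ => rfl
      map_zero' := rfl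
      map_add' := fun _ _ => rfl
      map_mul' := fun _ _ => rfl }
    ((continuous_eval_const t).comp ((continuous_apply 0).comp continuous_subtype_val))

end LCAlg

/-- A functor is *diffotopy invariant* if `H(ev_t)` does not depend on `t ∈ [0,1]`. -/
def DiffotopyInvariant (H : LCAlg.{u} ⥤ AddCommGrpCat.{v}) : Prop :=
  ∀ (A : LCAlg.{u}) (s t : I), H.map (A.ev s) = H.map (A.ev t)

section Completion
open UniformSpace UniformSpace.Completion

/-- The Hausdorff completion of a (non-unital) topological algebra. -/
def AlgCompletion (R : Type*) [UniformSpace R] : Type _ := Completion R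

namespace AlgCompletion

noncomputable instance (R : Type*) [UniformSpace R] : UniformSpace (AlgCompletion R) :=
  inferInstanceAs (UniformSpace (Completion R))
instance (R : Type*) [UniformSpace R] : CompleteSpace (AlgCompletion R) :=
  inferInstanceAs (CompleteSpace (Completion R))
instance (R : Type*) [UniformSpace R] : T2Space (AlgCompletion R) :=
  inferInstanceAs (T2Space (Completion R))

/-- The canonical map into the completion. -/
def of {R : Type*} [UniformSpace R] (x : R) : AlgCompletion R := (x : Completion R)

theorem isDenseInducing_of {R : Type*} [UniformSpace R] :
    IsDenseInducing (of : R → AlgCompletion R) := isDenseInducing_coe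

theorem continuous_of {R : Type*} [UniformSpace R] :
    Continuous (of : R → AlgCompletion R) := Completion.continuous_coe R

theorem denseRange_of {R : Type*} [UniformSpace R] :
    DenseRange (of : R → AlgCompletion R) := denseRange_coe

variable (R : Type*) [NonUnitalRing R] [UniformSpace R] [IsUniformAddGroup R]

noncomputable instance : AddCommGroup (AlgCompletion R) :=
  inferInstanceAs (AddCommGroup (Completion R))
instance : IsUniformAddGroup (AlgCompletion R) := inferInstanceAs (IsUniformAddGroup (Completion R))

variable {R}

theorem of_add (x y : R) : of (x + y) = of x + of y := Completion.coe_add x y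
theorem of_zero : of (0 : R) = 0 := Completion.coe_zero

/-- The canonical map into the completion, as a homomorphism of groups. -/
noncomputable def ofHom : R →+ AlgCompletion R := ⟨⟨of, of_zero⟩, of_add⟩

theorem isDenseInducing_ofHom : IsDenseInducing (ofHom : R →+ AlgCompletion R) :=
  isDenseInducing_of

variable [Module ℂ R] [ContinuousSMul ℂ R]

noncomputable instance : Module ℂ (AlgCompletion R) :=
  haveI := uniformContinuousConstSMul_of_continuousConstSMul ℂ R
  inferInstanceAs (Module ℂ (Completion R))

theorem of_smul (c : ℂ) (x : R) : of (c • x) = c • of x :=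
  haveI := uniformContinuousConstSMul_of_continuousConstSMul ℂ R
  Completion.coe_smul c x

theorem continuous_const_smul' (c : ℂ) : Continuous fun x : AlgCompletion R => c • x :=
  (Completion.uniformContinuous_map (α := R) (f := (c • ·))).continuous

instance : ContinuousSMul ℂ (AlgCompletion R) where
  continuous_smul := by
    let φ : ℂ →+ R →+ AlgCompletion R :=
      { toFun := fun c => ⟨⟨fun r => of (c • r), by rw [smul_zero, of_zero]⟩,
          fun x y => by simp only [smul_add, of_add]⟩
        map_zero' := by ext r; simp [of_zero]
        map_add' := fun c d => by ext r; simp [add_smul, of_add] }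
    have hφ : Continuous fun p : ℂ × R => φ p.1 p.2 := continuous_of.comp continuous_smul
    have di : IsDenseInducing (AddMonoidHom.id ℂ) := IsDenseEmbedding.id.isDenseInducing
    have hc := di.extend_Z_bilin (isDenseInducing_ofHom (R := R)) hφ
    convert hc using 1
    ext ⟨c, x⟩
    refine congrFun (denseRange_of.equalizer (continuous_const_smul' c)
      (hc.comp (Continuous.prodMk_right c)) (funext fun r => ?_)) x
    have := (di.prodMap (isDenseInducing_ofHom (R := R))).extend_eq hφ (c, r)
    exact (of_smul c r).symm.trans this.symm

instance [LocallyConvexSpace ℝ R] : LocallyConvexSpace ℝ (AlgCompletion R) := by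
  refine (locallyConvexSpace_iff_exists_convex_subset_zero ℝ _).2 fun U hU => ?_
  obtain ⟨V, hV, hVc, hVU⟩ := exists_mem_nhds_isClosed_subset hU
  have h0 : (of ⁻¹' V : Set R) ∈ 𝓝 (0 : R) := by
    apply continuous_of.continuousAt.preimage_mem_nhds
    rwa [of_zero]
  obtain ⟨W, hW, hWconv, hWV⟩ :=
    (locallyConvexSpace_iff_exists_convex_subset_zero ℝ R).1 inferInstance _ h0
  have := continuousSMul_real (AlgCompletion R)
  refine ⟨closure (of '' W), ?_, ?_, ?_⟩
  · rw [← of_zero]; exact isDenseInducing_of.closure_image_mem_nhds hW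
  · let L : R →ₗ[ℝ] AlgCompletion R :=
      { toFun := of, map_add' := of_add, map_smul' := fun c x => of_smul (c : ℂ) x }
    exact (hWconv.linear_image L).closure
  · exact (closure_minimal (Set.image_subset_iff.2 hWV) hVc).trans hVU

variable [ContinuousMul R]

noncomputable instance : Mul (AlgCompletion R) :=
  ⟨fun x y => (isDenseInducing_of.prodMap isDenseInducing_of).extend
    (fun p : R × R => of (p.1 * p.2)) (x, y)⟩

theorem of_mul (x y : R) : of (x * y) = of x * of y :=
  ((isDenseInducing_of.prodMap isDenseInducing_of).extend_eq
    (continuous_of.comp continuous_mul) (x, y)).symm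

instance : ContinuousMul (AlgCompletion R) where
  continuous_mul := by
    let φ : R →+ R →+ AlgCompletion R :=
      { toFun := fun c => ⟨⟨fun r => of (c * r), by rw [mul_zero, of_zero]⟩,
          fun x y => by simp only [mul_add, of_add]⟩
        map_zero' := by ext r; simp [of_zero]
        map_add' := fun c d => by ext r; simp [add_mul, of_add] }
    have hφ : Continuous fun p : R × R => φ p.1 p.2 := continuous_of.comp continuous_mul
    exact (isDenseInducing_ofHom (R := R)).extend_Z_bilin (isDenseInducing_ofHom (R := R)) hφ

theorem eq_of_dense {f g : AlgCompletion R → AlgCompletion R} (hf : Continuous f)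
    (hg : Continuous g) (h : ∀ r : R, f (of r) = g (of r)) (x : AlgCompletion R) : f x = g x :=
  congrFun (denseRange_of.equalizer hf hg (funext h)) x

theorem mul_assoc' (x y z : AlgCompletion R) : x * y * z = x * (y * z) := by
  refine eq_of_dense ((continuous_id.mul continuous_const).mul continuous_const)
    (continuous_id.mul continuous_const) (fun a => ?_) x
  refine eq_of_dense ((continuous_const.mul continuous_id).mul continuous_const)
    (continuous_const.mul (continuous_id.mul continuous_const)) (fun b => ?_) y
  refine eq_of_dense (continuous_const.mul continuous_id)
    (continuous_const.mul (continuous_const.mul continuous_id)) (fun c => ?_) z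
  simp only [Pi.mul_apply, id_eq, ← of_mul, mul_assoc]

theorem mul_add' (x y z : AlgCompletion R) : x * (y + z) = x * y + x * z := by
  refine eq_of_dense (continuous_id.mul continuous_const)
    ((continuous_id.mul continuous_const).add (continuous_id.mul continuous_const))
    (fun a => ?_) x
  refine eq_of_dense (continuous_const.mul (continuous_id.add continuous_const))
    ((continuous_const.mul continuous_id).add continuous_const) (fun b => ?_) y
  refine eq_of_dense (continuous_const.mul (continuous_const.add continuous_id))
    (continuous_const.add (continuous_const.mul continuous_id)) (fun c => ?_) z
  simp only [Pi.mul_apply, Pi.add_apply, id_eq, ← of_mul, ← of_add, mul_add]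

theorem add_mul' (x y z : AlgCompletion R) : (x + y) * z = x * z + y * z := by
  refine eq_of_dense ((continuous_id.add continuous_const).mul continuous_const)
    ((continuous_id.mul continuous_const).add continuous_const) (fun a => ?_) x
  refine eq_of_dense ((continuous_const.add continuous_id).mul continuous_const)
    (continuous_const.add (continuous_id.mul continuous_const)) (fun b => ?_) y
  refine eq_of_dense (continuous_const.mul continuous_id)
    ((continuous_const.mul continuous_id).add (continuous_const.mul continuous_id))
    (fun c => ?_) z
  simp only [Pi.mul_apply, Pi.add_apply, id_eq, ← of_mul, ← of_add, add_mul]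

theorem zero_mul' (x : AlgCompletion R) : 0 * x = 0 := by
  refine eq_of_dense (continuous_const.mul continuous_id) continuous_const (fun a => ?_) x
  change 0 * of a = 0
  rw [← of_zero, ← of_mul, zero_mul]

theorem mul_zero' (x : AlgCompletion R) : x * 0 = 0 := by
  refine eq_of_dense (continuous_id.mul continuous_const) continuous_const (fun a => ?_) x
  change of a * 0 = 0
  rw [← of_zero, ← of_mul, mul_zero]

noncomputable instance : NonUnitalRing (AlgCompletion R) where
  __ := (inferInstance : AddCommGroup (AlgCompletion R))
  zero_mul := zero_mul'
  mul_zero := mul_zero'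
  mul_assoc := mul_assoc'
  left_distrib := mul_add'
  right_distrib := add_mul'

theorem smul_mul' [IsScalarTower ℂ R R] (c : ℂ) (x y : AlgCompletion R) :
    (c • x) * y = c • (x * y) := by
  refine eq_of_dense ((continuous_const_smul c).mul continuous_const)
    ((continuous_const_smul c).comp (continuous_id.mul continuous_const)) (fun a => ?_) x
  refine eq_of_dense (continuous_const.mul continuous_id)
    ((continuous_const_smul c).comp (continuous_const.mul continuous_id)) (fun b => ?_) y
  simp only [Pi.mul_apply, id_eq, Function.comp_apply, ← of_mul, ← of_smul, smul_mul_assoc]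

theorem mul_smul' [SMulCommClass ℂ R R] (c : ℂ) (x y : AlgCompletion R) :
    c • (x * y) = x * (c • y) := by
  refine eq_of_dense ((continuous_const_smul c).comp (continuous_id.mul continuous_const))
    (continuous_id.mul continuous_const) (fun a => ?_) x
  refine eq_of_dense ((continuous_const_smul c).comp (continuous_const.mul continuous_id))
    (continuous_const.mul (continuous_const_smul c)) (fun b => ?_) y
  simp only [Pi.mul_apply, id_eq, Function.comp_apply, ← of_mul, ← of_smul, mul_smul_comm]

instance [IsScalarTower ℂ R R] [SMulCommClass ℂ R R] [LocallyConvexSpace ℝ R] :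
    IsLCAlg (AlgCompletion R) where
  smul_assoc := smul_mul'
  smul_comm := mul_smul'

end AlgCompletion
end Completion

section Tensor

/-- The algebraic tensor product `A ⊗ B`, to be endowed with the projective topology. -/
def ProjTensor (A : LCAlg.{u}) (B : LCAlg.{w}) : Type (max u w) := A ⊗[ℂ] B

namespace ProjTensor
variable (A : LCAlg.{u}) (B : LCAlg.{w})

noncomputable instance : NonUnitalRing (ProjTensor A B) := inferInstanceAs (NonUnitalRing (A ⊗[ℂ] B))
noncomputable instance : Module ℂ (ProjTensor A B) := inferInstanceAs (Module ℂ (A ⊗[ℂ] B))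
instance : IsScalarTower ℂ (ProjTensor A B) (ProjTensor A B) :=
  inferInstanceAs (IsScalarTower ℂ (A ⊗[ℂ] B) (A ⊗[ℂ] B))
instance : SMulCommClass ℂ (ProjTensor A B) (ProjTensor A B) :=
  inferInstanceAs (SMulCommClass ℂ (A ⊗[ℂ] B) (A ⊗[ℂ] B))

variable {A B}

/-- A pure tensor. -/
noncomputable def tm (a : A) (b : B) : ProjTensor A B := a ⊗ₜ[ℂ] b

theorem tm_mul (a a' : A) (b b' : B) : tm a b * tm a' b' = tm (a * a') (b * b') :=
  Algebra.TensorProduct.tmul_mul_tmul a a' b b'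

@[elab_as_elim]
theorem ind {P : ProjTensor A B → Prop} (x : ProjTensor A B) (h0 : P 0)
    (ht : ∀ a b, P (tm a b)) (ha : ∀ x y, P x → P y → P (x + y)) : P x :=
  TensorProduct.induction_on x h0 ht ha

variable (A B)

/-- The seminorms that define the projective topology: all seminorms `r` on `A ⊗ B` with
`r (a ⊗ b) ≤ p a * q b` for some continuous seminorms `p` on `A` and `q` on `B`. -/
def seminorms : SeminormFamily ℂ (ProjTensor A B)
    {r : Seminorm ℂ (ProjTensor A B) // ∃ (p : Seminorm ℂ A) (q : Seminorm ℂ B),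
      Continuous p ∧ Continuous q ∧ ∀ a b, r (tm a b) ≤ p a * q b} := fun r => r.1

noncomputable instance : TopologicalSpace (ProjTensor A B) :=
  haveI : Nonempty {r : Seminorm ℂ (ProjTensor A B) // ∃ (p : Seminorm ℂ A) (q : Seminorm ℂ B),
      Continuous p ∧ Continuous q ∧ ∀ a b, r (tm a b) ≤ p a * q b} :=
    ⟨0, 0, 0, continuous_const, continuous_const, by simp⟩
  (seminorms A B).moduleFilterBasis.topology

theorem withSeminorms : WithSeminorms (seminorms A B) := ⟨rfl⟩

instance : IsTopologicalAddGroup (ProjTensor A B) := (withSeminorms A B).topologicalAddGroup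
instance : ContinuousSMul ℂ (ProjTensor A B) := (withSeminorms A B).continuousSMul
instance : LocallyConvexSpace ℝ (ProjTensor A B) := (withSeminorms A B).toLocallyConvexSpace
noncomputable instance : UniformSpace (ProjTensor A B) :=
  IsTopologicalAddGroup.rightUniformSpace _
instance : IsUniformAddGroup (ProjTensor A B) := isUniformAddGroup_of_addCommGroup

end ProjTensor

theorem exists_seminorm_of_mem_nhds {E : Type*} [AddCommGroup E] [Module ℂ E] [TopologicalSpace E]
    [IsTopologicalAddGroup E] [ContinuousSMul ℂ E] [LocallyConvexSpace ℝ E] {U : Set E}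
    (hU : U ∈ 𝓝 (0 : E)) : ∃ p : Seminorm ℂ E, Continuous p ∧ ∀ x, p x < 1 → x ∈ U := by
  have := polynormable_of_locallyConvex E
  obtain ⟨s, r, hr, h⟩ := ((PolynormableSpace.withSeminorms ℂ E).mem_nhds_iff 0 U).1 hU
  refine ⟨NNReal.mk r⁻¹ (inv_pos.2 hr).le •
    s.sup (fun p : {p : Seminorm ℂ E // Continuous p} => p.1), ?_, fun x hx => h ?_⟩
  · have : Continuous ⇑(s.sup (fun p : {p : Seminorm ℂ E // Continuous p} => p.1) : Seminorm ℂ E) := by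
      clear h
      induction s using Finset.cons_induction with
      | empty => exact continuous_const
      | cons a s ha ih =>
        rw [Finset.sup_cons]
        exact a.2.max ih
    exact continuous_const.mul this
  · rw [Seminorm.mem_ball_zero]
    have hx' : r⁻¹ * (s.sup (fun p : {p : Seminorm ℂ E // Continuous p} => p.1) : Seminorm ℂ E) x < 1 := hx
    rwa [inv_mul_lt_iff₀ hr, mul_one] at hx'

theorem LCAlg.exists_seminorm_mul (A : LCAlg.{u}) (p : Seminorm ℂ A) (hp : Continuous p) :
    ∃ q : Seminorm ℂ A, Continuous q ∧ ∀ a b, p (a * b) ≤ q a * q b := by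
  have hU : {z : A × A | p (z.1 * z.2) < 1} ∈ 𝓝 (0 : A × A) :=
    (isOpen_lt (hp.comp continuous_mul) continuous_const).mem_nhds (by simp)
  obtain ⟨U, hU1, V, hV1, hUV⟩ := mem_nhds_prod_iff.1 hU
  obtain ⟨q, hq, hqU⟩ := exists_seminorm_of_mem_nhds (Filter.inter_mem hU1 hV1)
  refine ⟨q, hq, fun a b => ?_⟩
  have key : ∀ δ > 0, p (a * b) ≤ (q a + δ) * (q b + δ) := by
    intro δ hδ
    have ha : 0 < q a + δ := add_pos_of_nonneg_of_pos (apply_nonneg q a) hδ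
    have hb : 0 < q b + δ := add_pos_of_nonneg_of_pos (apply_nonneg q b) hδ
    have aux : ∀ x : A, 0 < q x + δ → q (((q x + δ : ℝ) : ℂ)⁻¹ • x) < 1 := by
      intro x hx
      rw [map_smul_eq_mul, norm_inv, Complex.norm_real, Real.norm_of_nonneg hx.le,
        inv_mul_lt_iff₀ hx, mul_one]
      linarith
    have h1 : p ((((q a + δ : ℝ) : ℂ)⁻¹ • a) * (((q b + δ : ℝ) : ℂ)⁻¹ • b)) < 1 :=
      hUV (Set.mk_mem_prod (hqU _ (aux a ha)).1 (hqU _ (aux b hb)).2)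
    rw [smul_mul_smul_comm, map_smul_eq_mul, norm_mul, norm_inv, norm_inv, Complex.norm_real,
      Complex.norm_real, Real.norm_of_nonneg ha.le, Real.norm_of_nonneg hb.le, ← mul_inv,
      inv_mul_lt_iff₀ (mul_pos ha hb), mul_one] at h1
    exact h1.le
  have lim : Tendsto (fun δ : ℝ => (q a + δ) * (q b + δ)) (𝓝[>] 0) (𝓝 ((q a + 0) * (q b + 0))) :=
    (Continuous.tendsto (by fun_prop) 0).mono_left nhdsWithin_le_nhds
  rw [add_zero, add_zero] at lim
  exact ge_of_tendsto lim (eventually_nhdsWithin_of_forall key)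

namespace ProjTensor
variable {A : LCAlg.{u}} {B : LCAlg.{w}}

theorem tm_smul_add (a : A) (b b' : B) : tm a (b + b') = tm a b + tm a b' :=
  TensorProduct.tmul_add a b b'

/-- The projective tensor product of two seminorms: the largest seminorm `r` on `A ⊗ B` with
`r (a ⊗ b) ≤ p a * q b`. -/
noncomputable def projSeminorm (p : Seminorm ℂ A) (q : Seminorm ℂ B) :
    Seminorm ℂ (ProjTensor A B) :=
  sSup {r | ∀ a b, r (tm a b) ≤ p a * q b}

theorem bddAbove_proj (p : Seminorm ℂ A) (q : Seminorm ℂ B) :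
    BddAbove {r : Seminorm ℂ (ProjTensor A B) | ∀ a b, r (tm a b) ≤ p a * q b} := by
  rw [Seminorm.bddAbove_iff]
  have : ∀ x : ProjTensor A B, ∃ C : ℝ, ∀ r : Seminorm ℂ (ProjTensor A B),
      (∀ a b, r (tm a b) ≤ p a * q b) → r x ≤ C := by
    intro x
    induction x using ind with
    | h0 => exact ⟨0, fun r _ => by simp⟩
    | ht a b => exact ⟨_, fun r hr => hr a b⟩
    | ha x y hx hy =>
      obtain ⟨C, hC⟩ := hx
      obtain ⟨C', hC'⟩ := hy
      exact ⟨C + C', fun r hr => (map_add_le_add r x y).trans (add_le_add (hC r hr) (hC' r hr))⟩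
  choose C hC using this
  refine ⟨C, ?_⟩
  rintro _ ⟨r, hr, rfl⟩ x
  exact hC x r hr

theorem le_proj {p : Seminorm ℂ A} {q : Seminorm ℂ B} {r : Seminorm ℂ (ProjTensor A B)}
    (h : ∀ a b, r (tm a b) ≤ p a * q b) (x) : r x ≤ projSeminorm p q x :=
  le_csSup (bddAbove_proj p q) h x

theorem proj_tm (p : Seminorm ℂ A) (q : Seminorm ℂ B) (a : A) (b : B) :
    projSeminorm p q (tm a b) ≤ p a * q b := by
  rw [projSeminorm, Seminorm.sSup_apply (bddAbove_proj p q)]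
  have : Nonempty {r : Seminorm ℂ (ProjTensor A B) | ∀ a b, r (tm a b) ≤ p a * q b} :=
    ⟨0, fun a b => mul_nonneg (apply_nonneg p a) (apply_nonneg q b)⟩
  exact ciSup_le fun r => r.2 a b

theorem le_proj_smul {p : Seminorm ℂ A} {q : Seminorm ℂ B} {r : Seminorm ℂ (ProjTensor A B)}
    {C : ℝ} (hC : 0 ≤ C) (h : ∀ a b, r (tm a b) ≤ C * (p a * q b)) (x) :
    r x ≤ C * projSeminorm p q x := by
  refine (le_proj (p := NNReal.mk C hC • p) (q := q) (r := r) (fun a b => ?_) x).trans ?_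
  · exact (h a b).trans_eq (mul_assoc _ _ _).symm
  · rcases hC.eq_or_lt with rfl | hC'
    · rw [zero_mul]
      have : ∀ x : ProjTensor A B,
          projSeminorm (NNReal.mk 0 le_rfl • p) q x ≤ 0 := by
        intro x
        induction x using ind with
        | h0 => simp
        | ht a b => exact (proj_tm _ _ _ _).trans_eq (by simp)
        | ha x y hx hy => exact (map_add_le_add _ x y).trans (by linarith)
      exact this x
    · have := le_proj (p := p) (q := q)
        (r := NNReal.mk C⁻¹ (inv_pos.2 hC').le • projSeminorm (NNReal.mk C hC • p) q)
        (fun a b => ?_) x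
      · change C⁻¹ * _ ≤ _ at this
        rwa [inv_mul_le_iff₀ hC'] at this
      · change C⁻¹ * _ ≤ _
        rw [inv_mul_le_iff₀ hC', ← mul_assoc]
        exact proj_tm _ _ _ _

theorem exists_mul_bound (r : Seminorm ℂ (ProjTensor A B)) {p : Seminorm ℂ A} {q : Seminorm ℂ B}
    (hp : Continuous p) (hq : Continuous q) (h : ∀ a b, r (tm a b) ≤ p a * q b) :
    ∃ (p' : Seminorm ℂ A) (q' : Seminorm ℂ B), Continuous p' ∧ Continuous q' ∧
      ∀ x y, r (x * y) ≤ projSeminorm p' q' x * projSeminorm p' q' y := by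
  obtain ⟨p', hp', hpp'⟩ := A.exists_seminorm_mul p hp
  obtain ⟨q', hq', hqq'⟩ := B.exists_seminorm_mul q hq
  refine ⟨p', q', hp', hq', fun x y => ?_⟩
  have step1 : ∀ (x : ProjTensor A B) (a' : A) (b' : B),
      r (x * tm a' b') ≤ (p' a' * q' b') * projSeminorm p' q' x := by
    intro x a' b'
    refine le_proj_smul (r := r.comp (LinearMap.mulRight ℂ (tm a' b')))
      (mul_nonneg (apply_nonneg _ _) (apply_nonneg _ _)) (fun a b => ?_) x
    change r (tm a b * tm a' b') ≤ _
    rw [tm_mul]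
    refine (h _ _).trans ((mul_le_mul (hpp' a a') (hqq' b b') (apply_nonneg _ _)
      (mul_nonneg (apply_nonneg _ _) (apply_nonneg _ _))).trans_eq (by ring))
  refine le_proj_smul (r := r.comp (LinearMap.mulLeft ℂ x)) (apply_nonneg _ _) (fun a b => ?_) y
  exact (step1 x a b).trans_eq (mul_comm _ _)

theorem continuous_proj {p : Seminorm ℂ A} {q : Seminorm ℂ B} (hp : Continuous p)
    (hq : Continuous q) : Continuous (projSeminorm p q) :=
  (withSeminorms A B).continuous_seminorm ⟨projSeminorm p q, p, q, hp, hq, proj_tm p q⟩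

instance : ContinuousMul (ProjTensor A B) where
  continuous_mul := by
    refine continuous_iff_continuousAt.2 fun ⟨x₀, y₀⟩ => ?_
    refine ((withSeminorms A B).tendsto_nhds _ _).2 fun ⟨r, p, q, hp, hq, h⟩ ε hε => ?_
    obtain ⟨p', q', hp', hq', hb⟩ := exists_mul_bound r hp hq h
    have hc := continuous_proj hp' hq'
    have lim : Tendsto (fun z : ProjTensor A B × ProjTensor A B =>
        projSeminorm p' q' (z.1 - x₀) * projSeminorm p' q' z.2 +
          projSeminorm p' q' x₀ * projSeminorm p' q' (z.2 - y₀)) (𝓝 (x₀, y₀)) (𝓝 0) := by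
      have : Continuous (fun z : ProjTensor A B × ProjTensor A B =>
        projSeminorm p' q' (z.1 - x₀) * projSeminorm p' q' z.2 +
          projSeminorm p' q' x₀ * projSeminorm p' q' (z.2 - y₀)) :=
        ((hc.comp (continuous_fst.sub continuous_const)).mul (hc.comp continuous_snd)).add
          (continuous_const.mul (hc.comp (continuous_snd.sub continuous_const)))
      simpa using this.tendsto (x₀, y₀)
    filter_upwards [lim.eventually_lt_const hε] with z hz
    refine lt_of_le_of_lt ?_ hz
    have e : z.1 * z.2 - x₀ * y₀ = (z.1 - x₀) * z.2 + x₀ * (z.2 - y₀) := by noncomm_ring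
    change r (z.1 * z.2 - x₀ * y₀) ≤ _
    rw [e]
    exact (map_add_le_add r _ _).trans (add_le_add (hb _ _) (hb _ _))

theorem continuous_tm : Continuous fun z : A × B => tm z.1 z.2 := by
  refine continuous_iff_continuousAt.2 fun ⟨a₀, b₀⟩ => ?_
  refine ((withSeminorms A B).tendsto_nhds _ _).2 fun ⟨r, p, q, hp, hq, h⟩ ε hε => ?_
  have lim : Tendsto (fun z : A × B => p (z.1 - a₀) * q z.2 + p a₀ * q (z.2 - b₀))
      (𝓝 (a₀, b₀)) (𝓝 0) := by
    have : Continuous (fun z : A × B => p (z.1 - a₀) * q z.2 + p a₀ * q (z.2 - b₀)) :=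
      ((hp.comp (continuous_fst.sub continuous_const)).mul (hq.comp continuous_snd)).add
        (continuous_const.mul (hq.comp (continuous_snd.sub continuous_const)))
    simpa using this.tendsto (a₀, b₀)
  filter_upwards [lim.eventually_lt_const hε] with z hz
  refine lt_of_le_of_lt ?_ hz
  have e : tm z.1 z.2 - tm a₀ b₀ = tm (z.1 - a₀) z.2 + tm a₀ (z.2 - b₀) := by
    have h1 : tm (z.1 - a₀) z.2 = tm z.1 z.2 - tm a₀ z.2 := TensorProduct.sub_tmul _ _ _
    have h2 : tm a₀ (z.2 - b₀) = tm a₀ z.2 - tm a₀ b₀ := TensorProduct.tmul_sub _ _ _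
    rw [h1, h2]; abel
  change r (tm z.1 z.2 - tm a₀ b₀) ≤ _
  rw [e]
  exact (map_add_le_add r _ _).trans (add_le_add (h _ _) (h _ _))

end ProjTensor

namespace LCAlg

/-- The completed projective tensor product `A ⊗_π B` of locally convex algebras. -/
noncomputable abbrev tensor (A : LCAlg.{u}) (B : LCAlg.{w}) : LCAlg.{max u w} :=
  ⟨AlgCompletion (ProjTensor A B)⟩

variable {A : LCAlg.{u}} {B : LCAlg.{w}}

/-- The pure tensor `a ⊗ b` in `A ⊗_π B`. -/
noncomputable def tmul (a : A) (b : B) : tensor A B := AlgCompletion.of (ProjTensor.tm a b)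

theorem tmul_mul (a a' : A) (b b' : B) : tmul a b * tmul a' b' = tmul (a * a') (b * b') := by
  rw [tmul, tmul, tmul, ← ProjTensor.tm_mul, AlgCompletion.of_mul]

theorem continuous_tmul : Continuous fun z : A × B => tmul z.1 z.2 :=
  AlgCompletion.continuous_of.comp ProjTensor.continuous_tm

theorem tmul_add (a : A) (b b' : B) : tmul a (b + b') = tmul a b + tmul a b' := by
  rw [tmul, ProjTensor.tm_smul_add, AlgCompletion.of_add]; rfl

end LCAlg
end Tensor

section Rapid

variable {X J L N : Type}

/-- The space of rapidly decreasing families `(c i)` with respect to a weight `w`, with the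
seminorms `∑ i, (w i) ^ m * |c i|`. The family `c` is represented by the sequence of all the
`ℓ¹`-families `(w i) ^ m * c i`, so that the topology is the one induced from `∏ m, ℓ¹(X)`. -/
def Rapid (w : X → ℕ) : Submodule ℂ (ℕ → lp (fun _ : X => ℂ) 1) where
  carrier := {x | ∀ m i, x m i = (w i : ℂ) ^ m * x 0 i}
  zero_mem' m i := by simp
  add_mem' {x y} hx hy m i := by
    have h1 := hx m i
    have h2 := hy m i
    simp only [Pi.add_apply, lp.coeFn_add, h1, h2, mul_add]
  smul_mem' c x hx m i := by
    have h1 := hx m i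
    simp only [Pi.smul_apply, lp.coeFn_smul, h1, smul_eq_mul]
    ring

theorem continuous_lp_apply (i : X) : Continuous fun x : lp (fun _ : X => ℂ) 1 => x i := by
  refine LipschitzWith.continuous (K := 1) (LipschitzWith.of_dist_le_mul fun x y => ?_)
  rw [dist_eq_norm, dist_eq_norm, NNReal.coe_one, one_mul]
  exact lp.norm_apply_le_norm one_ne_zero (x - y) i

namespace Rapid
variable {w : X → ℕ} {wJ : J → ℕ} {wN : N → ℕ} {wL : L → ℕ}

theorem isClosed (w : X → ℕ) : IsClosed (Rapid w : Set (ℕ → lp (fun _ : X => ℂ) 1)) := by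
  have : (Rapid w : Set (ℕ → lp (fun _ : X => ℂ) 1)) =
      ⋂ m, ⋂ i, {x | x m i = (w i : ℂ) ^ m * x 0 i} := by
    ext x; simp only [Set.mem_iInter]; rfl
  rw [this]
  refine isClosed_iInter fun m => isClosed_iInter fun i => isClosed_eq ?_ ?_
  · exact (continuous_lp_apply i).comp (continuous_apply m)
  · exact continuous_const.mul ((continuous_lp_apply i).comp (continuous_apply 0))

/-- The coefficients of a rapidly decreasing family. -/
def cf (x : Rapid w) (i : X) : ℂ := x.1 0 i

theorem cf_add (x y : Rapid w) (i : X) : cf (x + y) i = cf x i + cf y i := rfl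
theorem cf_smul (c : ℂ) (x : Rapid w) (i : X) : cf (c • x) i = c * cf x i := rfl
theorem cf_sub (x y : Rapid w) (i : X) : cf (x - y) i = cf x i - cf y i := rfl
theorem cf_zero (i : X) : cf (0 : Rapid w) i = 0 := rfl

theorem apply_eq (x : Rapid w) (m : ℕ) (i : X) : x.1 m i = (w i : ℂ) ^ m * cf x i := x.2 m i

theorem ext {x y : Rapid w} (h : ∀ i, cf x i = cf y i) : x = y := by
  apply Subtype.ext; funext m; apply lp.ext; funext i
  rw [apply_eq, apply_eq, h]

/-- The weighted `ℓ¹`-norms of a family. -/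
noncomputable def wn (w : X → ℕ) (m : ℕ) (c : X → ℂ) : ℝ≥0∞ := ∑' i, (w i : ℝ≥0∞) ^ m * ‖c i‖ₑ

theorem memℓp_one {c : X → ℂ} (h : ∑' i, ‖c i‖ₑ ≠ ⊤) : Memℓp (E := fun _ : X => ℂ) c 1 := by
  refine memℓp_gen ?_
  have := ENNReal.summable_toReal h
  simpa using this

theorem lp_enorm (x : lp (fun _ : X => ℂ) 1) : ‖x‖ₑ = ∑' i, ‖x i‖ₑ := by
  have hs : Summable fun i => ‖x i‖ := by
    have := (lp.memℓp x).summable (by simp)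
    simpa using this
  have h : ‖x‖ = ∑' i, ‖x i‖ := by
    rw [lp.norm_eq_tsum_rpow (by simp)]; simp
  rw [← ofReal_norm, h, ENNReal.ofReal_tsum_of_nonneg (fun _ => norm_nonneg _) hs]
  simp only [ofReal_norm]

theorem enorm_weight (n m : ℕ) (z : ℂ) : ‖(n : ℂ) ^ m * z‖ₑ = (n : ℝ≥0∞) ^ m * ‖z‖ₑ := by
  rw [enorm_mul, enorm_pow]
  congr 2
  rw [← ofReal_norm, Complex.norm_natCast, ENNReal.ofReal_natCast]

theorem enorm_apply (x : Rapid w) (m : ℕ) : ‖x.1 m‖ₑ = wn w m (cf x) := by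
  rw [lp_enorm, wn]
  simp only [apply_eq, enorm_weight]

theorem wn_ne_top (x : Rapid w) (m : ℕ) : wn w m (cf x) ≠ ⊤ := by
  rw [← enorm_apply]; exact enorm_ne_top

/-- Construct an element from its coefficients. -/
def ofCf (c : X → ℂ) (h : ∀ m, wn w m c ≠ ⊤) : Rapid w :=
  ⟨fun m => ⟨fun i => (w i : ℂ) ^ m * c i, memℓp_one (by
    simp only [enorm_weight]; exact h m)⟩, fun m i => by simp⟩

theorem cf_ofCf (c : X → ℂ) (h : ∀ m, wn w m c ≠ ⊤) (i : X) : cf (ofCf c h) i = c i := by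
  change (w i : ℂ) ^ 0 * c i = c i
  simp

/-- The family with a single coefficient one. -/
noncomputable def single (i₀ : X) : Rapid w :=
  haveI := Classical.decEq X
  ofCf (fun i => if i = i₀ then 1 else 0) (fun m => by
    rw [wn, tsum_eq_single i₀ (by intro i hi; simp [hi])]
    simp only [if_true]
    exact ENNReal.mul_ne_top (ENNReal.pow_ne_top (ENNReal.natCast_ne_top _)) enorm_ne_top)

open Classical in
theorem cf_single (i₀ i : X) : cf (single i₀ : Rapid w) i = if i = i₀ then 1 else 0 := by
  rw [single, cf_ofCf]

/-- Index data for the bilinear maps `(c, d) ↦ (∑ l, c (a n l) * d (b n l))`. -/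
structure BilData (w : X → ℕ) (wJ : J → ℕ) (wN : N → ℕ) (wL : L → ℕ) where
  a : N → L → X
  b : N → L → J
  inj : ∀ l, Function.Injective fun n => (a n l, b n l)
  le : ∀ n l, wN n ≤ w (a n l) * wJ (b n l)
  leL : ∀ n l, wL l ≤ w (a n l) * wJ (b n l)
  pos : ∀ l, 0 < wL l
  sum : ∑' l, ((wL l : ℝ≥0∞) ^ 2)⁻¹ ≠ ⊤

namespace BilData
variable (B : BilData w wJ wN wL)

theorem bound (m : ℕ) (c : X → ℂ) (d : J → ℂ) :
    ∑' n, (wN n : ℝ≥0∞) ^ m * ∑' l, ‖c (B.a n l)‖ₑ * ‖d (B.b n l)‖ₑ ≤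
      (∑' l, ((wL l : ℝ≥0∞) ^ 2)⁻¹) * (wn w (m + 2) c * wn wJ (m + 2) d) := by
  have h1 : ∀ n l, (wN n : ℝ≥0∞) ^ m * (‖c (B.a n l)‖ₑ * ‖d (B.b n l)‖ₑ) ≤
      ((wL l : ℝ≥0∞) ^ 2)⁻¹ * (((w (B.a n l) : ℝ≥0∞) ^ (m + 2) * ‖c (B.a n l)‖ₑ) *
        ((wJ (B.b n l) : ℝ≥0∞) ^ (m + 2) * ‖d (B.b n l)‖ₑ)) := by
    intro n l
    have e1 : (wN n : ℝ≥0∞) ≤ w (B.a n l) * wJ (B.b n l) := by exact_mod_cast B.le n l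
    have e2 : (wL l : ℝ≥0∞) ≤ w (B.a n l) * wJ (B.b n l) := by exact_mod_cast B.leL n l
    have e3 : (wL l : ℝ≥0∞) ^ 2 ≠ 0 := pow_ne_zero _ (by exact_mod_cast (B.pos l).ne')
    have e4 : (wL l : ℝ≥0∞) ^ 2 ≠ ⊤ := ENNReal.pow_ne_top (ENNReal.natCast_ne_top _)
    calc (wN n : ℝ≥0∞) ^ m * (‖c (B.a n l)‖ₑ * ‖d (B.b n l)‖ₑ)
        = ((wL l : ℝ≥0∞) ^ 2)⁻¹ * ((wN n : ℝ≥0∞) ^ m * (wL l : ℝ≥0∞) ^ 2 *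
            (‖c (B.a n l)‖ₑ * ‖d (B.b n l)‖ₑ)) := by
          rw [mul_comm ((wN n : ℝ≥0∞) ^ m) ((wL l : ℝ≥0∞) ^ 2), mul_assoc,
            ← mul_assoc (((wL l : ℝ≥0∞) ^ 2)⁻¹), ENNReal.inv_mul_cancel e3 e4, one_mul]
      _ ≤ ((wL l : ℝ≥0∞) ^ 2)⁻¹ * (((w (B.a n l) : ℝ≥0∞) * wJ (B.b n l)) ^ m *
            ((w (B.a n l) : ℝ≥0∞) * wJ (B.b n l)) ^ 2 *
            (‖c (B.a n l)‖ₑ * ‖d (B.b n l)‖ₑ)) := by gcongr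
      _ = _ := by congr 1; ring
  calc ∑' n, (wN n : ℝ≥0∞) ^ m * ∑' l, ‖c (B.a n l)‖ₑ * ‖d (B.b n l)‖ₑ
      = ∑' n, ∑' l, (wN n : ℝ≥0∞) ^ m * (‖c (B.a n l)‖ₑ * ‖d (B.b n l)‖ₑ) := by
        simp only [ENNReal.tsum_mul_left]
    _ ≤ ∑' n, ∑' l, ((wL l : ℝ≥0∞) ^ 2)⁻¹ *
          (((w (B.a n l) : ℝ≥0∞) ^ (m + 2) * ‖c (B.a n l)‖ₑ) *
        ((wJ (B.b n l) : ℝ≥0∞) ^ (m + 2) * ‖d (B.b n l)‖ₑ)) :=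
        ENNReal.tsum_le_tsum fun n => ENNReal.tsum_le_tsum fun l => h1 n l
    _ = ∑' l, ((wL l : ℝ≥0∞) ^ 2)⁻¹ * ∑' n,
          (((w (B.a n l) : ℝ≥0∞) ^ (m + 2) * ‖c (B.a n l)‖ₑ) *
        ((wJ (B.b n l) : ℝ≥0∞) ^ (m + 2) * ‖d (B.b n l)‖ₑ)) := by
        rw [ENNReal.tsum_comm]; simp only [ENNReal.tsum_mul_left]
    _ ≤ ∑' l, ((wL l : ℝ≥0∞) ^ 2)⁻¹ * (wn w (m + 2) c * wn wJ (m + 2) d) := by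
        refine ENNReal.tsum_le_tsum fun l => mul_le_mul_right ?_ _
        refine (ENNReal.tsum_comp_le_tsum_of_injective (B.inj l) (fun p : X × J =>
          ((w p.1 : ℝ≥0∞) ^ (m + 2) * ‖c p.1‖ₑ) * ((wJ p.2 : ℝ≥0∞) ^ (m + 2) * ‖d p.2‖ₑ))).trans ?_
        rw [ENNReal.tsum_prod (f := fun i j =>
          ((w i : ℝ≥0∞) ^ (m + 2) * ‖c i‖ₑ) * ((wJ j : ℝ≥0∞) ^ (m + 2) * ‖d j‖ₑ))]
        simp only [ENNReal.tsum_mul_left, ENNReal.tsum_mul_right]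
        exact le_rfl
    _ = _ := by rw [ENNReal.tsum_mul_right]

theorem bound_ne_top (B : BilData w wJ wN wL) (m : ℕ) (x : Rapid w) (y : Rapid wJ) :
    (∑' l, ((wL l : ℝ≥0∞) ^ 2)⁻¹) * (wn w (m + 2) (cf x) * wn wJ (m + 2) (cf y)) ≠ ⊤ :=
  ENNReal.mul_ne_top B.sum (ENNReal.mul_ne_top (wn_ne_top x _) (wn_ne_top y _))

theorem summable (x : Rapid w) (y : Rapid wJ) (n : N) :
    Summable fun l => cf x (B.a n l) * cf y (B.b n l) := by
  have h := ne_top_of_le_ne_top (B.bound_ne_top 0 x y) (B.bound 0 (cf x) (cf y))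
  have h2 := ENNReal.ne_top_of_tsum_ne_top h n
  rw [pow_zero, one_mul] at h2
  refine Summable.of_norm ?_
  have := ENNReal.summable_toReal h2
  simpa using this

theorem wn_le (m : ℕ) (c : X → ℂ) (d : J → ℂ) :
    wn wN m (fun n => ∑' l, c (B.a n l) * d (B.b n l)) ≤
      (∑' l, ((wL l : ℝ≥0∞) ^ 2)⁻¹) * (wn w (m + 2) c * wn wJ (m + 2) d) := by
  refine le_trans (ENNReal.tsum_le_tsum fun n => mul_le_mul_right ?_ _) (B.bound m c d)
  refine enorm_tsum_le_tsum_enorm.trans_eq ?_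
  simp only [enorm_mul]

/-- The bilinear map defined by the index data. -/
noncomputable def bil : Rapid w →ₗ[ℂ] Rapid wJ →ₗ[ℂ] Rapid wN :=
  LinearMap.mk₂ ℂ (fun x y => ofCf (fun n => ∑' l, cf x (B.a n l) * cf y (B.b n l))
      (fun m => ne_top_of_le_ne_top (B.bound_ne_top m x y) (B.wn_le m _ _)))
    (fun x x' y => ext fun n => by
      rw [cf_add, cf_ofCf, cf_ofCf, cf_ofCf, ← (B.summable x y n).tsum_add (B.summable x' y n)]
      simp only [cf_add, add_mul])
    (fun c x y => ext fun n => by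
      rw [cf_smul, cf_ofCf, cf_ofCf, ← tsum_mul_left]
      simp only [cf_smul, mul_assoc])
    (fun x y y' => ext fun n => by
      rw [cf_add, cf_ofCf, cf_ofCf, cf_ofCf, ← (B.summable x y n).tsum_add (B.summable x y' n)]
      simp only [cf_add, mul_add])
    (fun c x y => ext fun n => by
      rw [cf_smul, cf_ofCf, cf_ofCf, ← tsum_mul_left]
      simp only [cf_smul, mul_left_comm])

theorem cf_bil (x : Rapid w) (y : Rapid wJ) (n : N) :
    cf (B.bil x y) n = ∑' l, cf x (B.a n l) * cf y (B.b n l) :=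
  cf_ofCf _ (fun m => ne_top_of_le_ne_top (B.bound_ne_top m x y) (B.wn_le m _ _)) n

theorem hasSum_bil (x : Rapid w) (y : Rapid wJ) (n : N) :
    HasSum (fun l => cf x (B.a n l) * cf y (B.b n l)) (cf (B.bil x y) n) := by
  rw [cf_bil]; exact (B.summable x y n).hasSum

theorem norm_bil_le (m : ℕ) (x : Rapid w) (y : Rapid wJ) :
    ‖(B.bil x y).1 m‖ ≤
      (∑' l, ((wL l : ℝ≥0∞) ^ 2)⁻¹).toReal * (‖x.1 (m + 2)‖ * ‖y.1 (m + 2)‖) := by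
  have h : ‖(B.bil x y).1 m‖ₑ ≤
      (∑' l, ((wL l : ℝ≥0∞) ^ 2)⁻¹) * (‖x.1 (m + 2)‖ₑ * ‖y.1 (m + 2)‖ₑ) := by
    rw [enorm_apply, enorm_apply, enorm_apply]
    have e : cf (B.bil x y) = fun n => ∑' l, cf x (B.a n l) * cf y (B.b n l) :=
      funext (B.cf_bil x y)
    rw [e]
    exact B.wn_le m _ _
  have h2 := ENNReal.toReal_mono (ENNReal.mul_ne_top B.sum
    (ENNReal.mul_ne_top enorm_ne_top enorm_ne_top)) h
  simpa using h2

theorem continuous_bil : Continuous fun z : Rapid w × Rapid wJ => B.bil z.1 z.2 := by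
  refine Continuous.subtype_mk (continuous_pi fun m => ?_) _
  have cx : Continuous fun x : Rapid w => x.1 (m + 2) :=
    (continuous_apply _).comp continuous_subtype_val
  have cy : Continuous fun y : Rapid wJ => y.1 (m + 2) :=
    (continuous_apply _).comp continuous_subtype_val
  set V := (∑' l, ((wL l : ℝ≥0∞) ^ 2)⁻¹).toReal
  refine continuous_iff_continuousAt.2 fun ⟨x₀, y₀⟩ => ?_
  refine tendsto_iff_norm_sub_tendsto_zero.2 ?_
  have lim : Tendsto (fun z : Rapid w × Rapid wJ =>
      V * (‖(z.1 - x₀).1 (m + 2)‖ * ‖z.2.1 (m + 2)‖) +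
        V * (‖x₀.1 (m + 2)‖ * ‖(z.2 - y₀).1 (m + 2)‖)) (𝓝 (x₀, y₀)) (𝓝 0) := by
    have : Continuous (fun z : Rapid w × Rapid wJ =>
      V * (‖(z.1 - x₀).1 (m + 2)‖ * ‖z.2.1 (m + 2)‖) +
        V * (‖x₀.1 (m + 2)‖ * ‖(z.2 - y₀).1 (m + 2)‖)) :=
      (continuous_const.mul (((cx.comp (continuous_fst.sub continuous_const)).norm).mul
        (cy.comp continuous_snd).norm)).add
      (continuous_const.mul (continuous_const.mul
        (cy.comp (continuous_snd.sub continuous_const)).norm))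
    simpa using this.tendsto (x₀, y₀)
  refine squeeze_zero (fun _ => norm_nonneg _) (fun z => ?_) lim
  have e : B.bil z.1 z.2 - B.bil x₀ y₀ = B.bil (z.1 - x₀) z.2 + B.bil x₀ (z.2 - y₀) := by
    simp only [map_sub, LinearMap.sub_apply]; abel
  have e2 : (B.bil z.1 z.2).1 m - (B.bil x₀ y₀).1 m =
      (B.bil (z.1 - x₀) z.2).1 m + (B.bil x₀ (z.2 - y₀)).1 m :=
    congrArg (fun t : Rapid wN => t.1 m) e
  change ‖(B.bil z.1 z.2).1 m - (B.bil x₀ y₀).1 m‖ ≤ _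
  rw [e2]
  exact (norm_add_le _ _).trans (add_le_add (B.norm_bil_le m _ _) (B.norm_bil_le m _ _))

theorem continuous_bil_comp {T : Type*} [TopologicalSpace T] {f : T → Rapid w} {g : T → Rapid wJ}
    (hf : Continuous f) (hg : Continuous g) : Continuous fun t => B.bil (f t) (g t) :=
  B.continuous_bil.comp (hf.prodMk hg)

end BilData
end Rapid
end Rapid

namespace SmoothToeplitz
open Rapid

/-- The weight `(1 + i) (1 + j)` on matrix coefficients. -/
def wK (p : ℕ × ℕ) : ℕ := (1 + p.1) * (1 + p.2)
/-- The weight `1 + |n|` on Fourier coefficients. -/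
def wZ (n : ℤ) : ℕ := 1 + n.natAbs

theorem sum_nat : ∑' l : ℕ, (((1 + l : ℕ) : ℝ≥0∞) ^ 2)⁻¹ ≠ ⊤ := by
  have h : Summable fun l : ℕ => (((1 + l : ℕ) : ℝ) ^ 2)⁻¹ := by
    have := (summable_nat_add_iff 1).2 (Real.summable_nat_pow_inv.2 one_lt_two)
    simpa [add_comm] using this
  have := h.tsum_ofReal_ne_top
  convert this using 3 with l
  rw [ENNReal.ofReal_inv_of_pos (by positivity), ENNReal.ofReal_pow (by positivity),
    ENNReal.ofReal_natCast]

theorem sum_int : ∑' l : ℤ, ((wZ l : ℝ≥0∞) ^ 2)⁻¹ ≠ ⊤ := by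
  have h : Summable fun l : ℤ => ((wZ l : ℝ) ^ 2)⁻¹ := by
    have h0 : Summable fun l : ℕ => (((1 + l : ℕ) : ℝ) ^ 2)⁻¹ := by
      have := (summable_nat_add_iff 1).2 (Real.summable_nat_pow_inv.2 one_lt_two)
      simpa [add_comm] using this
    refine Summable.of_nat_of_neg ?_ ?_
    · exact h0
    · simpa [wZ] using h0
  have := h.tsum_ofReal_ne_top
  convert this using 3 with l
  rw [ENNReal.ofReal_inv_of_pos (by unfold wZ; positivity), ENNReal.ofReal_pow (by positivity),
    ENNReal.ofReal_natCast]

/-- `∑ l, k i l * k' l j`. -/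
def bKK : BilData wK wK wK (fun l : ℕ => 1 + l) where
  a n l := (n.1, l)
  b n l := (l, n.2)
  inj l n n' h := by
    simp only [Prod.mk.injEq] at h
    exact Prod.ext h.1.1 h.2.2
  le n l := by
    simp only [wK]
    nlinarith [Nat.zero_le ((1 + n.1) * (1 + n.2) * l), Nat.zero_le ((1 + n.1) * (1 + n.2) * l * l)]
  leL n l := by
    simp only [wK]
    calc 1 + l = 1 * (1 + l) * (1 * 1) := by ring
      _ ≤ (1 + n.1) * (1 + l) * ((1 + l) * (1 + n.2)) := by gcongr <;> omega
  pos l := by omega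
  sum := sum_nat

/-- `∑ l, k i l * g (l - j)`. -/
def bKZ : BilData wK wZ wK (fun l : ℕ => 1 + l) where
  a n l := (n.1, l)
  b n l := (l : ℤ) - n.2
  inj l n n' h := by
    simp only [Prod.mk.injEq] at h
    exact Prod.ext h.1.1 (by omega)
  le n l := by
    simp only [wK, wZ]
    rw [mul_assoc]
    gcongr
    have h : n.2 ≤ l + ((l : ℤ) - n.2).natAbs := by omega
    nlinarith [Nat.zero_le (l * ((l : ℤ) - n.2).natAbs)]
  leL n l := by
    simp only [wK, wZ]
    calc 1 + l = 1 * (1 + l) * 1 := by ring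
      _ ≤ (1 + n.1) * (1 + l) * (1 + ((l : ℤ) - n.2).natAbs) := by gcongr <;> omega
  pos l := by omega
  sum := sum_nat

/-- `∑ l, f (i - l) * k l j`. -/
def bZK : BilData wZ wK wK (fun l : ℕ => 1 + l) where
  a n l := (n.1 : ℤ) - l
  b n l := (l, n.2)
  inj l n n' h := by
    simp only [Prod.mk.injEq] at h
    exact Prod.ext (by omega) h.2.2
  le n l := by
    simp only [wK, wZ]
    rw [← mul_assoc]
    gcongr
    have h : n.1 ≤ l + ((n.1 : ℤ) - l).natAbs := by omega
    nlinarith [Nat.zero_le (l * ((n.1 : ℤ) - l).natAbs)]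
  leL n l := by
    simp only [wK, wZ]
    calc 1 + l = 1 * ((1 + l) * 1) := by ring
      _ ≤ (1 + ((n.1 : ℤ) - l).natAbs) * ((1 + l) * (1 + n.2)) := by gcongr <;> omega
  pos l := by omega
  sum := sum_nat

/-- `∑ l ≥ 0, f (i + l + 1) * g (-(l + 1) - j)`. -/
def bH : BilData wZ wZ wK (fun l : ℕ => 1 + l) where
  a n l := (n.1 : ℤ) + (l + 1)
  b n l := -((l : ℤ) + 1) - n.2
  inj l n n' h := by
    simp only [Prod.mk.injEq] at h
    exact Prod.ext (by omega) (by omega)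
  le n l := by
    simp only [wK, wZ]
    gcongr <;> omega
  leL n l := by
    simp only [wZ]
    calc 1 + l = (1 + l) * 1 := by ring
      _ ≤ _ := by gcongr <;> omega
  pos l := by omega
  sum := sum_nat

/-- The convolution `∑ l, f (n - l) * g l`. -/
def bZZ : BilData wZ wZ wZ wZ where
  a n l := n - l
  b _ l := l
  inj l n n' h := by
    simp only [Prod.mk.injEq] at h
    omega
  le n l := by
    simp only [wZ]
    have h : n.natAbs ≤ (n - l).natAbs + l.natAbs := by omega
    nlinarith [Nat.zero_le ((n - l).natAbs * l.natAbs)]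
  leL n l := by
    simp only [wZ]
    calc 1 + l.natAbs = 1 * (1 + l.natAbs) := by ring
      _ ≤ _ := by gcongr; omega
  pos l := by simp only [wZ]; omega
  sum := sum_int

end SmoothToeplitz

open SmoothToeplitz in
/-- The smooth Toeplitz algebra `𝒯^∞ = 𝒦^∞ ⊕ C^∞(S¹)`: pairs of a matrix `k` with rapidly decreasing
coefficients and a smooth function `f` on the circle, given by its rapidly decreasing Fourier
coefficients. The pair `(k, f)` stands for the operator `k + T_f` on `ℓ²(ℕ)`, `T_f` the Toeplitz
operator with symbol `f`. -/
def SmoothToeplitz : Type := Rapid wK × Rapid wZ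

namespace SmoothToeplitz
open Rapid

noncomputable instance : AddCommGroup SmoothToeplitz :=
  inferInstanceAs (AddCommGroup (Rapid wK × Rapid wZ))
noncomputable instance : Module ℂ SmoothToeplitz := inferInstanceAs (Module ℂ (Rapid wK × Rapid wZ))
noncomputable instance : UniformSpace SmoothToeplitz :=
  inferInstanceAs (UniformSpace (Rapid wK × Rapid wZ))

/-- The part `k`. -/
def kpart (x : SmoothToeplitz) : Rapid wK := x.1
/-- The symbol `f`. -/
def symb (x : SmoothToeplitz) : Rapid wZ := x.2

@[ext]
theorem ext' {x y : SmoothToeplitz} (h1 : kpart x = kpart y) (h2 : symb x = symb y) : x = y :=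
  Prod.ext h1 h2

/-- The product of the operators `k + T_f` and `k' + T_g`, by `T_f T_g = T_{f g} - H`. -/
noncomputable instance : Mul SmoothToeplitz where
  mul x y := (bKK.bil (kpart x) (kpart y) + bKZ.bil (kpart x) (symb y) +
    bZK.bil (symb x) (kpart y) - bH.bil (symb x) (symb y), bZZ.bil (symb x) (symb y))

/-- The matrix of the operator `k + T_f` in the standard basis of `ℓ²(ℕ)`. -/
def mat (x : SmoothToeplitz) (i j : ℕ) : ℂ := cf (kpart x) (i, j) + cf (symb x) ((i : ℤ) - j)

theorem mat_add (x y : SmoothToeplitz) (i j : ℕ) : mat (x + y) i j = mat x i j + mat y i j := by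
  change cf (kpart x + kpart y) _ + cf (symb x + symb y) _ = _
  rw [cf_add, cf_add, mat, mat]; ring

theorem mat_smul (c : ℂ) (x : SmoothToeplitz) (i j : ℕ) : mat (c • x) i j = c * mat x i j := by
  change cf (c • kpart x) _ + cf (c • symb x) _ = _
  rw [cf_smul, cf_smul, mat]; ring

theorem mat_sub (x y : SmoothToeplitz) (i j : ℕ) : mat (x - y) i j = mat x i j - mat y i j := by
  have : x - y = x + (-1 : ℂ) • y := by rw [neg_one_smul, sub_eq_add_neg]
  rw [this, mat_add, mat_smul]; ring

theorem summable_cf {X : Type} {w : X → ℕ} (x : Rapid w) : Summable fun i => ‖cf x i‖ := by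
  have h := wn_ne_top x 0
  simp only [wn, pow_zero, one_mul] at h
  have := ENNReal.summable_toReal h
  simpa using this

theorem mat_eq_zero {x : SmoothToeplitz} (h : ∀ i j, mat x i j = 0) : x = 0 := by
  have hs : ∀ n, cf (symb x) n = 0 := by
    intro n
    have hinj : Function.Injective fun j : ℕ => (j + n.toNat, j + (-n).toNat) := by
      intro a b hab
      simp only [Prod.mk.injEq] at hab
      omega
    have h1 : Tendsto (fun j : ℕ => ‖cf (kpart x) (j + n.toNat, j + (-n).toNat)‖) atTop (𝓝 0) :=
      ((summable_cf (kpart x)).comp_injective hinj).tendsto_atTop_zero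
    have h2 : ∀ j : ℕ, ‖cf (kpart x) (j + n.toNat, j + (-n).toNat)‖ = ‖cf (symb x) n‖ := by
      intro j
      have := h (j + n.toNat) (j + (-n).toNat)
      rw [mat] at this
      have e : ((j + n.toNat : ℕ) : ℤ) - (j + (-n).toNat : ℕ) = n := by omega
      rw [e] at this
      rw [eq_neg_of_add_eq_zero_left this, norm_neg]
    simp only [h2] at h1
    exact norm_eq_zero.1 (tendsto_nhds_unique tendsto_const_nhds h1)
  refine ext' (Rapid.ext fun p => ?_) (Rapid.ext hs)
  have := h p.1 p.2
  rw [mat, hs, add_zero] at this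
  exact this

theorem mat_injective {x y : SmoothToeplitz} (h : ∀ i j, mat x i j = mat y i j) : x = y :=
  sub_eq_zero.1 (mat_eq_zero fun i j => by rw [mat_sub, h, sub_self])

theorem mat_mul (x y : SmoothToeplitz) (i j : ℕ) :
    HasSum (fun l => mat x i l * mat y l j) (mat (x * y) i j) := by
  have h1 := bKK.hasSum_bil (kpart x) (kpart y) (i, j)
  have h2 := bKZ.hasSum_bil (kpart x) (symb y) (i, j)
  have h3 := bZK.hasSum_bil (symb x) (kpart y) (i, j)
  have h4 := bH.hasSum_bil (symb x) (symb y) (i, j)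
  have h5 := (Equiv.subRight (j : ℤ)).hasSum_iff.2
    (bZZ.hasSum_bil (symb x) (symb y) ((i : ℤ) - j))
  have h5' : HasSum (fun l : ℤ => cf (symb x) ((i : ℤ) - l) * cf (symb y) (l - j))
      (cf (bZZ.bil (symb x) (symb y)) ((i : ℤ) - j)) := by
    convert h5 using 2 with l
    simp only [Function.comp_apply, bZZ, Equiv.subRight_apply]
    congr 2; ring
  have h6 : HasSum (fun l : ℕ => cf (symb x) ((i : ℤ) - l) * cf (symb y) ((l : ℤ) - j))
      (cf (bZZ.bil (symb x) (symb y)) ((i : ℤ) - j) - cf (bH.bil (symb x) (symb y)) (i, j)) := by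
    have hs := (h5'.summable.comp_injective Nat.cast_injective).hasSum
    have ht : HasSum (fun l : ℕ => cf (symb x) ((i : ℤ) - (-((l : ℤ) + 1))) *
        cf (symb y) (-((l : ℤ) + 1) - j)) (cf (bH.bil (symb x) (symb y)) (i, j)) := by
      convert h4 using 3 with l <;> simp only [bH, sub_neg_eq_add]
    have h7 := HasSum.of_nat_of_neg_add_one
      (f := fun l : ℤ => cf (symb x) ((i : ℤ) - l) * cf (symb y) (l - j)) hs ht
    rw [← h7.unique h5', add_sub_cancel_right]
    exact hs
  have := ((h1.add h2).add h3).add h6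
  convert this using 1
  · funext l
    simp only [mat, bKK, bKZ, bZK]
    ring
  · change cf (bKK.bil (kpart x) (kpart y) + bKZ.bil (kpart x) (symb y) +
      bZK.bil (symb x) (kpart y) - bH.bil (symb x) (symb y)) (i, j) +
      cf (bZZ.bil (symb x) (symb y)) ((i : ℤ) - j) = _
    simp only [cf_add, cf_sub]
    ring

theorem summable_row (x : SmoothToeplitz) (i : ℕ) : Summable fun l => ‖mat x i l‖ := by
  refine Summable.of_nonneg_of_le (fun _ => norm_nonneg _) (fun l => norm_add_le _ _) ?_
  refine ((summable_cf (kpart x)).comp_injective (i := fun l : ℕ => (i, l)) ?_).add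
    ((summable_cf (symb x)).comp_injective (i := fun l : ℕ => (i : ℤ) - l) ?_)
  · intro a b h; simpa using h
  · intro a b h; simp only at h; omega

theorem summable_col (x : SmoothToeplitz) (j : ℕ) : Summable fun l => ‖mat x l j‖ := by
  refine Summable.of_nonneg_of_le (fun _ => norm_nonneg _) (fun l => norm_add_le _ _) ?_
  refine ((summable_cf (kpart x)).comp_injective (i := fun l : ℕ => (l, j)) ?_).add
    ((summable_cf (symb x)).comp_injective (i := fun l : ℕ => (l : ℤ) - j) ?_)
  · intro a b h; simpa using h
  · intro a b h; simp only at h; omega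

theorem exists_bound (x : SmoothToeplitz) : ∃ C, ∀ i j, ‖mat x i j‖ ≤ C := by
  refine ⟨(∑' p, ‖cf (kpart x) p‖) + ∑' n, ‖cf (symb x) n‖, fun i j => ?_⟩
  refine (norm_add_le _ _).trans (add_le_add ?_ ?_)
  · exact (summable_cf (kpart x)).le_tsum (i, j) fun _ _ => norm_nonneg _
  · exact (summable_cf (symb x)).le_tsum _ fun _ _ => norm_nonneg _

theorem mul_assoc' (x y z : SmoothToeplitz) : x * y * z = x * (y * z) := by
  refine mat_injective fun i j => ?_
  rw [← (mat_mul (x * y) z i j).tsum_eq, ← (mat_mul x (y * z) i j).tsum_eq]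
  simp only [← (mat_mul x y _ _).tsum_eq, ← (mat_mul y z _ _).tsum_eq, ← tsum_mul_left,
    ← tsum_mul_right]
  obtain ⟨C, hC⟩ := exists_bound y
  have hs : Summable (Function.uncurry fun l k : ℕ => mat x i k * mat y k l * mat z l j) := by
    refine Summable.of_norm_bounded (g := fun p : ℕ × ℕ => C * (‖mat z p.1 j‖ * ‖mat x i p.2‖))
      (((summable_col z j).mul_of_nonneg (summable_row x i) (fun _ => norm_nonneg _)
        (fun _ => norm_nonneg _)).mul_left C) ?_
    rintro ⟨l, k⟩
    simp only [Function.uncurry_apply_pair, norm_mul]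
    have := hC k l
    have h1 := norm_nonneg (mat x i k)
    have h2 := norm_nonneg (mat z l j)
    calc ‖mat x i k‖ * ‖mat y k l‖ * ‖mat z l j‖ ≤ ‖mat x i k‖ * C * ‖mat z l j‖ := by gcongr
      _ = _ := by ring
  rw [← hs.tsum_comm]
  simp only [mul_assoc]

theorem add_mul' (x y z : SmoothToeplitz) : (x + y) * z = x * z + y * z := by
  refine mat_injective fun i j => (mat_mul (x + y) z i j).unique ?_
  rw [mat_add]
  convert (mat_mul x z i j).add (mat_mul y z i j) using 2 with l
  rw [mat_add, add_mul]

theorem mul_add' (x y z : SmoothToeplitz) : x * (y + z) = x * y + x * z := by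
  refine mat_injective fun i j => (mat_mul x (y + z) i j).unique ?_
  rw [mat_add]
  convert (mat_mul x y i j).add (mat_mul x z i j) using 2 with l
  rw [mat_add, mul_add]

theorem smul_mul' (c : ℂ) (x y : SmoothToeplitz) : (c • x) * y = c • (x * y) := by
  refine mat_injective fun i j => (mat_mul (c • x) y i j).unique ?_
  rw [mat_smul]
  have := (mat_mul x y i j).mul_left c
  simpa only [mat_smul, mul_assoc] using this

theorem mul_smul' (c : ℂ) (x y : SmoothToeplitz) : x * (c • y) = c • (x * y) := by
  refine mat_injective fun i j => (mat_mul x (c • y) i j).unique ?_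
  rw [mat_smul]
  have := (mat_mul x y i j).mul_left c
  simpa only [mat_smul, mul_left_comm] using this

noncomputable instance : NonUnitalRing SmoothToeplitz where
  __ := (inferInstance : AddCommGroup SmoothToeplitz)
  left_distrib := mul_add'
  right_distrib := add_mul'
  mul_assoc := mul_assoc'
  zero_mul x := by have := smul_mul' 0 0 x; rwa [zero_smul, zero_smul] at this
  mul_zero x := by have := mul_smul' 0 x 0; rwa [zero_smul, zero_smul] at this

instance : IsScalarTower ℂ SmoothToeplitz SmoothToeplitz := ⟨smul_mul'⟩
instance : SMulCommClass ℂ SmoothToeplitz SmoothToeplitz := ⟨fun c x y => (mul_smul' c x y).symm⟩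

theorem continuous_kpart : Continuous kpart := continuous_fst (X := Rapid wK) (Y := Rapid wZ)
theorem continuous_symb : Continuous symb := continuous_snd (X := Rapid wK) (Y := Rapid wZ)

instance : ContinuousMul SmoothToeplitz where
  continuous_mul := by
    have c1 : Continuous fun z : SmoothToeplitz × SmoothToeplitz => kpart z.1 :=
      continuous_kpart.comp continuous_fst
    have c2 : Continuous fun z : SmoothToeplitz × SmoothToeplitz => symb z.1 :=
      continuous_symb.comp continuous_fst
    have c3 : Continuous fun z : SmoothToeplitz × SmoothToeplitz => kpart z.2 :=
      continuous_kpart.comp continuous_snd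
    have c4 : Continuous fun z : SmoothToeplitz × SmoothToeplitz => symb z.2 :=
      continuous_symb.comp continuous_snd
    have d1 : Continuous fun z : SmoothToeplitz × SmoothToeplitz =>
      bKK.bil (kpart z.1) (kpart z.2) := bKK.continuous_bil_comp c1 c3
    have d2 : Continuous fun z : SmoothToeplitz × SmoothToeplitz =>
      bKZ.bil (kpart z.1) (symb z.2) := bKZ.continuous_bil_comp c1 c4
    have d3 : Continuous fun z : SmoothToeplitz × SmoothToeplitz =>
      bZK.bil (symb z.1) (kpart z.2) := bZK.continuous_bil_comp c2 c3
    have d4 : Continuous fun z : SmoothToeplitz × SmoothToeplitz =>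
      bH.bil (symb z.1) (symb z.2) := bH.continuous_bil_comp c2 c4
    have d5 : Continuous fun z : SmoothToeplitz × SmoothToeplitz =>
      bZZ.bil (symb z.1) (symb z.2) := bZZ.continuous_bil_comp c2 c4
    exact (((d1.add d2).add d3).sub d4).prodMk d5

/-- The inclusion into the product of the ambient spaces. -/
def toProd : SmoothToeplitz →ₗ[ℂ]
    (ℕ → lp (fun _ : ℕ × ℕ => ℂ) 1) × (ℕ → lp (fun _ : ℤ => ℂ) 1) where
  toFun x := ((kpart x).1, (symb x).1)
  map_add' _ _ := rfl
  map_smul' _ _ := rfl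

theorem range_toProd : Set.range toProd = (Rapid wK : Set _) ×ˢ (Rapid wZ : Set _) := by
  ext p
  constructor
  · rintro ⟨x, rfl⟩
    exact ⟨(kpart x).2, (symb x).2⟩
  · rintro ⟨h1, h2⟩
    exact ⟨((⟨p.1, h1⟩ : Rapid wK), (⟨p.2, h2⟩ : Rapid wZ)), rfl⟩

instance : IsLCAlg SmoothToeplitz :=
  haveI : @LocallyConvexSpace ℝ ((ℕ → lp (fun _ : ℕ × ℕ => ℂ) 1) × (ℕ → lp (fun _ : ℤ => ℂ) 1))
    _ _ _ (Module.complexToReal _) _ := inferInstanceAs (LocallyConvexSpace ℝ _)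
  IsLCAlg.of_inducing toProd
    ((isUniformInducing_val _).prod (isUniformInducing_val _))
    (Subtype.val_injective.prodMap Subtype.val_injective) (by
      rw [range_toProd]
      exact ((Rapid.isClosed wK).prod (Rapid.isClosed wZ)).isComplete)

/-- The unit. -/
noncomputable def one : SmoothToeplitz := ((0 : Rapid wK), (single 0 : Rapid wZ))
/-- The shift `S`, with symbol `z`. -/
noncomputable def S : SmoothToeplitz := ((0 : Rapid wK), (single 1 : Rapid wZ))
/-- The adjoint `S̄` of the shift, with symbol `z⁻¹`. -/
noncomputable def Sbar : SmoothToeplitz := ((0 : Rapid wK), (single (-1) : Rapid wZ))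
/-- The projection `e = 1 - S S̄`. -/
noncomputable def e : SmoothToeplitz := one - S * Sbar

theorem mat_one (i j : ℕ) : mat one i j = if i = j then 1 else 0 := by
  have : mat one i j = 0 + cf (single 0 : Rapid wZ) ((i : ℤ) - j) := rfl
  rw [this, cf_single, zero_add]
  split_ifs <;> first | rfl | omega

theorem mat_S (i j : ℕ) : mat S i j = if i = j + 1 then 1 else 0 := by
  have : mat S i j = 0 + cf (single 1 : Rapid wZ) ((i : ℤ) - j) := rfl
  rw [this, cf_single, zero_add]
  split_ifs <;> first | rfl | omega

theorem mat_Sbar (i j : ℕ) : mat Sbar i j = if j = i + 1 then 1 else 0 := by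
  have : mat Sbar i j = 0 + cf (single (-1) : Rapid wZ) ((i : ℤ) - j) := rfl
  rw [this, cf_single, zero_add]
  split_ifs <;> first | rfl | omega

theorem one_mul' (x : SmoothToeplitz) : one * x = x := by
  refine mat_injective fun i j => (mat_mul one x i j).unique ?_
  convert hasSum_single (f := fun l => mat one i l * mat x l j) i ?_ using 1
  · simp [mat_one]
  · intro l hl; simp [mat_one, hl.symm]

theorem mul_one' (x : SmoothToeplitz) : x * one = x := by
  refine mat_injective fun i j => (mat_mul x one i j).unique ?_
  convert hasSum_single (f := fun l => mat x i l * mat one l j) j ?_ using 1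
  · simp [mat_one]
  · intro l hl; simp [mat_one, hl]

theorem Sbar_mul_S : Sbar * S = one := by
  refine mat_injective fun i j => (mat_mul Sbar S i j).unique ?_
  convert hasSum_single (f := fun l => mat Sbar i l * mat S l j) (i + 1) ?_ using 1
  · simp [mat_one, mat_S, mat_Sbar]
  · intro l hl; simp [mat_Sbar, hl]

theorem symb_e : symb e = 0 := by
  have h : e = ((single (0, 0) : Rapid wK), (0 : Rapid wZ)) := by
    refine mat_injective fun i j => ?_
    have h2 : mat ((single (0, 0) : Rapid wK), (0 : Rapid wZ)) i j =
        cf (single (0, 0) : Rapid wK) (i, j) + 0 := rfl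
    have h3 : mat (S * Sbar) i j = if i = j ∧ i ≠ 0 then 1 else 0 := by
      refine (mat_mul S Sbar i j).unique ?_
      convert hasSum_single (f := fun l => mat S i l * mat Sbar l j) (i - 1) ?_ using 1
      · rw [mat_S, mat_Sbar]
        split_ifs <;> first | omega | simp
      · intro l hl
        have : i ≠ l + 1 := by omega
        simp [mat_S, this]
    rw [h2, cf_single, add_zero, e, mat_sub, mat_one, h3]
    simp only [Prod.mk.injEq]
    split_ifs <;> first | omega | simp
  rw [h]; rfl

/-- The smooth Toeplitz algebra, as a locally convex algebra. -/
noncomputable abbrev alg : LCAlg.{0} := ⟨SmoothToeplitz⟩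

/-- The subalgebra `𝒦^∞` of smooth compact operators. -/
noncomputable def compacts : NonUnitalSubalgebra ℂ alg where
  carrier := {x | symb x = 0}
  add_mem' {x y} hx hy := by
    change symb x + symb y = 0
    rw [show symb x = 0 from hx, show symb y = 0 from hy, add_zero]
  zero_mem' := rfl
  mul_mem' {x y} hx hy := by
    change bZZ.bil (symb x) (symb y) = 0
    rw [show symb x = 0 from hx, map_zero, LinearMap.zero_apply]
  smul_mem' c x hx := by
    change c • symb x = 0
    rw [show symb x = 0 from hx, smul_zero]

theorem isClosed_compacts : IsClosed (compacts : Set alg) :=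
  isClosed_eq continuous_symb continuous_const

end SmoothToeplitz

namespace LCAlg
open SmoothToeplitz

/-- The locally convex algebra `𝒦^∞` of smooth compact operators. -/
noncomputable abbrev K : LCAlg.{0} := ofClosed SmoothToeplitz.alg compacts isClosed_compacts

/-- The minimal idempotent `e ∈ 𝒦^∞` with the only coefficient `e 0 0 = 1`. -/
noncomputable def K.e : K := ⟨SmoothToeplitz.e, symb_e⟩
end LCAlg

namespace LCAlg
variable {A : LCAlg.{u}} {B : LCAlg.{w}}

theorem add_tmul (a a' : A) (b : B) : tmul (a + a') b = tmul a b + tmul a' b := by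
  have h : ProjTensor.tm (a + a') b = ProjTensor.tm a b + ProjTensor.tm a' b :=
    TensorProduct.add_tmul a a' b
  rw [tmul, h, AlgCompletion.of_add]; rfl

theorem smul_tmul (c : ℂ) (a : A) (b : B) : tmul (c • a) b = c • tmul a b := by
  have h : ProjTensor.tm (c • a) b = c • ProjTensor.tm a b := TensorProduct.smul_tmul' c a b
  rw [tmul, h, AlgCompletion.of_smul]; rfl

theorem tmul_smul (c : ℂ) (a : A) (b : B) : tmul a (c • b) = c • tmul a b := by
  have h : ProjTensor.tm a (c • b) = c • ProjTensor.tm a b := TensorProduct.tmul_smul c a b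
  rw [tmul, h, AlgCompletion.of_smul]; rfl

theorem tmul_sub (a : A) (b b' : B) : tmul a (b - b') = tmul a b - tmul a b' := by
  rw [eq_sub_iff_add_eq, ← tmul_add, sub_add_cancel]

/-- The morphism `a ↦ a ⊗ b` for an idempotent `b`. -/
noncomputable def tmulRight (A : LCAlg.{max u w}) (b : B) (hb : b * b = b) :
    A ⟶ tensor A B :=
  mkHom
    { toFun := fun a => tmul a b
      map_smul' := fun c a => smul_tmul c a b
      map_zero' := by have := smul_tmul 0 (0 : A) b; rwa [zero_smul, zero_smul] at this
      map_add' := fun a a' => add_tmul a a' b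
      map_mul' := fun a a' => by rw [tmul_mul, hb] }
    (continuous_tmul.comp (continuous_id.prodMk continuous_const))

/-- The morphism `b ↦ a ⊗ b` for an idempotent `a`. -/
noncomputable def tmulLeft (a : A) (ha : a * a = a) (B : LCAlg.{max u w}) : B ⟶ tensor A B :=
  mkHom
    { toFun := fun b => tmul a b
      map_smul' := fun c b => tmul_smul c a b
      map_zero' := by have := tmul_smul 0 a (0 : B); rwa [zero_smul, zero_smul] at this
      map_add' := fun b b' => tmul_add a b b'
      map_mul' := fun b b' => by rw [tmul_mul, ha] }
    (continuous_tmul.comp (continuous_const.prodMk continuous_id))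

theorem tensor_one_mul {a : A} {b : B} (ha : ∀ x, a * x = x) (hb : ∀ x, b * x = x)
    (x : tensor A B) : tmul a b * x = x := by
  refine AlgCompletion.eq_of_dense (continuous_const.mul continuous_id) continuous_id
    (fun r => ?_) x
  change AlgCompletion.of (ProjTensor.tm a b) * AlgCompletion.of r = AlgCompletion.of r
  rw [← AlgCompletion.of_mul]
  congr 1
  induction r using ProjTensor.ind with
  | h0 => rw [mul_zero]
  | ht a' b' => rw [ProjTensor.tm_mul, ha, hb]
  | ha x y hx hy => rw [mul_add, hx, hy]

/-- The morphism `x ↦ u x v`, where `v u` is a left unit. -/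
def ad {B : LCAlg.{u}} (u v : B) (h : ∀ x, v * u * x = x) : B ⟶ B :=
  mkHom
    { toFun := fun x => u * x * v
      map_smul' := fun c x => by
        change u * (c • x) * v = c • (u * x * v)
        rw [mul_smul_comm, smul_mul_assoc]
      map_zero' := by rw [mul_zero, zero_mul]
      map_add' := fun x y => by rw [mul_add, add_mul]
      map_mul' := fun x y => by
        calc u * (x * y) * v = u * (x * (v * u * y)) * v := by rw [h]
          _ = u * x * v * (u * y * v) := by simp only [mul_assoc] }
    ((continuous_const.mul continuous_id).mul continuous_const)

theorem K.e_mul_e : K.e * K.e = K.e := by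
  apply Subtype.ext
  change SmoothToeplitz.e * SmoothToeplitz.e = SmoothToeplitz.e
  have h : SmoothToeplitz.Sbar * SmoothToeplitz.e = 0 := by
    rw [SmoothToeplitz.e, mul_sub, ← mul_assoc, SmoothToeplitz.Sbar_mul_S,
      SmoothToeplitz.mul_one', SmoothToeplitz.one_mul', sub_self]
  calc SmoothToeplitz.e * SmoothToeplitz.e
      = (SmoothToeplitz.one - SmoothToeplitz.S * SmoothToeplitz.Sbar) * SmoothToeplitz.e := rfl
    _ = SmoothToeplitz.e := by
      rw [sub_mul, SmoothToeplitz.one_mul', mul_assoc, h, mul_zero, sub_zero]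

/-- The stabilisation `A ⟶ 𝒦^∞ ⊗_π A`, `a ↦ e ⊗ a`. -/
noncomputable def stab (A : LCAlg.{u}) : A ⟶ tensor.{0, u} K A :=
  tmulLeft.{0, u} K.e K.e_mul_e A

end LCAlg

/-- A functor `H` is `𝒦^∞`-stable if all the maps `H(A) ⟶ H(𝒦^∞ ⊗_π A)` induced by `a ↦ e ⊗ a` are
isomorphisms. -/
def KStable (H : LCAlg.{u} ⥤ AddCommGrpCat.{v}) : Prop :=
  ∀ A : LCAlg.{u}, IsIso (H.map (LCAlg.stab A))

section Pimsner

/-- A C⋆-auto-correspondence over `A`: the (right) Hilbert `A`-module `E` together with an injective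
representation `φ` of `A` on `E` by adjointable operators, `E` being full. The right action of `A` is
the action of `Aᵐᵒᵖ`, and `⟨x | y⟩` is `inner Aᵐᵒᵖ x y`, as an element of `A`. -/
structure Correspondence (A E : Type u) [CStarAlgebra A] [PartialOrder A] [StarOrderedRing A]
    [NormedAddCommGroup E] [NormedSpace ℂ E] [Module Aᵐᵒᵖ E] [CStarModule Aᵐᵒᵖ E] where
  φ : A →ₙₐ[ℂ] Module.End ℂ E
  adj : ∀ a x y, inner Aᵐᵒᵖ (φ a x) y = inner Aᵐᵒᵖ x (φ (star a) y)
  inj : Function.Injective φ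
  full : (Submodule.span ℂ {a : A | ∃ x y : E, MulOpposite.op a = inner Aᵐᵒᵖ x y}).topologicalClosure
    = ⊤

namespace Correspondence
variable {A E : Type u} [CStarAlgebra A] [PartialOrder A] [StarOrderedRing A]
    [NormedAddCommGroup E] [NormedSpace ℂ E] [Module Aᵐᵒᵖ E] [CStarModule Aᵐᵒᵖ E]

/-- The `A`-valued inner product. -/
def ip (x y : E) : A := (inner Aᵐᵒᵖ x y).unop

/-- The finite rank operator `∑ θ_{x, y}`, `θ_{x, y} z = x ⟨y | z⟩`. -/
def finiteRank (A : Type u) {E : Type u} [CStarAlgebra A] [PartialOrder A] [StarOrderedRing A]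
    [NormedAddCommGroup E] [NormedSpace ℂ E] [Module Aᵐᵒᵖ E] [CStarModule Aᵐᵒᵖ E]
    (R : List (E × E)) (z : E) : E :=
  (R.map fun p => MulOpposite.op (ip (A := A) p.2 z) • p.1).sum

/-- A covariant representation of the correspondence on a C⋆-algebra `B`. The covariance condition
says that `π a` is the limit of `∑ t x * (t y)⋆` whenever the operators `∑ θ_{x, y}` converge to
`φ a` in norm. -/
structure CovRep (c : Correspondence A E) where
  B : Type u
  [cstar : NonUnitalCStarAlgebra B]
  π : A →⋆ₙₐ[ℂ] B
  t : E →ₗ[ℂ] B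
  t_inner : ∀ x y, star (t x) * t y = π (ip x y)
  t_left : ∀ a x, t (c.φ a x) = π a * t x
  cov : ∀ (a : A) (R : ℕ → List (E × E)),
    (∀ ε > 0, ∀ᶠ n in atTop, ∀ z, ‖c.φ a z - finiteRank A (R n) z‖ ≤ ε * ‖z‖) →
    Tendsto (fun n => ((R n).map fun p => t p.1 * star (t p.2)).sum) atTop (𝓝 (π a))

attribute [instance] CovRep.cstar

variable (c : Correspondence A E)

theorem CovRep.norm_t_le {c : Correspondence A E} (ρ : c.CovRep) (x : E) : ‖ρ.t x‖ ≤ ‖x‖ := by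
  have h1 : ‖ρ.t x‖ * ‖ρ.t x‖ ≤ ‖x‖ * ‖x‖ := by
    rw [← CStarRing.norm_star_mul_self, ρ.t_inner,
      CStarModule.norm_eq_sqrt_norm_inner_self (A := Aᵐᵒᵖ) x,
      Real.mul_self_sqrt (norm_nonneg _)]
    exact NonUnitalStarAlgHom.norm_apply_le ρ.π (ip x x)
  exact (mul_self_le_mul_self_iff (norm_nonneg _) (norm_nonneg _)).2 h1

/-- The product of all covariant representations. -/
noncomputable abbrev Univ : Type (u + 1) := lp (fun ρ : c.CovRep => ρ.B) ∞

/-- The image of `a ∈ A` under all covariant representations. -/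
noncomputable def univA (a : A) : c.Univ :=
  ⟨fun ρ => ρ.π a, memℓp_infty ⟨‖a‖, by
    rintro _ ⟨ρ, rfl⟩; exact NonUnitalStarAlgHom.norm_apply_le ρ.π a⟩⟩

/-- The image of `x ∈ E` under all covariant representations. -/
noncomputable def univE (x : E) : c.Univ :=
  ⟨fun ρ => ρ.t x, memℓp_infty ⟨‖x‖, by rintro _ ⟨ρ, rfl⟩; exact ρ.norm_t_le x⟩⟩

/-- The Pimsner algebra `𝒪_E`: the universal C⋆-algebra for the covariant representations of the
correspondence, that is, the C⋆-algebra generated by `A` and `E` in the product of all of them. -/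
noncomputable def pimsner : NonUnitalStarSubalgebra ℂ c.Univ :=
  (NonUnitalStarAlgebra.adjoin ℂ (Set.range c.univA ∪ Set.range c.univE)).topologicalClosure

theorem univA_mem (a : A) : c.univA a ∈ c.pimsner :=
  NonUnitalStarSubalgebra.le_topologicalClosure _
    (NonUnitalStarAlgebra.subset_adjoin ℂ _ (Or.inl ⟨a, rfl⟩))

theorem univE_mem (x : E) : c.univE x ∈ c.pimsner :=
  NonUnitalStarSubalgebra.le_topologicalClosure _
    (NonUnitalStarAlgebra.subset_adjoin ℂ _ (Or.inr ⟨x, rfl⟩))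

/-- The canonical map `A → 𝒪_E`. -/
noncomputable def ofA : A →ₙₐ[ℂ] c.pimsner where
  toFun a := ⟨c.univA a, c.univA_mem a⟩
  map_smul' z a := Subtype.ext (lp.ext (funext fun ρ => map_smul ρ.π z a))
  map_zero' := Subtype.ext (lp.ext (funext fun ρ => map_zero ρ.π))
  map_add' a b := Subtype.ext (lp.ext (funext fun ρ => map_add ρ.π a b))
  map_mul' a b := Subtype.ext (lp.ext (funext fun ρ => map_mul ρ.π a b))

/-- The canonical map `E → 𝒪_E`, `ξ ↦ S_ξ`. -/
noncomputable def S (ξ : E) : c.pimsner := ⟨c.univE ξ, c.univE_mem ξ⟩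

end Correspondence

variable {A E : Type u} [CStarAlgebra A] [PartialOrder A] [StarOrderedRing A]
    [NormedAddCommGroup E] [NormedSpace ℂ E] [Module Aᵐᵒᵖ E] [CStarModule Aᵐᵒᵖ E]

/-- A self-adjoint locally convex subalgebra `D ⊆ 𝒪_E` with unit `1_A`, such that `𝒜 = D ∩ A` is
complete in the topology of `D`. -/
structure PimsnerSubalgebra (c : Correspondence A E) where
  D : LCAlg.{u}
  incl : D →ₙₐ[ℂ] c.pimsner
  inj : Function.Injective incl
  star_mem : ∀ d, ∃ d', incl d' = star (incl d)
  one : D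
  incl_one : incl one = c.ofA 1
  one_mul : ∀ d, one * d = d
  mul_one : ∀ d, d * one = d
  complete : IsComplete {d | incl d ∈ Set.range c.ofA}

namespace PimsnerSubalgebra
open LCAlg
variable {c : Correspondence A E} (P : PimsnerSubalgebra c)

/-- The subalgebra `𝒜 = D ∩ A` of `D`. -/
def calASub : NonUnitalSubalgebra ℂ P.D where
  carrier := {d | P.incl d ∈ Set.range c.ofA}
  add_mem' := by
    rintro x y ⟨a, ha⟩ ⟨b, hb⟩
    exact ⟨a + b, by rw [map_add, map_add, ha, hb]⟩
  zero_mem' := ⟨0, by rw [map_zero, map_zero]⟩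
  mul_mem' := by
    rintro x y ⟨a, ha⟩ ⟨b, hb⟩
    exact ⟨a * b, by rw [map_mul, map_mul, ha, hb]⟩
  smul_mem' := by
    rintro z x ⟨a, ha⟩
    exact ⟨z • a, by rw [map_smul, map_smul, ha]⟩

theorem isClosed_calASub : IsClosed (P.calASub : Set P.D) := P.complete.isClosed

/-- The locally convex algebra `𝒜 = D ∩ A`. -/
abbrev calA : LCAlg.{u} := ofClosed P.D P.calASub P.isClosed_calASub

/-- The space `ℰ = {ξ ∈ E | S_ξ ∈ D}`. -/
abbrev calE : Type u := {ξ : E // ∃ d, P.incl d = c.S ξ}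

/-- `S_ξ` as an element of `D`. -/
noncomputable def S (ξ : P.calE) : P.D := ξ.2.choose

/-- `S̄_ξ`, the adjoint of `S_ξ`, as an element of `D`. -/
noncomputable def Sbar (ξ : P.calE) : P.D := (P.star_mem (P.S ξ)).choose

/-- `S_{ξ_1} ⋯ S_{ξ_n}`. -/
noncomputable def Smulti (ξ : List P.calE) : P.D := ξ.foldr (fun η d => P.S η * d) P.one

/-- The adjoint `S̄_{ξ_n} ⋯ S̄_{ξ_1}` of `S_{ξ_1} ⋯ S_{ξ_n}`. -/
noncomputable def Sbarmulti (ξ : List P.calE) : P.D := ξ.foldl (fun d η => P.Sbar η * d) P.one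

/-- `D` is *tame*: there is a sequence of multivectors `ξ_0, ξ_1, …` with entries in `ℰ`, of degrees
`1, …, 1, 2, …, 2, 3, …` (each degree on an interval of length `l`), such that the `S_{ξ_i} S̄_{ξ_i}`
of each degree sum up to one, and `S_{ξ_i}` and `S̄_{ξ_i}` are of polynomial growth. -/
def Tame : Prop :=
  ∃ (l : ℕ) (ξ : ℕ → List P.calE), 0 < l ∧ (∀ i, (ξ i).length = i / l + 1) ∧
    (∀ k, ∑ r ∈ Finset.range l, P.Smulti (ξ (l * k + r)) * P.Sbarmulti (ξ (l * k + r)) = P.one) ∧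
    ∀ p : Seminorm ℂ P.D, Continuous p → ∃ (N : ℕ) (M : ℝ), ∀ i : ℕ,
      p (P.Smulti (ξ i)) ≤ M * (1 + i) ^ N ∧ p (P.Sbarmulti (ξ i)) ≤ M * (1 + i) ^ N

/-- `D ⊗_π 𝒯^∞`. -/
noncomputable abbrev DT : LCAlg.{u} := tensor.{u, 0} P.D SmoothToeplitz.alg

/-- The element `d ⊗ x` of `D ⊗_π 𝒯^∞`. -/
noncomputable def pure (d : P.D) (x : SmoothToeplitz) : P.DT :=
  tmul.{u, 0} d (show SmoothToeplitz.alg from x)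

/-- The closed subalgebra of `D ⊗_π 𝒯^∞` generated by `𝒜 ⊗ 1`, `S(ℰ) ⊗ S` and `S̄(ℰ) ⊗ S̄`. -/
noncomputable def toeplitzSub : NonUnitalSubalgebra ℂ P.DT :=
  (NonUnitalAlgebra.adjoin ℂ ({x | ∃ a ∈ P.calASub, x = P.pure a SmoothToeplitz.one} ∪
    (Set.range fun ξ => P.pure (P.S ξ) SmoothToeplitz.S) ∪
    (Set.range fun ξ => P.pure (P.Sbar ξ) SmoothToeplitz.Sbar))).topologicalClosure

theorem isClosed_toeplitzSub : IsClosed (P.toeplitzSub : Set P.DT) :=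
  NonUnitalSubalgebra.isClosed_topologicalClosure _

/-- The Toeplitz algebra `𝒯^∞_D`. -/
noncomputable abbrev toeplitz : LCAlg.{u} := ofClosed P.DT P.toeplitzSub P.isClosed_toeplitzSub

/-- The inclusion `ι : 𝒜 ⟶ 𝒯^∞_D`, `a ↦ a ⊗ 1`. -/
noncomputable def ι : P.calA ⟶ P.toeplitz :=
  codRestrict (LCAlg.incl _ _ P.isClosed_calASub ≫
      tmulRight.{u, 0} (B := SmoothToeplitz.alg) P.D SmoothToeplitz.one
        (SmoothToeplitz.one_mul' _)) _ P.isClosed_toeplitzSub (fun a =>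
    NonUnitalSubalgebra.le_topologicalClosure _
      (NonUnitalAlgebra.subset_adjoin ℂ (Or.inl (Or.inl ⟨a.1, a.2, rfl⟩))))

/-- The inclusion `α : 𝒯^∞_D ⟶ D ⊗_π 𝒯^∞`. -/
noncomputable def α : P.toeplitz ⟶ P.DT := LCAlg.incl _ _ P.isClosed_toeplitzSub

theorem pure_mul (d d' : P.D) (x x' : SmoothToeplitz) :
    P.pure d x * P.pure d' x' = P.pure (d * d') (x * x') := tmul_mul d d' _ _

/-- The morphism `ᾱ = Ad(1 ⊗ S) : 𝒯^∞_D ⟶ D ⊗_π 𝒯^∞`, `x ↦ (1 ⊗ S) x (1 ⊗ S̄)`. -/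
noncomputable def αbar : P.toeplitz ⟶ P.DT :=
  P.α ≫ LCAlg.ad (P.pure P.one SmoothToeplitz.S) (P.pure P.one SmoothToeplitz.Sbar) (fun x => by
    rw [pure_mul, SmoothToeplitz.Sbar_mul_S, P.one_mul]
    exact tensor_one_mul P.one_mul SmoothToeplitz.one_mul' x)

/-- The quasihomomorphism `(α, ᾱ) : 𝒯^∞_D ⇉ D ⊗_π 𝒯^∞ ⊵ C`, the minimal one for `α` and `ᾱ`. -/
noncomputable def quasi : QuasiHom P.toeplitz P.DT := QuasiHom.associated P.α P.αbar

/-- The algebra `C`. -/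
noncomputable abbrev C : LCAlg.{u} := P.quasi.target

theorem e_mul_e : SmoothToeplitz.e * SmoothToeplitz.e = SmoothToeplitz.e :=
  congrArg Subtype.val K.e_mul_e

theorem pure_e_mem (a : P.calA) : P.pure a.1 SmoothToeplitz.e ∈ P.quasi.B := by
  have h := P.quasi.sub_mem (ap P.ι a)
  have e1 : ap P.quasi.α (ap P.ι a) = P.pure a.1 SmoothToeplitz.one := rfl
  have e2 : ap P.quasi.β (ap P.ι a) = P.pure P.one SmoothToeplitz.S *
    P.pure a.1 SmoothToeplitz.one * P.pure P.one SmoothToeplitz.Sbar := rfl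
  rw [e1, e2, pure_mul, pure_mul, P.one_mul, P.mul_one, SmoothToeplitz.mul_one'] at h
  have e3 : P.pure a.1 SmoothToeplitz.e = P.pure a.1 SmoothToeplitz.one -
      P.pure a.1 (SmoothToeplitz.S * SmoothToeplitz.Sbar) := tmul_sub _ _ _
  rw [e3]
  exact h

/-- The inclusion `ι_C : 𝒜 ⟶ C`, `a ↦ a ⊗ e`. -/
noncomputable def ιC : P.calA ⟶ P.C :=
  codRestrict (LCAlg.incl _ _ P.isClosed_calASub ≫
    tmulRight.{u, 0} (B := SmoothToeplitz.alg) P.D SmoothToeplitz.e e_mul_e) _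
    P.quasi.isClosed P.pure_e_mem

end PimsnerSubalgebra
end Pimsner

/-! ### Split exact functors on products and orthogonal sums -/

section SplitExactFunctor
open LCAlg
variable {H : LCAlg.{u} ⥤ AddCommGrpCat.{v}}

/-! Write y for the map `P.quasi.map H hH`. Since a ⊗ 1 = a ⊗ S S̄ + a ⊗ e, the homomorphism α ∘ ι
is the orthogonal sum of ᾱ ∘ ι and ι_C. Split exact functors are additive on orthogonal sums
(`SplitExact.map_add`), hence y ∘ H(ι) = H(ι_C) (`map_ι_quasi`). This already gives (i): if z is a
right inverse of H(ι_C), then H(ι) ∘ z is a right inverse of y.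

For tame D it is enough to find g : H(C) → H(𝒜) with g y H(ι) = 1 and H(ι) g y = 1
(`TameFamily.exists_inverse`): then H(ι) g is a left inverse of y, and g y is inverse to H(ι).
Tameness provides in each degree elements W_i = S_ξ and V_i = S̄_ξ with ∑ W_i V_i = 1, a `Frame`, to
which degree zero is added. If b maps degree m to degree n, then the coefficients V_i b W_j lie in
𝒜, because S̄_ξ a S_η ∈ 𝒜 for a ∈ 𝒜 and multivectors ξ, η of equal length. The closed span
`Frame.cpt` of all b ⊗ e_{nm} with such b contains C, and b ⊗ e_{nm} ↦ ∑ e_{ij} ⊗ V_i b W_j extends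
to a continuous homomorphism M into 𝒦^∞ ⊗ 𝒜 (`exists_frameHom`), because the rapid decay of matrix
entries beats the polynomial growth of V and W. Restricted along ι_C it is the stabilisation, so g
is H(M) on C followed by the inverse of stabilisation, and g y H(ι) = 1.

For the other identity the argument is repeated one level up, in D ⊗ 𝒯^∞ ⊗ 𝒯^∞, with coefficients in
𝒯^∞_D instead of 𝒜, along the map θ(d ⊗ s) = d ⊗ 1 ⊗ s. On 𝒯^∞_D the homomorphism θ α is joined to
the orthogonal sum of θ ᾱ and x ↦ x ⊗ e by a smooth path that differs from θ α only by compact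
matrices: the part S_ξ ⊗ 1 ⊗ e_{10} of S_ξ ⊗ 1 ⊗ S is rotated to S_ξ ⊗ S ⊗ e_{00}
(`exists_rotation_path`, `TameFamily.exists_path`). By diffotopy invariance and additivity, (θ α, θ
ᾱ) induces the same map as x ↦ x ⊗ e (`map_inclC_θcpt`). The frame homomorphism over 𝒯^∞_D turns
this into the stabilisation, and naturality of frame homomorphisms along ι yields H(ι) g y = 1.

The path exists because a left invertible v with left inverse v' defines a homomorphism S ↦ v, S̄ ↦
v' on 𝒯^∞ as soon as the powers of v and v' grow polynomially (`SmoothToeplitz.exists_hom`). For the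
rotating isometry this growth, derivatives in the parameter included, is read off from a closed
formula for its powers (`npw_twisted`). -/

theorem LCAlg.hom_ext {A B : LCAlg.{u}} {f g : A ⟶ B} (h : ∀ a, ap f a = ap g a) : f = g := by
  obtain ⟨f, hf⟩ := f
  obtain ⟨g, hg⟩ := g
  have : f = g := NonUnitalAlgHom.ext h
  subst this
  rfl

theorem LCAlg.ap_sub {A B : LCAlg.{u}} (f : A ⟶ B) (x y : A) : ap f (x - y) = ap f x - ap f y :=
  map_sub (Hom.toAlgHom f) x y

theorem LCAlg.ap_sum {A B : LCAlg.{u}} (f : A ⟶ B) {ι : Type*} (s : Finset ι) (x : ι → A) :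
    ap f (∑ i ∈ s, x i) = ∑ i ∈ s, ap f (x i) :=
  map_sum (Hom.toAlgHom f) x s

/-- The inclusion of the first factor of a product. -/
def LCAlg.inl (A B : LCAlg.{u}) : A ⟶ LCAlg.prod A B :=
  mkHom (B := LCAlg.prod A B) (NonUnitalAlgHom.inl ℂ A B) (continuous_id.prodMk continuous_const)

/-- The inclusion of the second factor of a product. -/
def LCAlg.inr (A B : LCAlg.{u}) : B ⟶ LCAlg.prod A B :=
  mkHom (B := LCAlg.prod A B) (NonUnitalAlgHom.inr ℂ A B) (continuous_const.prodMk continuous_id)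

/-- The projection to the first factor of a product. -/
def LCAlg.fst (A B : LCAlg.{u}) : LCAlg.prod A B ⟶ A :=
  mkHom (A := LCAlg.prod A B) (NonUnitalAlgHom.fst ℂ A B) continuous_fst

/-- The projection to the second factor of a product. -/
def LCAlg.snd (A B : LCAlg.{u}) : LCAlg.prod A B ⟶ B :=
  mkHom (A := LCAlg.prod A B) (NonUnitalAlgHom.snd ℂ A B) continuous_snd

theorem SplitExact.prod_right (hH : SplitExact H) (A B : LCAlg.{u}) :
    Function.Exact (H.map (inl A B)) (H.map (snd A B)) := by
  refine (hH A (prod A B) B (inl A B) (snd A B) (inr A B) ?_ (fun b => ?_) rfl).2.1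
  · exact IsEmbedding.of_comp (g := Prod.fst) (ap_continuous _) continuous_fst IsEmbedding.id
  · exact ⟨fun h => ⟨b.1, Prod.ext rfl (Eq.symm h)⟩, by rintro ⟨a, rfl⟩; rfl⟩

theorem SplitExact.prod_left (hH : SplitExact H) (A B : LCAlg.{u}) :
    Function.Exact (H.map (inr A B)) (H.map (fst A B)) := by
  refine (hH B (prod A B) A (inr A B) (fst A B) (inl A B) ?_ (fun b => ?_) rfl).2.1
  · exact IsEmbedding.of_comp (g := Prod.snd) (ap_continuous _) continuous_snd IsEmbedding.id
  · exact ⟨fun h => ⟨b.2, Prod.ext (Eq.symm h) rfl⟩, by rintro ⟨a, rfl⟩; rfl⟩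

theorem LCAlg.map_comp_apply {A B C : LCAlg.{u}} (f : A ⟶ B) (g : B ⟶ C) (x : H.obj A) :
    H.map (f ≫ g) x = H.map g (H.map f x) := by
  rw [H.map_comp, ConcreteCategory.comp_apply]

/-- Removing the B-part of x leaves an element of the kernel of H(snd), which by split exactness
comes from H(A). Applying H(fst) identifies the element it comes from. -/
theorem SplitExact.prod_decomp (hH : SplitExact H) (A B : LCAlg.{u}) (x : H.obj (prod A B)) :
    x = H.map (inl A B) (H.map (fst A B) x) + H.map (inr A B) (H.map (snd A B) x) := by
  have h0 : H.map (snd A B) (x - H.map (inr A B) (H.map (snd A B) x)) = 0 := by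
    rw [map_sub, ← map_comp_apply (inr A B) (snd A B), show inr A B ≫ snd A B = 𝟙 B from rfl,
      H.map_id, ConcreteCategory.id_apply, sub_self]
  obtain ⟨z, hz⟩ := (hH.prod_right A B _).1 h0
  have h1 := congrArg (H.map (fst A B)) hz
  rw [← map_comp_apply (inl A B) (fst A B), show inl A B ≫ fst A B = 𝟙 A from rfl,
    H.map_id, ConcreteCategory.id_apply, map_sub, (hH.prod_left A B _).2 ⟨_, rfl⟩,
    sub_zero] at h1
  rw [← h1, hz, sub_add_cancel]

/-- A split exact functor is additive on orthogonal sums of homomorphisms. -/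
theorem SplitExact.map_add (hH : SplitExact H) {A B : LCAlg.{u}} (f g k : A ⟶ B)
    (hk : ∀ a, ap k a = ap f a + ap g a) (hfg : ∀ a b, ap f a * ap g b = 0)
    (hgf : ∀ a b, ap g a * ap f b = 0) : H.map k = H.map f + H.map g := by
  -- Orthogonality of f and g is what makes (a, a') ↦ f a + g a' multiplicative. Then k is this map
  -- after the diagonal, and the decomposition of H(A × A) applies.
  let m : prod A A ⟶ B := mkHom (A := prod A A)
    { toFun := fun p => ap f p.1 + ap g p.2
      map_smul' := fun c p => by
        simp only [Prod.smul_fst, Prod.smul_snd, ap_smul, smul_add, MonoidHom.id_apply]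
      map_zero' := by simp only [Prod.fst_zero, Prod.snd_zero, ap_zero, add_zero]
      map_add' := fun p q => by
        simp only [Prod.fst_add, Prod.snd_add, ap_add]; abel
      map_mul' := fun p q => by
        simp only [Prod.fst_mul, Prod.snd_mul, ap_mul, mul_add, add_mul, hfg, hgf, add_zero,
          zero_add] }
    (((ap_continuous f).comp continuous_fst).add ((ap_continuous g).comp continuous_snd))
  let d : A ⟶ prod A A := mkHom (B := prod A A)
    ((NonUnitalAlgHom.id ℂ A).prod (NonUnitalAlgHom.id ℂ A)) (continuous_id.prodMk continuous_id)
  have e : k = d ≫ m := hom_ext hk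
  have e1 : inl A A ≫ m = f := hom_ext fun a => by
    change ap f a + ap g 0 = ap f a
    rw [ap_zero, add_zero]
  have e2 : inr A A ≫ m = g := hom_ext fun a => by
    change ap f 0 + ap g a = ap g a
    rw [ap_zero, zero_add]
  ext x
  change H.map k x = H.map f x + H.map g x
  rw [e, map_comp_apply, hH.prod_decomp A A (H.map d x), _root_.map_add, ← map_comp_apply d,
    ← map_comp_apply d, show d ≫ fst A A = 𝟙 A from rfl, show d ≫ snd A A = 𝟙 A from rfl,
    H.map_id, ConcreteCategory.id_apply, ← map_comp_apply, ← map_comp_apply, e1, e2]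

end SplitExactFunctor

/-! ### Seminorm estimates in locally convex spaces -/

section Seminorms

/-- Continuity at the origin gives unit balls of q and r on which p ∘ f is less than one. The
arguments are scaled into these balls by q a + δ and r b + δ, because q a and r b may vanish, and
then δ tends to zero. -/
theorem exists_seminorm_bilin {A B E : Type*} [AddCommGroup A] [Module ℂ A] [TopologicalSpace A]
    [IsTopologicalAddGroup A] [ContinuousSMul ℂ A] [LocallyConvexSpace ℝ A]
    [AddCommGroup B] [Module ℂ B] [TopologicalSpace B]
    [IsTopologicalAddGroup B] [ContinuousSMul ℂ B] [LocallyConvexSpace ℝ B]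
    [AddCommGroup E] [Module ℂ E] [TopologicalSpace E]
    (f : A →ₗ[ℂ] B →ₗ[ℂ] E) (hf : Continuous fun z : A × B => f z.1 z.2)
    (p : Seminorm ℂ E) (hp : Continuous p) :
    ∃ (q : Seminorm ℂ A) (r : Seminorm ℂ B), Continuous q ∧ Continuous r ∧
      ∀ a b, p (f a b) ≤ q a * r b := by
  have hU : {z : A × B | p (f z.1 z.2) < 1} ∈ 𝓝 (0 : A × B) :=
    (isOpen_lt (hp.comp hf) continuous_const).mem_nhds (by simp)
  obtain ⟨U, hU1, V, hV1, hUV⟩ := mem_nhds_prod_iff.1 hU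
  obtain ⟨q, hq, hqU⟩ := exists_seminorm_of_mem_nhds hU1
  obtain ⟨r, hr, hrV⟩ := exists_seminorm_of_mem_nhds hV1
  refine ⟨q, r, hq, hr, fun a b => ?_⟩
  have key : ∀ δ > 0, p (f a b) ≤ (q a + δ) * (r b + δ) := by
    intro δ hδ
    have ha : 0 < q a + δ := add_pos_of_nonneg_of_pos (apply_nonneg q a) hδ
    have hb : 0 < r b + δ := add_pos_of_nonneg_of_pos (apply_nonneg r b) hδ
    have auxa : q (((q a + δ : ℝ) : ℂ)⁻¹ • a) < 1 := by
      rw [map_smul_eq_mul, norm_inv, Complex.norm_real, Real.norm_of_nonneg ha.le,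
        inv_mul_lt_iff₀ ha, mul_one]
      linarith
    have auxb : r (((r b + δ : ℝ) : ℂ)⁻¹ • b) < 1 := by
      rw [map_smul_eq_mul, norm_inv, Complex.norm_real, Real.norm_of_nonneg hb.le,
        inv_mul_lt_iff₀ hb, mul_one]
      linarith
    have h1 : p (f (((q a + δ : ℝ) : ℂ)⁻¹ • a) (((r b + δ : ℝ) : ℂ)⁻¹ • b)) < 1 :=
      hUV (Set.mk_mem_prod (hqU _ auxa) (hrV _ auxb))
    rw [map_smul, map_smul f, LinearMap.smul_apply, smul_smul, map_smul_eq_mul, norm_mul, norm_inv,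
      norm_inv, Complex.norm_real,
      Complex.norm_real, Real.norm_of_nonneg ha.le, Real.norm_of_nonneg hb.le, ← mul_inv,
      inv_mul_lt_iff₀ (mul_pos hb ha), mul_one, mul_comm] at h1
    exact h1.le
  have lim : Tendsto (fun δ : ℝ => (q a + δ) * (r b + δ)) (𝓝[>] 0) (𝓝 ((q a + 0) * (r b + 0))) :=
    (Continuous.tendsto (by fun_prop) 0).mono_left nhdsWithin_le_nhds
  rw [add_zero, add_zero] at lim
  exact ge_of_tendsto lim (eventually_nhdsWithin_of_forall key)

variable {E : Type*} [AddCommGroup E] [Module ℂ E] [UniformSpace E]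
    [IsUniformAddGroup E] [ContinuousSMul ℂ E] [LocallyConvexSpace ℝ E]

theorem Seminorm.map_sum_le' (p : Seminorm ℂ E) {ι : Type*} (s : Finset ι) (f : ι → E) :
    p (∑ i ∈ s, f i) ≤ ∑ i ∈ s, p (f i) :=
  Finset.le_sum_of_subadditive p (map_zero p).le (map_add_le_add p) s f

/-- In a complete locally convex space, absolutely summable families are summable. -/
theorem summable_of_summable_seminorm [CompleteSpace E] {ι : Type*} {f : ι → E}
    (h : ∀ p : Seminorm ℂ E, Continuous p → Summable fun i => p (f i)) : Summable f := by
  rw [summable_iff_vanishing]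
  intro U hU
  obtain ⟨p, hp, hpU⟩ := exists_seminorm_of_mem_nhds hU
  obtain ⟨s, hs⟩ := summable_iff_vanishing.1 (h p hp) (Set.Iio 1) (Iio_mem_nhds one_pos)
  exact ⟨s, fun t ht => hpU _ ((p.map_sum_le' t f).trans_lt (hs t ht))⟩

theorem continuous_of_seminorm_le {F : Type*} [AddCommGroup F] [Module ℂ F] [TopologicalSpace F]
    [IsTopologicalAddGroup F] (f : F →ₗ[ℂ] E)
    (h : ∀ p : Seminorm ℂ E, Continuous p → ∃ q : Seminorm ℂ F, Continuous q ∧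
      ∀ x, p (f x) ≤ q x) : Continuous f := by
  refine continuous_of_continuousAt_zero f ?_
  intro U hU
  rw [map_zero] at hU
  obtain ⟨p, hp, hpU⟩ := exists_seminorm_of_mem_nhds hU
  rw [Filter.mem_map]
  obtain ⟨q, hq, hpq⟩ := h p hp
  have : {x | q x < 1} ∈ 𝓝 (0 : F) := (isOpen_lt hq continuous_const).mem_nhds (by simp)
  exact Filter.mem_of_superset this fun x hx => hpU _ ((hpq x).trans_lt hx)

/-- The sum of an absolutely convergent family of linear maps. -/
theorem exists_sum_linear [CompleteSpace E] [T2Space E] {F : Type*} [AddCommGroup F] [Module ℂ F]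
    [TopologicalSpace F] [IsTopologicalAddGroup F] {ι : Type*}
    (f : ι → F →ₗ[ℂ] E)
    (h : ∀ p : Seminorm ℂ E, Continuous p → ∃ (q : Seminorm ℂ F) (c : ι → ℝ), Continuous q ∧
      Summable c ∧ ∀ i x, p (f i x) ≤ c i * q x) :
    ∃ g : F →ₗ[ℂ] E, Continuous g ∧ ∀ x, HasSum (fun i => f i x) (g x) := by
  have hs : ∀ x, Summable fun i => f i x := fun x => summable_of_summable_seminorm fun p hp => by
    obtain ⟨q, c, -, hc, hle⟩ := h p hp
    exact Summable.of_nonneg_of_le (fun i => apply_nonneg p _) (fun i => hle i x)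
      (hc.mul_right (q x))
  let g : F →ₗ[ℂ] E :=
    { toFun := fun x => ∑' i, f i x
      map_add' := fun x y => by
        simp only [map_add]; exact (hs x).tsum_add (hs y)
      map_smul' := fun c x => by
        simp only [map_smul]; exact (hs x).tsum_const_smul c }
  refine ⟨g, ?_, fun x => (hs x).hasSum⟩
  refine continuous_of_seminorm_le g fun p hp => ?_
  obtain ⟨q, c, hq, hc, hle⟩ := h p hp
  -- The c i are not assumed to be non-negative, hence the absolute values. The bound holds for the
  -- partial sums and passes to the limit.
  refine ⟨NNReal.mk (∑' i, |c i|) (tsum_nonneg fun i => abs_nonneg _) • q,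
    continuous_const.mul hq, fun x => ?_⟩
  change p (g x) ≤ (∑' i, |c i|) * q x
  refine le_of_tendsto ((hp.tendsto _).comp (hs x).hasSum) (Eventually.of_forall fun s => ?_)
  refine (p.map_sum_le' s _).trans ?_
  refine (Finset.sum_le_sum fun i _ => (hle i x).trans
    (mul_le_mul_of_nonneg_right (le_abs_self _) (apply_nonneg q x))).trans ?_
  rw [← Finset.sum_mul]
  exact mul_le_mul_of_nonneg_right (hc.abs.sum_le_tsum s fun i _ => abs_nonneg _)
    (apply_nonneg q x)

end Seminorms

/-! ### Universal property of the completed projective tensor product -/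

namespace LCAlg
variable {A : LCAlg.{u}} {B : LCAlg.{w}}

/-- Sums of pure tensors are dense in the completion. The form for additive maps lets identities in
several variables be tested on pure tensors one variable at a time, by composing with left and right
multiplications. -/
theorem dense_span_tmul {E : Type*} [AddCommGroup E] [TopologicalSpace E] [T2Space E]
    {f g : tensor A B →+ E} (hf : Continuous f) (hg : Continuous g)
    (h : ∀ a b, f (tmul a b) = g (tmul a b)) (x : tensor A B) : f x = g x := by
  refine congrFun (AlgCompletion.denseRange_of.equalizer hf hg (funext fun r => ?_)) x
  change f (AlgCompletion.of r) = g (AlgCompletion.of r)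
  induction r using ProjTensor.ind with
  | h0 => rw [AlgCompletion.of_zero, map_zero, map_zero]
  | ht a b => exact h a b
  | ha x y hx hy => rw [AlgCompletion.of_add, map_add, map_add, hx, hy]

/-- A continuous bilinear map factors through the completed projective tensor product. -/
theorem exists_tensorLift {E : Type*} [AddCommGroup E] [Module ℂ E] [UniformSpace E]
    [IsUniformAddGroup E] [ContinuousSMul ℂ E] [LocallyConvexSpace ℝ E] [CompleteSpace E]
    [T2Space E] (f : A →ₗ[ℂ] B →ₗ[ℂ] E) (hf : Continuous fun z : A × B => f z.1 z.2) :
    ∃ g : tensor A B →ₗ[ℂ] E, Continuous g ∧ ∀ a b, g (tmul a b) = f a b := by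
  let L : ProjTensor A B →ₗ[ℂ] E := TensorProduct.lift f
  have hL : ∀ a b, L (ProjTensor.tm a b) = f a b := fun a b => TensorProduct.lift.tmul a b
  have hLc : Continuous L := by
    refine continuous_of_seminorm_le L fun p hp => ?_
    obtain ⟨q, r, hq, hr, hb⟩ := exists_seminorm_bilin f hf p hp
    refine ⟨ProjTensor.projSeminorm q r, ProjTensor.continuous_proj hq hr, fun x => ?_⟩
    -- The pullback p ∘ L is bounded by q a * r b on pure tensors, so it lies below the largest
    -- seminorm with this property.
    refine ProjTensor.le_proj (r := p.comp L) (fun a b => ?_) x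
    change p (L (ProjTensor.tm a b)) ≤ _
    rw [hL]; exact hb a b
  have hu : UniformContinuous L := uniformContinuous_addMonoidHom_of_continuous
    (f := L.toAddMonoidHom) hLc
  let g0 : AlgCompletion (ProjTensor A B) → E := UniformSpace.Completion.extension L
  have hg0 : Continuous g0 := UniformSpace.Completion.continuous_extension
  have hg1 : ∀ r, g0 (AlgCompletion.of r) = L r := fun r =>
    UniformSpace.Completion.extension_coe hu r
  have hadd : ∀ x y, g0 (x + y) = g0 x + g0 y := by
    intro x y
    refine congrFun (AlgCompletion.denseRange_of.equalizer
      (g := fun x => g0 (x + y)) (h := fun x => g0 x + g0 y) ?_ ?_ (funext fun r => ?_)) x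
    · exact hg0.comp (continuous_id.add continuous_const)
    · exact hg0.add continuous_const
    refine congrFun (AlgCompletion.denseRange_of.equalizer
      (g := fun y => g0 (AlgCompletion.of r + y)) (h := fun y => g0 (AlgCompletion.of r) + g0 y)
      ?_ ?_ (funext fun s => ?_)) y
    · exact hg0.comp (continuous_const.add continuous_id)
    · exact continuous_const.add hg0
    simp only [Function.comp_apply]
    rw [← AlgCompletion.of_add, hg1, hg1, hg1, map_add]
  have hsmul : ∀ (c : ℂ) x, g0 (c • x) = c • g0 x := by
    intro c x
    refine congrFun (AlgCompletion.denseRange_of.equalizer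
      (g := fun x => g0 (c • x)) (h := fun x => c • g0 x) ?_ ?_ (funext fun r => ?_)) x
    · exact hg0.comp (continuous_const_smul c)
    · exact hg0.const_smul c
    simp only [Function.comp_apply]
    rw [← AlgCompletion.of_smul, hg1, hg1, map_smul]
  exact ⟨⟨⟨g0, hadd⟩, hsmul⟩, hg0, fun a b => (hg1 _).trans (hL a b)⟩

/-- Commuting homomorphisms define a homomorphism on the tensor product. -/
theorem exists_tensorLiftHom {Y : LCAlg.{max u w}} (f : A →ₙₐ[ℂ] Y) (hf : Continuous f)
    (g : B →ₙₐ[ℂ] Y) (hg : Continuous g) (hfg : ∀ a b, f a * g b = g b * f a) :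
    ∃ k : tensor A B ⟶ Y, ∀ a b, ap k (tmul a b) = f a * g b := by
  obtain ⟨k, hk, hk2⟩ := exists_tensorLift (A := A) (B := B)
    (LinearMap.mk₂ ℂ (fun a b => f a * g b) (fun a a' b => by rw [map_add, add_mul])
      (fun c a b => by rw [map_smul, smul_mul_assoc]) (fun a b b' => by rw [map_add, mul_add])
      (fun c a b => by rw [map_smul, mul_smul_comm]))
    ((hf.comp continuous_fst).mul (hg.comp continuous_snd))
  have hmul : ∀ x y, k (x * y) = k x * k y := by
    intro x y
    refine dense_span_tmul (f := k.toAddMonoidHom.comp (AddMonoidHom.mulRight y))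
      (g := (AddMonoidHom.mulRight (k y)).comp k.toAddMonoidHom)
      (hk.comp (continuous_id.mul continuous_const)) (hk.mul continuous_const) (fun a b => ?_) x
    refine dense_span_tmul (f := k.toAddMonoidHom.comp (AddMonoidHom.mulLeft (tmul a b)))
      (g := (AddMonoidHom.mulLeft (k (tmul a b))).comp k.toAddMonoidHom)
      (hk.comp (continuous_const.mul continuous_id)) (continuous_const.mul hk)
      (fun a' b' => ?_) y
    change k (tmul a b * tmul a' b') = k (tmul a b) * k (tmul a' b')
    rw [tmul_mul, hk2, hk2, hk2]
    change f (a * a') * g (b * b') = f a * g b * (f a' * g b')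
    rw [map_mul, map_mul, mul_assoc, ← mul_assoc (f a'), hfg a', mul_assoc, mul_assoc]
  exact ⟨mkHom { toFun := k, map_smul' := map_smul k, map_zero' := map_zero k,
                 map_add' := map_add k, map_mul' := hmul } hk, hk2⟩

/-- A family of functions that is uniformly bounded on pure tensors is equicontinuous. -/
theorem exists_seminorm_tensor_bound {ι : Type*} (g : ι → Seminorm ℂ (tensor A B))
    (hg : ∀ i, Continuous (g i)) {p : Seminorm ℂ A} {q : Seminorm ℂ B} (hp : Continuous p)
    (hq : Continuous q) (h : ∀ i a b, g i (tmul a b) ≤ p a * q b) :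
    ∃ R : Seminorm ℂ (tensor A B), Continuous R ∧ ∀ i x, g i x ≤ R x := by
  let V : Set (ProjTensor A B) := {x | ProjTensor.projSeminorm p q x < 1}
  have hV : V ∈ 𝓝 (0 : ProjTensor A B) :=
    (isOpen_lt (ProjTensor.continuous_proj hp hq) continuous_const).mem_nhds (by simp)
  -- This neighbourhood of zero in the completion does not depend on i, and every g i is at most one
  -- on it: on the image of V by maximality of the projective seminorm, on the closure by
  -- continuity. So a single R serves all i.
  have hcl : closure (AlgCompletion.of '' V) ∈ 𝓝 (0 : tensor A B) := by
    have := AlgCompletion.isDenseInducing_of.closure_image_mem_nhds hV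
    rwa [AlgCompletion.of_zero] at this
  let φ : ProjTensor A B →ₗ[ℂ] tensor A B :=
    ⟨⟨AlgCompletion.of, AlgCompletion.of_add⟩, AlgCompletion.of_smul⟩
  obtain ⟨R, hR, hRU⟩ := exists_seminorm_of_mem_nhds hcl
  refine ⟨R, hR, fun i x => ?_⟩
  have hle1 : ∀ y, R y < 1 → g i y ≤ 1 := fun y hy => by
    refine closure_minimal (s := AlgCompletion.of '' V) (t := {y | g i y ≤ 1}) ?_
      (isClosed_le (hg i) continuous_const) (hRU y hy)
    rintro _ ⟨r, hr, rfl⟩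
    refine (ProjTensor.le_proj (r := (g i).comp φ) (fun a b => h i a b) r).trans (le_of_lt hr)
  refine le_of_forall_pos_lt_add fun δ hδ => ?_
  have hpos : 0 < R x + δ / 2 := by have := apply_nonneg R x; linarith
  have h1 := hle1 (((R x + δ / 2 : ℝ) : ℂ)⁻¹ • x) (by
    rw [map_smul_eq_mul, norm_inv, Complex.norm_real, Real.norm_of_nonneg hpos.le,
      inv_mul_lt_iff₀ hpos]
    linarith)
  rw [map_smul_eq_mul, norm_inv, Complex.norm_real, Real.norm_of_nonneg hpos.le,
      inv_mul_le_iff₀ hpos] at h1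
  linarith

end LCAlg

/-! ### Linear maps on spaces of rapidly decreasing families -/

namespace Rapid
variable {X : Type} {w : X → ℕ}

theorem weight_mul_norm_cf_le (x : Rapid w) (m : ℕ) (i : X) :
    (w i : ℝ) ^ m * ‖cf x i‖ ≤ ‖x.1 m‖ := by
  have := lp.norm_apply_le_norm one_ne_zero (x.1 m) i
  rwa [apply_eq, norm_mul, norm_pow, Complex.norm_natCast] at this

/-- The weighted `ℓ¹`-norms as seminorms. -/
noncomputable def seminorm (w : X → ℕ) (m : ℕ) : Seminorm ℂ (Rapid w) :=
  (normSeminorm ℂ (lp (fun _ : X => ℂ) 1)).comp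
    ((LinearMap.proj m).comp (Rapid w).subtype)

theorem continuous_seminorm (m : ℕ) : Continuous (seminorm w m) :=
  (continuous_norm (E := lp (fun _ : X => ℂ) 1)).comp
    ((continuous_apply (A := fun _ : ℕ => lp (fun _ : X => ℂ) 1) m).comp continuous_subtype_val)

theorem norm_single (i : X) (m : ℕ) : ‖(single i : Rapid w).1 m‖ = (w i : ℝ) ^ m := by
  have h := enorm_apply (single i : Rapid w) m
  rw [wn, tsum_eq_single i (by intro j hj; simp [cf_single, hj]), cf_single, if_pos rfl,
    enorm_one, mul_one] at h
  have := congrArg ENNReal.toReal h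
  simpa using this

/-- A continuous seminorm is of polynomial growth in the weight on the unit vectors. -/
theorem exists_growth_single (hw : ∀ i, 0 < w i) (p : Seminorm ℂ (Rapid w)) (hp : Continuous p) :
    ∃ (N : ℕ) (C : ℝ), ∀ i, p (single i) ≤ C * (w i : ℝ) ^ N := by
  have h0 : {x : Rapid w | p x < 1} ∈ 𝓝 (0 : Rapid w) :=
    (isOpen_lt hp continuous_const).mem_nhds (by simp)
  rw [nhds_subtype_eq_comap] at h0
  obtain ⟨t, ht, hts⟩ := h0
  rw [nhds_pi, Filter.mem_pi] at ht
  obtain ⟨s, hs, r, hr, hrt⟩ := ht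
  have hδ : ∀ᶠ δ : ℝ in 𝓝[>] 0, ∀ m ∈ s, Metric.ball (0 : lp (fun _ : X => ℂ) 1) δ ⊆ r m := by
    rw [hs.eventually_all]
    intro m _
    obtain ⟨ε, hε, hball⟩ := Metric.mem_nhds_iff.1 (hr m)
    filter_upwards [Ioo_mem_nhdsGT hε] with δ hδ
    exact (Metric.ball_subset_ball hδ.2.le).trans hball
  obtain ⟨δ, hδ, hδ0⟩ := (hδ.and self_mem_nhdsWithin).exists
  have hδ0 : 0 < δ := hδ0
  obtain ⟨N, hN⟩ := hs.bddAbove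
  refine ⟨N, 2 / δ, fun i => ?_⟩
  have hwi : (1 : ℝ) ≤ w i := by exact_mod_cast hw i
  -- The unit vector at i has m-th norm (w i)^m, and only norms with m ≤ N enter the neighbourhood.
  -- The factor δ / 2 / (w i)^N therefore moves the vector into it; δ / 2 is used because the balls
  -- are open.
  have hc : 0 < δ / 2 / (w i : ℝ) ^ N := by positivity
  set c : ℝ := δ / 2 / (w i : ℝ) ^ N with hcdef
  have key : p ((c : ℂ) • single i) < 1 := by
    refine hts (hrt fun m hm => hδ m hm ?_)
    rw [mem_ball_zero_iff]
    change ‖(c : ℂ) • (single i : Rapid w).1 m‖ < δ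
    rw [norm_smul, Complex.norm_real, Real.norm_of_nonneg hc.le, norm_single]
    calc c * (w i : ℝ) ^ m ≤ c * (w i : ℝ) ^ N := by
          gcongr
          exact hN hm
      _ = δ / 2 := by rw [hcdef]; field_simp
      _ < δ := by linarith
  rw [map_smul_eq_mul, Complex.norm_real, Real.norm_of_nonneg hc.le] at key
  have h2 : p (single i) < c⁻¹ := by rw [← one_div, lt_div_iff₀ hc, mul_comm]; exact key
  refine h2.le.trans_eq ?_
  rw [hcdef]; field_simp

/-- Convergence is tested in each of the weighted ℓ¹-norms separately, where it is the usual
expansion of an ℓ¹-sequence. -/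
theorem hasSum_cf_smul_single (x : Rapid w) :
    HasSum (fun i => cf x i • (single i : Rapid w)) x := by
  classical
  refine tendsto_subtype_rng.2 (tendsto_pi_nhds.2 fun m => ?_)
  have h := lp.hasSum_single (p := 1) ENNReal.one_ne_top (x.1 m)
  refine Tendsto.congr (fun s => ?_) h
  have e : (∑ i ∈ s, cf x i • (single i : Rapid w)).1 m =
      ∑ i ∈ s, cf x i • (single i : Rapid w).1 m :=
    map_sum ((LinearMap.proj m).comp (Rapid w).subtype) _ s
  rw [e]
  refine Finset.sum_congr rfl fun i _ => lp.ext (funext fun j => ?_)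
  rw [lp.coeFn_smul, Pi.smul_apply, apply_eq, cf_single, lp.coeFn_single]
  by_cases hj : j = i
  · subst hj
    rw [Pi.single_eq_same, apply_eq, if_pos rfl, mul_one, smul_eq_mul, mul_comm]
  · rw [Pi.single_eq_of_ne hj, if_neg hj, mul_zero, smul_zero]

/-- A linear map on rapidly decreasing families with prescribed values of polynomial growth. -/
theorem exists_linear_of_growth (hw : ∀ i, 0 < w i)
    (hs : Summable fun i => ((w i : ℝ) ^ 2)⁻¹) {E : Type*} [AddCommGroup E]
    [Module ℂ E] [UniformSpace E] [IsUniformAddGroup E] [ContinuousSMul ℂ E]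
    [LocallyConvexSpace ℝ E] [CompleteSpace E] [T2Space E] (y : X → E)
    (hy : ∀ p : Seminorm ℂ E, Continuous p → ∃ (N : ℕ) (C : ℝ), ∀ i, p (y i) ≤ C * (w i : ℝ) ^ N) :
    ∃ L : Rapid w →ₗ[ℂ] E, Continuous L ∧ ∀ i, L (single i) = y i := by
  let f : X → Rapid w →ₗ[ℂ] E := fun i =>
    { toFun := fun x => cf x i • y i
      map_add' := fun x x' => by rw [cf_add, add_smul]
      map_smul' := fun c x => by rw [cf_smul, mul_smul, RingHom.id_apply] }
  obtain ⟨L, hL, hsum⟩ := exists_sum_linear f (fun p hp => by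
    obtain ⟨N, C, hC⟩ := hy p hp
    -- N powers of the weight absorb the growth of y, and the two further ones leave the summable
    -- factor w⁻².
    refine ⟨seminorm w (N + 2), fun i => |C| * ((w i : ℝ) ^ 2)⁻¹, continuous_seminorm _,
      hs.mul_left _, fun i x => ?_⟩
    have hwi : (0 : ℝ) < w i := by exact_mod_cast hw i
    change p (cf x i • y i) ≤ _ * ‖x.1 (N + 2)‖
    rw [map_smul_eq_mul]
    calc ‖cf x i‖ * p (y i) ≤ ‖cf x i‖ * (|C| * (w i : ℝ) ^ N) := by
          gcongr
          exact (hC i).trans (by gcongr; exact le_abs_self C)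
      _ = |C| * ((w i : ℝ) ^ 2)⁻¹ * ((w i : ℝ) ^ (N + 2) * ‖cf x i‖) := by
          rw [pow_add]; field_simp
      _ ≤ _ := by gcongr; exact weight_mul_norm_cf_le x (N + 2) i)
  refine ⟨L, hL, fun i => (hsum _).unique ?_⟩
  have : y i = cf (single i : Rapid w) i • y i := by rw [cf_single, if_pos rfl, one_smul]
  have h := hasSum_single (f := fun j => f j (single i)) i fun j hj => by
    change cf (single i : Rapid w) j • y j = 0
    rw [cf_single, if_neg hj, zero_smul]
  rwa [this]

end Rapid

/-! ### Generators, relations and universal property of the smooth Toeplitz algebra -/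

namespace SmoothToeplitz
open Rapid

theorem wK_pos (p : ℕ × ℕ) : 0 < wK p := by unfold wK; positivity
theorem wZ_pos (n : ℤ) : 0 < wZ n := by unfold wZ; positivity

theorem summable_nat_inv_sq : Summable fun l : ℕ => (((1 + l : ℕ) : ℝ) ^ 2)⁻¹ := by
  have := (summable_nat_add_iff 1).2 (Real.summable_nat_pow_inv.2 one_lt_two)
  simpa [add_comm] using this

theorem summable_wK : Summable fun p : ℕ × ℕ => ((wK p : ℝ) ^ 2)⁻¹ := by
  refine (summable_nat_inv_sq.mul_of_nonneg summable_nat_inv_sq (fun _ => by positivity)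
    (fun _ => by positivity)).congr fun p => ?_
  rw [wK, Nat.cast_mul, mul_pow, mul_inv]

theorem summable_wZ : Summable fun n : ℤ => ((wZ n : ℝ) ^ 2)⁻¹ := by
  refine Summable.of_nat_of_neg summable_nat_inv_sq ?_
  simpa [wZ] using summable_nat_inv_sq

/-- The inclusion of the smooth compact operators, as a linear map. -/
noncomputable def ofK : Rapid wK →ₗ[ℂ] SmoothToeplitz := LinearMap.inl ℂ (Rapid wK) (Rapid wZ)

/-- The linear map that sends a symbol to its Toeplitz operator. -/
noncomputable def ofZ : Rapid wZ →ₗ[ℂ] SmoothToeplitz := LinearMap.inr ℂ (Rapid wK) (Rapid wZ)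

theorem continuous_ofK : Continuous ofK :=
  (continuous_id.prodMk continuous_const : Continuous fun x : Rapid wK => (x, (0 : Rapid wZ)))

theorem continuous_ofZ : Continuous ofZ :=
  (continuous_const.prodMk continuous_id : Continuous fun x : Rapid wZ => ((0 : Rapid wK), x))

theorem ofK_add_ofZ (x : SmoothToeplitz) : ofK (kpart x) + ofZ (symb x) = x :=
  ext' (add_zero (kpart x)) (zero_add (symb x))

/-- The matrix units. -/
noncomputable def mu (i j : ℕ) : SmoothToeplitz := ofK (single (i, j))

/-- The Toeplitz operator with symbol `z ^ n`. -/
noncomputable def zp (n : ℤ) : SmoothToeplitz := ofZ (single n)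

theorem zp_zero : zp 0 = one := rfl
theorem zp_one : zp 1 = S := rfl
theorem zp_neg_one : zp (-1) = Sbar := rfl

/-- The matrix units and the Toeplitz operators with symbol `z ^ n` span a dense subspace. -/
theorem closed_induction {V : Submodule ℂ SmoothToeplitz} (hV : IsClosed (V : Set SmoothToeplitz))
    (hmu : ∀ i j, mu i j ∈ V) (hzp : ∀ n, zp n ∈ V) (x : SmoothToeplitz) : x ∈ V := by
  rw [← ofK_add_ofZ x]
  refine V.add_mem ?_ ?_
  · have h := (hasSum_cf_smul_single (kpart x)).map ofK continuous_ofK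
    refine hV.mem_of_tendsto h (Eventually.of_forall fun s => V.sum_mem fun i _ => ?_)
    rw [Function.comp_apply, map_smul]
    exact V.smul_mem _ (hmu i.1 i.2)
  · have h := (hasSum_cf_smul_single (symb x)).map ofZ continuous_ofZ
    refine hV.mem_of_tendsto h (Eventually.of_forall fun s => V.sum_mem fun i _ => ?_)
    rw [Function.comp_apply, map_smul]
    exact V.smul_mem _ (hzp i)

theorem linear_ext {E : Type*} [AddCommGroup E] [Module ℂ E] [TopologicalSpace E] [T2Space E]
    {f g : SmoothToeplitz →ₗ[ℂ] E} (hf : Continuous f) (hg : Continuous g)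
    (hmu : ∀ i j, f (mu i j) = g (mu i j)) (hzp : ∀ n, f (zp n) = g (zp n))
    (x : SmoothToeplitz) : f x = g x :=
  closed_induction (V := LinearMap.eqLocus f g) (isClosed_eq hf hg) hmu hzp x

theorem exists_linear_of_growth {E : Type*} [AddCommGroup E]
    [Module ℂ E] [UniformSpace E] [IsUniformAddGroup E] [ContinuousSMul ℂ E]
    [LocallyConvexSpace ℝ E] [CompleteSpace E] [T2Space E] (a : ℕ × ℕ → E) (b : ℤ → E)
    (ha : ∀ p : Seminorm ℂ E, Continuous p → ∃ (N : ℕ) (C : ℝ), ∀ i, p (a i) ≤ C * (wK i : ℝ) ^ N)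
    (hb : ∀ p : Seminorm ℂ E, Continuous p → ∃ (N : ℕ) (C : ℝ), ∀ i, p (b i) ≤ C * (wZ i : ℝ) ^ N) :
    ∃ L : SmoothToeplitz →ₗ[ℂ] E, Continuous L ∧ (∀ i j, L (mu i j) = a (i, j)) ∧
      ∀ n, L (zp n) = b n := by
  obtain ⟨L1, h1, h1'⟩ := Rapid.exists_linear_of_growth wK_pos summable_wK a ha
  obtain ⟨L2, h2, h2'⟩ := Rapid.exists_linear_of_growth wZ_pos summable_wZ b hb
  refine ⟨L1.comp (LinearMap.fst ℂ (Rapid wK) (Rapid wZ)) +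
    L2.comp (LinearMap.snd ℂ (Rapid wK) (Rapid wZ)),
    (h1.comp continuous_kpart).add (h2.comp continuous_symb), fun i j => ?_, fun n => ?_⟩
  · change L1 (single (i, j)) + L2 0 = _
    rw [map_zero, add_zero, h1']
  · change L1 0 + L2 (single n) = _
    rw [map_zero, zero_add, h2']

section relations

theorem mat_mu (i j k l : ℕ) : mat (mu i j) k l = if k = i ∧ l = j then 1 else 0 := by
  have : mat (mu i j) k l = cf (single (i, j) : Rapid wK) (k, l) + 0 := rfl
  rw [this, cf_single, add_zero]
  simp only [Prod.mk.injEq]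

theorem mat_zp (n : ℤ) (k l : ℕ) : mat (zp n) k l = if (k : ℤ) - l = n then 1 else 0 := by
  have : mat (zp n) k l = 0 + cf (single n : Rapid wZ) ((k : ℤ) - l) := rfl
  rw [this, cf_single, zero_add]
  congr

theorem mat_S_mul (x : SmoothToeplitz) (i j : ℕ) :
    mat (S * x) i j = if i = 0 then 0 else mat x (i - 1) j := by
  refine (mat_mul S x i j).unique ?_
  convert hasSum_single (f := fun l => mat S i l * mat x l j) (i - 1) ?_ using 1
  · rw [mat_S]
    split_ifs <;> first | omega | simp
  · intro l hl
    have : i ≠ l + 1 := by omega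
    simp [mat_S, this]

theorem mat_Sbar_mul (x : SmoothToeplitz) (i j : ℕ) : mat (Sbar * x) i j = mat x (i + 1) j := by
  refine (mat_mul Sbar x i j).unique ?_
  convert hasSum_single (f := fun l => mat Sbar i l * mat x l j) (i + 1) ?_ using 1
  · simp [mat_Sbar]
  · intro l hl; simp [mat_Sbar, hl]

theorem mat_mul_S (x : SmoothToeplitz) (i j : ℕ) : mat (x * S) i j = mat x i (j + 1) := by
  refine (mat_mul x S i j).unique ?_
  convert hasSum_single (f := fun l => mat x i l * mat S l j) (j + 1) ?_ using 1
  · simp [mat_S]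
  · intro l hl; simp [mat_S, hl]

theorem mat_mul_Sbar (x : SmoothToeplitz) (i j : ℕ) :
    mat (x * Sbar) i j = if j = 0 then 0 else mat x i (j - 1) := by
  refine (mat_mul x Sbar i j).unique ?_
  convert hasSum_single (f := fun l => mat x i l * mat Sbar l j) (j - 1) ?_ using 1
  · rw [mat_Sbar]
    split_ifs <;> first | omega | simp
  · intro l hl
    have : j ≠ l + 1 := by omega
    simp [mat_Sbar, this]

theorem S_mul_mu (i j : ℕ) : S * mu i j = mu (i + 1) j := by
  refine mat_injective fun k l => ?_
  rw [mat_S_mul, mat_mu, mat_mu]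
  split_ifs <;> first | omega | rfl

theorem Sbar_mul_mu_succ (i j : ℕ) : Sbar * mu (i + 1) j = mu i j := by
  refine mat_injective fun k l => ?_
  rw [mat_Sbar_mul, mat_mu, mat_mu]
  split_ifs <;> first | omega | rfl

theorem Sbar_mul_mu_zero (j : ℕ) : Sbar * mu 0 j = 0 := by
  refine mat_eq_zero fun k l => ?_
  simp [mat_Sbar_mul, mat_mu]

theorem mu_mul_Sbar (i j : ℕ) : mu i j * Sbar = mu i (j + 1) := by
  refine mat_injective fun k l => ?_
  rw [mat_mul_Sbar, mat_mu, mat_mu]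
  split_ifs <;> first | omega | rfl

theorem mu_succ_mul_S (i j : ℕ) : mu i (j + 1) * S = mu i j := by
  refine mat_injective fun k l => ?_
  rw [mat_mul_S, mat_mu, mat_mu]
  split_ifs <;> first | omega | rfl

theorem mu_zero_mul_S (i : ℕ) : mu i 0 * S = 0 := by
  refine mat_eq_zero fun k l => ?_
  simp [mat_mul_S, mat_mu]

theorem mu_mul_mu (i j k l : ℕ) : mu i j * mu k l = if j = k then mu i l else 0 := by
  have h : ∀ a b, mat (mu i j * mu k l) a b = if j = k then mat (mu i l) a b else 0 := by
    intro a b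
    refine (mat_mul _ _ a b).unique ?_
    convert hasSum_single (f := fun m => mat (mu i j) a m * mat (mu k l) m b) j ?_ using 1
    · simp only [mat_mu, and_true]
      split_ifs <;> first | omega | simp
    · intro m hm
      simp [mat_mu, hm]
  split_ifs with hjk
  · exact mat_injective fun a b => by rw [h, if_pos hjk]
  · exact mat_eq_zero fun a b => by rw [h, if_neg hjk]

theorem e_eq_mu : e = mu 0 0 := by
  refine mat_injective fun i j => ?_
  rw [e, mat_sub, mat_mul_Sbar, mat_one, mat_S, mat_mu]
  split_ifs <;> first | omega | simp

theorem S_mul_zp_nat (n : ℕ) : S * zp n = zp (n + 1 : ℕ) := by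
  refine mat_injective fun k l => ?_
  rw [mat_S_mul, mat_zp, mat_zp]
  split_ifs <;> first | omega | rfl

/-- Multiplication by S puts zero into row 0, where the matrix of z^(-n) has its single entry in
column n. This is the only point at which products of S with powers of z leave the Toeplitz
operators. -/
theorem S_mul_zp_neg (n : ℕ) : S * zp (-((n + 1 : ℕ) : ℤ)) = zp (-(n : ℤ)) - mu 0 n := by
  refine mat_injective fun k l => ?_
  rw [mat_S_mul, mat_sub, mat_zp, mat_zp, mat_mu]
  split_ifs <;> first | omega | simp

theorem Sbar_mul_zp (n : ℤ) : Sbar * zp n = zp (n - 1) := by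
  refine mat_injective fun k l => ?_
  rw [mat_Sbar_mul, mat_zp, mat_zp]
  split_ifs <;> first | omega | rfl

end relations

/-- The smooth Toeplitz algebra is topologically generated by `1`, `S` and `S̄`. -/
theorem mem_of_generators {V : NonUnitalSubalgebra ℂ SmoothToeplitz}
    (hV : IsClosed (V : Set SmoothToeplitz)) (h1 : one ∈ V) (hS : S ∈ V) (hSbar : Sbar ∈ V)
    (x : SmoothToeplitz) : x ∈ V := by
  have h0 : mu 0 0 ∈ V := by
    rw [← e_eq_mu, e]; exact sub_mem h1 (V.mul_mem hS hSbar)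
  have hi : ∀ i, mu i 0 ∈ V := fun i => by
    induction i with
    | zero => exact h0
    | succ i ih => rw [← S_mul_mu]; exact V.mul_mem hS ih
  have hp : ∀ n : ℕ, zp n ∈ V := fun n => by
    induction n with
    | zero => exact h1
    | succ n ih => rw [← S_mul_zp_nat]; exact V.mul_mem hS ih
  have hn : ∀ n : ℕ, zp (-(n : ℤ)) ∈ V := fun n => by
    induction n with
    | zero => exact h1
    | succ n ih =>
      rw [show (-((n + 1 : ℕ) : ℤ)) = -(n : ℤ) - 1 by push_cast; ring, ← Sbar_mul_zp]
      exact V.mul_mem hSbar ih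
  refine closed_induction (V := V.toSubmodule) hV (fun i j => ?_) (fun n => ?_) x
  · change mu i j ∈ V
    induction j with
    | zero => exact hi i
    | succ j ih => rw [← mu_mul_Sbar]; exact V.mul_mem ih hSbar
  · change zp n ∈ V
    obtain ⟨k, rfl | rfl⟩ := n.eq_nat_or_neg
    · exact hp k
    · exact hn k

/-- The powers of an element in an algebra with unit `u`. -/
def npw {Y : Type*} [Mul Y] (u v : Y) : ℕ → Y
  | 0 => u
  | n + 1 => v * npw u v n

theorem npw_succ' {Y : Type*} [Semigroup Y] {u v : Y} (hu : ∀ y, u * y = y) (hu' : ∀ y, y * u = y)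
    (n : ℕ) : npw u v n * v = npw u v (n + 1) := by
  induction n with
  | zero => change u * v = v * u; rw [hu, hu']
  | succ n ih =>
    change v * npw u v n * v = v * npw u v (n + 1)
    rw [mul_assoc, ih]

/-- The universal property of the smooth Toeplitz algebra. -/
theorem exists_hom {Y : LCAlg.{u}} {o v v' : Y} (ho : ∀ y, o * y = y) (ho' : ∀ y, y * o = y)
    (hv : v' * v = o)
    (hg : ∀ p : Seminorm ℂ Y, Continuous p →
      ∃ (N : ℕ) (C : ℝ), ∀ n : ℕ, p (npw o v n) ≤ C * (1 + n : ℕ) ^ N)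
    (hg' : ∀ p : Seminorm ℂ Y, Continuous p →
      ∃ (N : ℕ) (C : ℝ), ∀ n : ℕ, p (npw o v' n) ≤ C * (1 + n : ℕ) ^ N) :
    ∃ f : alg →ₙₐ[ℂ] Y, Continuous f ∧ f one = o ∧ f S = v ∧ f Sbar = v' := by
  -- The prospective image of e. It forces e_{ij} ↦ v^i ε v'^j and z^n ↦ v^n or v'^(-n). Polynomial
  -- growth makes this a continuous linear map, and multiplicativity is checked afterwards.
  let ε : Y := o - v * v'
  have hε : v' * ε = 0 := by
    rw [mul_sub, ho', ← mul_assoc, hv, ho, sub_self]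
  let b : ℤ → Y := fun n => if 0 ≤ n then npw o v n.toNat else npw o v' (-n).toNat
  have hb1 : ∀ n : ℕ, b n = npw o v n := fun n => by simp [b]
  have hb2 : ∀ n : ℕ, b (-(n : ℤ)) = npw o v' n := fun n => by
    rcases Nat.eq_zero_or_pos n with rfl | hn
    · simp [b, npw]
    · simp [b, hn.ne']
  obtain ⟨L, hL, hLmu, hLzp⟩ := exists_linear_of_growth
    (fun p => npw o v p.1 * ε * npw o v' p.2) b
    (fun p hp => by
      obtain ⟨q, hq, hpq⟩ := Y.exists_seminorm_mul p hp
      obtain ⟨r, hr, hqr⟩ := Y.exists_seminorm_mul q hq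
      obtain ⟨N, C, hC⟩ := hg r hr
      obtain ⟨N', C', hC'⟩ := hg' q hq
      -- Both exponents are raised to N + N', since the weight contains 1 + i and 1 + j only through
      -- their product.
      refine ⟨N + N', |C| * r ε * |C'|, fun ⟨i, j⟩ => ?_⟩
      have h1 : r (npw o v i) ≤ |C| * (1 + i : ℕ) ^ N :=
        (hC i).trans (by gcongr; exact le_abs_self C)
      have h2 : q (npw o v' j) ≤ |C'| * (1 + j : ℕ) ^ N' :=
        (hC' j).trans (by gcongr; exact le_abs_self C')
      have hi : (1 : ℝ) ≤ (1 + i : ℕ) := by push_cast; linarith [Nat.cast_nonneg (α := ℝ) i]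
      have hj : (1 : ℝ) ≤ (1 + j : ℕ) := by push_cast; linarith [Nat.cast_nonneg (α := ℝ) j]
      calc p (npw o v i * ε * npw o v' j) ≤ (r (npw o v i) * r ε) * q (npw o v' j) :=
            (hpq _ _).trans (mul_le_mul_of_nonneg_right (hqr _ _) (apply_nonneg _ _))
        _ ≤ (|C| * (1 + i : ℕ) ^ N * r ε) * (|C'| * (1 + j : ℕ) ^ N') := by
            gcongr
        _ = |C| * r ε * |C'| * ((1 + i : ℕ) ^ N * (1 + j : ℕ) ^ N') := by ring
        _ ≤ |C| * r ε * |C'| * ((1 + i : ℕ) ^ (N + N') * (1 + j : ℕ) ^ (N + N')) := by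
            gcongr <;> first | assumption | omega
        _ = _ := by rw [← mul_pow, wK, Nat.cast_mul])
    (fun p hp => by
      obtain ⟨N, C, hC⟩ := hg p hp
      obtain ⟨N', C', hC'⟩ := hg' p hp
      refine ⟨N + N', |C| + |C'|, fun n => ?_⟩
      have hw1 : ∀ k : ℕ, (1 : ℝ) ≤ (1 + k : ℕ) := fun k => by
        push_cast; linarith [Nat.cast_nonneg (α := ℝ) k]
      obtain ⟨k, rfl | rfl⟩ := n.eq_nat_or_neg
      · rw [hb1, show wZ (k : ℤ) = 1 + k by simp [wZ]]
        refine (hC k).trans ?_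
        gcongr
        · exact (le_abs_self C).trans (le_add_of_nonneg_right (abs_nonneg _))
        · exact hw1 k
        · omega
      · rw [hb2, show wZ (-(k : ℤ)) = 1 + k by simp [wZ]]
        refine (hC' k).trans ?_
        gcongr
        · exact (le_abs_self C').trans (le_add_of_nonneg_left (abs_nonneg _))
        · exact hw1 k
        · omega)
  -- It suffices to test on matrix units and powers of z, which span a dense subspace.
  have hLS : ∀ x, L (S * x) = v * L x := by
    refine linear_ext (f := L.comp (LinearMap.mulLeft ℂ S)) (g := (LinearMap.mulLeft ℂ v).comp L)
      (hL.comp (continuous_const.mul continuous_id)) (continuous_const.mul hL)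
      (fun i j => ?_) (fun n => ?_)
    · change L (S * mu i j) = v * L (mu i j)
      rw [S_mul_mu, hLmu, hLmu]
      simp only [npw, mul_assoc]
    · change L (S * zp n) = v * L (zp n)
      obtain ⟨k, rfl | rfl⟩ := n.eq_nat_or_neg
      · rw [S_mul_zp_nat, hLzp, hLzp, hb1, hb1]; rfl
      · rcases k with _ | k
        · have := S_mul_zp_nat 0
          simp only [Nat.cast_zero, neg_zero] at this ⊢
          rw [this, hLzp, hLzp, hb1]
          have h0 := hb1 0
          rw [Nat.cast_zero] at h0
          rw [h0]; rfl
        -- The correction term in the product of S with a negative power is matched by v v' = o - ε.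
        · rw [S_mul_zp_neg, map_sub, hLzp, hLzp, hLmu, hb2, hb2]
          simp only [npw]
          rw [ho, sub_mul, ho, mul_assoc, sub_sub_cancel]
  have hLSbar : ∀ x, L (Sbar * x) = v' * L x := by
    refine linear_ext (f := L.comp (LinearMap.mulLeft ℂ Sbar))
      (g := (LinearMap.mulLeft ℂ v').comp L)
      (hL.comp (continuous_const.mul continuous_id)) (continuous_const.mul hL)
      (fun i j => ?_) (fun n => ?_)
    · change L (Sbar * mu i j) = v' * L (mu i j)
      rcases i with _ | i
      · rw [Sbar_mul_mu_zero, hLmu, map_zero]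
        simp only [npw]
        rw [ho, ← mul_assoc, hε, zero_mul]
      · rw [Sbar_mul_mu_succ, hLmu, hLmu]
        simp only [npw]
        rw [← mul_assoc, ← mul_assoc, ← mul_assoc, hv, ho]
    · change L (Sbar * zp n) = v' * L (zp n)
      rw [Sbar_mul_zp, hLzp, hLzp]
      obtain ⟨k, rfl | rfl⟩ := n.eq_nat_or_neg
      · rcases k with _ | k
        · have h0 := hb1 0
          have h1 := hb2 1
          rw [Nat.cast_zero] at h0
          rw [Nat.cast_one] at h1
          rw [Nat.cast_zero, zero_sub, h0, h1]; rfl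
        · rw [show ((k + 1 : ℕ) : ℤ) - 1 = k by push_cast; ring, hb1, hb1]
          simp only [npw]
          rw [← mul_assoc, hv, ho]
      · rw [show -(k : ℤ) - 1 = -((k + 1 : ℕ) : ℤ) by push_cast; ring, hb2, hb2]
        rfl
  have hLone : L one = o := by
    rw [← zp_zero, hLzp]; exact hb1 0
  have hLS1 : L S = v := by rw [← zp_one, hLzp]; exact (hb1 1).trans (ho' v)
  have hLSb1 : L Sbar = v' := by rw [← zp_neg_one, hLzp]; exact (hb2 1).trans (ho' v')
  -- The left factors on which L is multiplicative form a closed subalgebra. It contains 1, S and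
  -- S̄, which generate.
  let V : NonUnitalSubalgebra ℂ SmoothToeplitz :=
    { carrier := {x | ∀ y, L (x * y) = L x * L y}
      add_mem' := fun {x x'} hx hx' y => by rw [add_mul, map_add, map_add, hx, hx', add_mul]
      zero_mem' := fun y => by rw [zero_mul, map_zero, zero_mul]
      smul_mem' := fun c x hx y => by
        rw [smul_mul_assoc, map_smul, map_smul, hx, smul_mul_assoc]
      mul_mem' := fun {x x'} hx hx' y => by
        rw [mul_assoc, hx, hx', hx, mul_assoc] }
  have hVc : IsClosed (V : Set SmoothToeplitz) := by
    have : (V : Set SmoothToeplitz) = ⋂ y, {x | L (x * y) = L x * L y} := by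
      ext x; simp only [Set.mem_iInter]; rfl
    rw [this]
    exact isClosed_iInter fun y => isClosed_eq (hL.comp (continuous_id.mul continuous_const))
      (hL.mul continuous_const)
  have hmul : ∀ x y, L (x * y) = L x * L y := fun x => by
    refine mem_of_generators hVc ?_ ?_ ?_ x
    · intro y; rw [one_mul', hLone, ho]
    · intro y; rw [hLS, hLS1]
    · intro y; rw [hLSbar, hLSb1]
  exact ⟨{ toFun := L, map_smul' := map_smul L, map_zero' := map_zero L,
           map_add' := map_add L, map_mul' := hmul }, hL, hLone, hLS1, hLSb1⟩

end SmoothToeplitz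

/-! ### Families of polynomial growth -/

section PolyGrowth

/-- The family `x` is of polynomial growth in the weight `w` for all continuous seminorms. -/
def PolyGrowth {ι : Type*} (w : ι → ℕ) {E : Type*} [AddCommGroup E] [Module ℂ E]
    [TopologicalSpace E] (x : ι → E) : Prop :=
  ∀ p : Seminorm ℂ E, Continuous p → ∃ (N : ℕ) (C : ℝ), ∀ i, p (x i) ≤ C * (w i : ℝ) ^ N

namespace PolyGrowth
variable {ι κ : Type*} {w : ι → ℕ}

section
variable {E : Type*} [AddCommGroup E] [Module ℂ E] [TopologicalSpace E] {x y : ι → E}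

theorem exists_nonneg (h : PolyGrowth w x) (p : Seminorm ℂ E) (hp : Continuous p) :
    ∃ (N : ℕ) (C : ℝ), 0 ≤ C ∧ ∀ i, p (x i) ≤ C * (w i : ℝ) ^ N := by
  obtain ⟨N, C, hC⟩ := h p hp
  exact ⟨N, |C|, abs_nonneg C, fun i => (hC i).trans (by gcongr; exact le_abs_self C)⟩

theorem comp (h : PolyGrowth w x) (φ : κ → ι) : PolyGrowth (w ∘ φ) (x ∘ φ) := fun p hp => by
  obtain ⟨N, C, hC⟩ := h p hp
  exact ⟨N, C, fun i => hC (φ i)⟩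

theorem mono {w' : ι → ℕ} (h : PolyGrowth w x) (hw : ∀ i, w i ≤ w' i) : PolyGrowth w' x :=
  fun p hp => by
    obtain ⟨N, C, hC0, hC⟩ := h.exists_nonneg p hp
    exact ⟨N, C, fun i => (hC i).trans (by gcongr; exact hw i)⟩

theorem const (c : E) : PolyGrowth w fun _ => c := fun p _ =>
  ⟨0, p c, fun i => by simp⟩

theorem add (hw : ∀ i, 0 < w i) (hx : PolyGrowth w x) (hy : PolyGrowth w y) :
    PolyGrowth w fun i => x i + y i := fun p hp => by
  obtain ⟨N, C, hC0, hC⟩ := hx.exists_nonneg p hp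
  obtain ⟨N', C', hC0', hC'⟩ := hy.exists_nonneg p hp
  refine ⟨N + N', C + C', fun i => ?_⟩
  have hwi : (1 : ℝ) ≤ w i := by exact_mod_cast hw i
  calc p (x i + y i) ≤ C * (w i : ℝ) ^ N + C' * (w i : ℝ) ^ N' :=
        (map_add_le_add p _ _).trans (add_le_add (hC i) (hC' i))
    _ ≤ C * (w i : ℝ) ^ (N + N') + C' * (w i : ℝ) ^ (N + N') := by
        gcongr <;> first | assumption | omega
    _ = _ := by ring

/-- The bound on the terms is uniform in k < n, so summing n of them costs one more power of 1 + n.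
-/
theorem sum_range {z : ℕ → ℕ → E}
    (hz : ∀ p : Seminorm ℂ E, Continuous p → ∃ (N : ℕ) (C : ℝ), 0 ≤ C ∧
      ∀ n k, k < n → p (z n k) ≤ C * ((1 + n : ℕ) : ℝ) ^ N) :
    PolyGrowth (fun n => 1 + n) fun n => ∑ k ∈ Finset.range n, z n k := fun p hp => by
  obtain ⟨N, C, hC0, hC⟩ := hz p hp
  refine ⟨N + 1, C, fun n => ?_⟩
  calc p (∑ k ∈ Finset.range n, z n k) ≤ ∑ k ∈ Finset.range n, p (z n k) :=
        Finset.le_sum_of_subadditive p (map_zero p).le (map_add_le_add p) _ _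
    _ ≤ ∑ k ∈ Finset.range n, C * ((1 + n : ℕ) : ℝ) ^ N :=
        Finset.sum_le_sum fun k hk => hC n k (Finset.mem_range.1 hk)
    _ = n * (C * ((1 + n : ℕ) : ℝ) ^ N) := by rw [Finset.sum_const, Finset.card_range, nsmul_eq_mul]
    _ ≤ ((1 + n : ℕ) : ℝ) * (C * ((1 + n : ℕ) : ℝ) ^ N) := by gcongr; omega
    _ = _ := by ring

end

theorem mul {Y : LCAlg.{u}} {x y : ι → Y} (hx : PolyGrowth w x)
    (hy : PolyGrowth w y) : PolyGrowth w fun i => x i * y i := fun p hp => by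
  obtain ⟨q, hq, hpq⟩ := Y.exists_seminorm_mul p hp
  obtain ⟨N, C, hC0, hC⟩ := hx.exists_nonneg q hq
  obtain ⟨N', C', hC0', hC'⟩ := hy.exists_nonneg q hq
  refine ⟨N + N', C * C', fun i => (hpq _ _).trans ?_⟩
  calc q (x i) * q (y i) ≤ (C * (w i : ℝ) ^ N) * (C' * (w i : ℝ) ^ N') :=
        mul_le_mul (hC i) (hC' i) (apply_nonneg _ _) (by positivity)
    _ = _ := by ring

theorem map {Y Y' : Type*} [AddCommGroup Y] [Module ℂ Y] [TopologicalSpace Y] [AddCommGroup Y']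
    [Module ℂ Y'] [TopologicalSpace Y'] {x : ι → Y} (hx : PolyGrowth w x) (f : Y →ₗ[ℂ] Y')
    (hf : Continuous f) : PolyGrowth w fun i => f (x i) :=
  fun p hp => hx (p.comp f) (hp.comp hf)

end PolyGrowth
end PolyGrowth

/-! ### Flat functions and derivatives of their powers -/

section FlatFunctions
open scoped ContDiff

/-- A smooth function on the line that is constant on `(-∞, 0]` and on `[1, ∞)`. -/
structure IsFlat (g : ℝ → ℂ) : Prop where
  contDiff : ContDiff ℝ ∞ g
  left : ∀ x ≤ 0, g x = g 0
  right : ∀ x, 1 ≤ x → g x = g 1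

namespace IsFlat
variable {g h : ℝ → ℂ}

theorem const (c : ℂ) : IsFlat fun _ => c := ⟨contDiff_const, fun _ _ => rfl, fun _ _ => rfl⟩

theorem mul (hg : IsFlat g) (hh : IsFlat h) : IsFlat fun x => g x * h x where
  contDiff := hg.contDiff.mul hh.contDiff
  left x hx := by simp only [hg.left x hx, hh.left x hx]
  right x hx := by simp only [hg.right x hx, hh.right x hx]

theorem sub (hg : IsFlat g) (hh : IsFlat h) : IsFlat fun x => g x - h x where
  contDiff := hg.contDiff.sub hh.contDiff
  left x hx := by simp only [hg.left x hx, hh.left x hx]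
  right x hx := by simp only [hg.right x hx, hh.right x hx]

theorem pow (hg : IsFlat g) (k : ℕ) : IsFlat fun x => g x ^ k where
  contDiff := hg.contDiff.pow k
  left x hx := by simp only [hg.left x hx]
  right x hx := by simp only [hg.right x hx]

theorem continuous_iteratedDeriv (hg : IsFlat g) (n : ℕ) : Continuous (iteratedDeriv n g) :=
  hg.contDiff.continuous_iteratedDeriv n (by exact_mod_cast le_top)

theorem hasDerivAt_iteratedDeriv (hg : IsFlat g) (n : ℕ) (x : ℝ) :
    HasDerivAt (iteratedDeriv n g) (iteratedDeriv (n + 1) g x) x := by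
  rw [iteratedDeriv_succ]
  exact (hg.contDiff.differentiable_iteratedDeriv n
    (by exact_mod_cast WithTop.coe_lt_top n) x).hasDerivAt

theorem iteratedDeriv_eq_zero_of_eventuallyEq {c : ℂ} {x : ℝ} (h : g =ᶠ[𝓝 x] fun _ => c) (n : ℕ) :
    iteratedDeriv (n + 1) g x = 0 := by
  rw [h.iteratedDeriv_eq, iteratedDeriv_succ']
  have : deriv (fun _ : ℝ => c) = fun _ => 0 := by ext; simp
  rw [this]
  simp

/-- The function is constant on one side of the point only, so the derivatives vanish on the open
half-line, and at its end point by continuity. -/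
theorem iteratedDeriv_zero_left (hg : IsFlat g) (n : ℕ) : iteratedDeriv (n + 1) g 0 = 0 := by
  have h1 : ∀ x ∈ Set.Iio (0 : ℝ), iteratedDeriv (n + 1) g x = 0 := fun x hx =>
    iteratedDeriv_eq_zero_of_eventuallyEq (c := g 0)
      (by filter_upwards [Iio_mem_nhds hx] with y hy using hg.left y (le_of_lt hy)) n
  have hcl : IsClosed {x | iteratedDeriv (n + 1) g x = 0} :=
    isClosed_eq (hg.continuous_iteratedDeriv _) continuous_const
  exact closure_minimal h1 hcl (by rw [closure_Iio]; exact Set.self_mem_Iic)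

theorem iteratedDeriv_zero_right (hg : IsFlat g) (n : ℕ) : iteratedDeriv (n + 1) g 1 = 0 := by
  have h1 : ∀ x ∈ Set.Ioi (1 : ℝ), iteratedDeriv (n + 1) g x = 0 := fun x hx =>
    iteratedDeriv_eq_zero_of_eventuallyEq (c := g 1)
      (by filter_upwards [Ioi_mem_nhds hx] with y hy using hg.right y (le_of_lt hy)) n
  have hcl : IsClosed {x | iteratedDeriv (n + 1) g x = 0} :=
    isClosed_eq (hg.continuous_iteratedDeriv _) continuous_const
  exact closure_minimal h1 hcl (by rw [closure_Ioi]; exact Set.self_mem_Ici)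

end IsFlat

/-- The derivatives of the powers of a smooth function bounded by one grow polynomially. -/
theorem exists_bound_iteratedDeriv_pow {h : ℝ → ℂ} (hh : ContDiff ℝ ∞ h)
    (hb : ∀ t ∈ Set.Icc (0 : ℝ) 1, ‖h t‖ ≤ 1) (j : ℕ) :
    ∀ g : ℝ → ℂ, ContDiff ℝ ∞ g → ∃ C : ℝ, 0 ≤ C ∧ ∀ k : ℕ, ∀ t ∈ Set.Icc (0 : ℝ) 1,
      ‖iteratedDeriv j (fun x => g x * h x ^ k) t‖ ≤ C * ((1 + k : ℕ) : ℝ) ^ j := by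
  induction j with
  | zero =>
    intro g hg
    obtain ⟨C, hC⟩ := isCompact_Icc.exists_bound_of_continuousOn
      (s := Set.Icc (0 : ℝ) 1) hg.continuous.continuousOn
    have hC0 : 0 ≤ C := (norm_nonneg _).trans (hC 0 (by simp))
    refine ⟨C, hC0, fun k t ht => ?_⟩
    rw [iteratedDeriv_zero, pow_zero, mul_one, norm_mul, norm_pow]
    exact (mul_le_of_le_one_right (norm_nonneg _) (pow_le_one₀ (norm_nonneg _) (hb t ht))).trans
      (hC t ht)
  | succ j ih =>
    intro g hg
    have hg' : ContDiff ℝ ∞ (deriv g) := (contDiff_infty_iff_deriv.1 hg).2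
    have hh' : ContDiff ℝ ∞ (deriv h) := (contDiff_infty_iff_deriv.1 hh).2
    obtain ⟨C1, hC10, hC1⟩ := ih (deriv g) hg'
    obtain ⟨C2, hC20, hC2⟩ := ih (fun x => g x * deriv h x) (hg.mul hh')
    refine ⟨C1 + C2, by positivity, fun k t ht => ?_⟩
    -- Differentiation replaces the prefactor g by g' and by g h', which is why the induction runs
    -- over all smooth g; it costs one factor k. For k = 0 the truncated exponent k - 1 is harmless,
    -- as its coefficient vanishes.
    have hd : deriv (fun x => g x * h x ^ k) =
        fun x => deriv g x * h x ^ k + (k : ℂ) * (g x * deriv h x * h x ^ (k - 1)) := by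
      ext x
      have d1 : HasDerivAt g (deriv g x) x :=
        (hg.differentiable (by simp) x).hasDerivAt
      have d2 : HasDerivAt h (deriv h x) x :=
        (hh.differentiable (by simp) x).hasDerivAt
      refine (d1.mul (d2.pow k)).deriv.trans ?_
      simp only [Pi.pow_apply]
      ring
    rw [iteratedDeriv_succ', hd]
    have s1 : ContDiff ℝ ∞ fun x => deriv g x * h x ^ k := hg'.mul (hh.pow k)
    have s2 : ContDiff ℝ ∞ fun x => g x * deriv h x * h x ^ (k - 1) :=
      (hg.mul hh').mul (hh.pow _)
    have hj : ((j : ℕ∞) : WithTop ℕ∞) ≤ ((⊤ : ℕ∞) : WithTop ℕ∞) := by exact_mod_cast le_top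
    have e := iteratedDeriv_fun_add (n := j) (x := t)
      (f := fun x => deriv g x * h x ^ k)
      (g := fun x => (k : ℂ) * (g x * deriv h x * h x ^ (k - 1)))
      (s1.of_le hj).contDiffAt ((contDiff_const.mul s2).of_le hj).contDiffAt
    rw [e, iteratedDeriv_const_mul_field]
    refine (norm_add_le _ _).trans ?_
    have b1 := hC1 k t ht
    have b2 := hC2 (k - 1) t ht
    have hk1 : (1 : ℝ) ≤ ((1 + k : ℕ) : ℝ) := by push_cast; linarith [Nat.cast_nonneg (α := ℝ) k]
    rw [norm_mul, Complex.norm_natCast]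
    calc _ ≤ C1 * ((1 + k : ℕ) : ℝ) ^ j + (k : ℝ) * (C2 * ((1 + (k - 1) : ℕ) : ℝ) ^ j) := by
          gcongr
      _ ≤ C1 * ((1 + k : ℕ) : ℝ) ^ (j + 1) + ((1 + k : ℕ) : ℝ) * (C2 * ((1 + k : ℕ) : ℝ) ^ j) := by
          gcongr <;> first | exact hk1 | omega
      _ = _ := by ring

/-- A smooth function that increases from `0` to `1`, flat at the end points. -/
noncomputable def smoothStep (x : ℝ) : ℂ := (Real.smoothTransition x : ℂ)

theorem isFlat_smoothStep : IsFlat smoothStep where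
  contDiff := Complex.ofRealCLM.contDiff.comp Real.smoothTransition.contDiff
  left x hx := by
    simp only [smoothStep, Real.smoothTransition.zero_of_nonpos hx, Real.smoothTransition.zero]
  right x hx := by
    simp only [smoothStep, Real.smoothTransition.one_of_one_le hx, Real.smoothTransition.one]

theorem smoothStep_zero : smoothStep 0 = 0 := by simp [smoothStep]
theorem smoothStep_one : smoothStep 1 = 1 := by simp [smoothStep]

end FlatFunctions

/-! ### The algebra of smooth paths -/

namespace LCAlg
section Paths
variable {B : LCAlg.{u}}

/-- A neighbourhood of zero in Z B restricts only finitely many derivatives, each uniformly in t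
with respect to one continuous seminorm of B. This reduces estimates in Z B to pointwise estimates
of derivatives. -/
theorem exists_seminorm_smoothPaths (P : Seminorm ℂ (Z B)) (hP : Continuous P) :
    ∃ (n : ℕ) (q : Seminorm ℂ B), Continuous q ∧ ∀ (F : Z B) (c : ℝ), 0 ≤ c →
      (∀ i ≤ n, ∀ t, q (F.1 i t) ≤ c) → P F ≤ c := by
  have h0 : {x : Z B | P x < 1} ∈ 𝓝 (0 : Z B) :=
    (isOpen_lt hP continuous_const).mem_nhds (by simp)
  rw [nhds_subtype_eq_comap] at h0
  obtain ⟨t, ht, hts⟩ := h0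
  rw [nhds_pi, Filter.mem_pi] at ht
  obtain ⟨s, hs, r, hr, hrt⟩ := ht
  have hq : ∀ m, ∃ q : Seminorm ℂ B, Continuous q ∧
      ∀ f : C(I, B), (∀ t, q (f t) < 1) → f ∈ r m := by
    intro m
    obtain ⟨V, hV, hVr⟩ := UniformSpace.mem_nhds_iff.1 (hr m)
    obtain ⟨W, hW, hWV⟩ :=
      ContinuousMap.hasBasis_compactConvergenceUniformity_of_compact.mem_iff.1 hV
    obtain ⟨q, hq, hqW⟩ := exists_seminorm_of_mem_nhds (mem_nhds_left (0 : B) hW)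
    exact ⟨q, hq, fun f hf => hVr (hWV fun t => hqW _ (hf t))⟩
  choose q hqc hq using hq
  have hsum : ∀ (s : Finset ℕ) (x : B), (∑ m ∈ s, q m) x = ∑ m ∈ s, q m x := fun s x => by
    classical
    induction s using Finset.induction_on with
    | empty => rfl
    | insert a s ha ih => rw [Finset.sum_insert ha, Finset.sum_insert ha, ← ih]; rfl
  obtain ⟨N, hN⟩ := hs.bddAbove
  have hcont : Continuous ⇑(∑ m ∈ Finset.range (N + 1), q m) := by
    have : ⇑(∑ m ∈ Finset.range (N + 1), q m) = fun x => ∑ m ∈ Finset.range (N + 1), q m x := by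
      funext x; exact hsum _ x
    rw [this]
    exact continuous_finsetSum _ fun m _ => hqc m
  -- Summing dominates all the seminorms involved at once. Scaling by c + δ instead of c allows c =
  -- 0.
  refine ⟨N, ∑ m ∈ Finset.range (N + 1), q m, hcont, fun F c hc hF => ?_⟩
  refine le_of_forall_pos_lt_add fun δ hδ => ?_
  have hpos : 0 < c + δ := by linarith
  have key : P (((c + δ : ℝ) : ℂ)⁻¹ • F) < 1 := by
    refine hts (hrt fun m hm => hq m _ fun t => ?_)
    change q m (((c + δ : ℝ) : ℂ)⁻¹ • F.1 m t) < 1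
    rw [map_smul_eq_mul, norm_inv, Complex.norm_real, Real.norm_of_nonneg hpos.le,
      inv_mul_lt_iff₀ hpos]
    have h1 := hF m (hN hm) t
    rw [hsum] at h1
    have h2 := Finset.single_le_sum (f := fun i => q i (F.1 m t)) (fun i _ => apply_nonneg _ _)
      (Finset.mem_range.2 (Nat.lt_succ_of_le (hN hm)))
    linarith
  rw [map_smul_eq_mul, norm_inv, Complex.norm_real, Real.norm_of_nonneg hpos.le,
      inv_mul_lt_iff₀ hpos] at key
  linarith

theorem hasPathDeriv_smul_const {f f' : ℝ → ℂ} (hf : Continuous f) (hf' : Continuous f')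
    (h : ∀ t, HasDerivAt f (f' t) t) (x : B) :
    HasPathDeriv (⟨fun t : I => f t • x, by fun_prop⟩ : C(I, B)) ⟨fun t : I => f' t • x, by fun_prop⟩ := by
  intro t
  have h1 := hasDerivAt_iff_tendsto_slope.1 (h t)
  have h2 : Tendsto (fun s : I => (s : ℝ)) (𝓝[≠] t) (𝓝[≠] (t : ℝ)) :=
    tendsto_nhdsWithin_iff.2 ⟨(continuous_subtype_val.tendsto t).mono_left nhdsWithin_le_nhds,
      eventually_nhdsWithin_of_forall fun s hs e => hs (Subtype.ext e)⟩
  refine Tendsto.congr (fun s => ?_) ((h1.comp h2).smul_const x)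
  change slope f t s • x = (((s : ℝ) - t : ℝ) : ℂ)⁻¹ • (f s • x - f t • x)
  rw [slope_def_module, ← sub_smul, smul_smul, Complex.real_smul, Complex.ofReal_inv]

/-- The smooth path `t ↦ g t • x`. -/
noncomputable def flatPath {g : ℝ → ℂ} (hg : IsFlat g) (x : B) : Z B :=
  ⟨fun n => ⟨fun t : I => iteratedDeriv n g t • x,
      ((hg.continuous_iteratedDeriv n).comp continuous_subtype_val).smul continuous_const⟩, fun n =>
    ⟨hasPathDeriv_smul_const (hg.continuous_iteratedDeriv n) (hg.continuous_iteratedDeriv (n + 1))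
      (hg.hasDerivAt_iteratedDeriv n) x, by
        change iteratedDeriv (n + 1) g 0 • x = 0
        rw [hg.iteratedDeriv_zero_left, zero_smul], by
        change iteratedDeriv (n + 1) g 1 • x = 0
        rw [hg.iteratedDeriv_zero_right, zero_smul]⟩⟩

theorem Z_ext {F G : Z B} (h : ∀ t, F.1 0 t = G.1 0 t) : F = G :=
  smoothPaths_ext (ContinuousMap.ext h)

theorem flatPath_apply {g : ℝ → ℂ} (hg : IsFlat g) (x : B) (t : I) :
    (flatPath hg x).1 0 t = g t • x := by
  change iteratedDeriv 0 g t • x = _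
  rw [iteratedDeriv_zero]

theorem Z_add_apply (F G : Z B) (t : I) : (F + G).1 0 t = F.1 0 t + G.1 0 t := rfl
theorem Z_mul_apply (F G : Z B) (t : I) : (F * G).1 0 t = F.1 0 t * G.1 0 t := rfl
theorem Z_sum_apply {ι : Type*} (s : Finset ι) (F : ι → Z B) (t : I) :
    (∑ i ∈ s, F i).1 0 t = ∑ i ∈ s, (F i).1 0 t :=
  ap_sum (B.ev t) s F

/-- Only derivatives up to some order n matter for P, and the j-th derivative of g h^k is O((1 +
k)^j) because h is bounded by one. Thus powers of a scalar coefficient that varies with the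
parameter remain of polynomial growth in Z B. -/
theorem flatPath_growth {g h : ℝ → ℂ} (hg : IsFlat g) (hh : IsFlat h)
    (hb : ∀ t ∈ Set.Icc (0 : ℝ) 1, ‖h t‖ ≤ 1) (P : Seminorm ℂ (Z B)) (hP : Continuous P) :
    ∃ (q : Seminorm ℂ B) (N : ℕ) (C : ℝ), Continuous q ∧ 0 ≤ C ∧ ∀ (k : ℕ) (x : B),
      P (flatPath (hg.mul (hh.pow k)) x) ≤ C * ((1 + k : ℕ) : ℝ) ^ N * q x := by
  obtain ⟨n, q, hq, hle⟩ := exists_seminorm_smoothPaths P hP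
  choose C hC0 hC using fun j => exists_bound_iteratedDeriv_pow hh.contDiff hb j g hg.contDiff
  have hS0 : 0 ≤ ∑ j ∈ Finset.range (n + 1), C j := Finset.sum_nonneg fun j _ => hC0 j
  refine ⟨q, n, ∑ j ∈ Finset.range (n + 1), C j, hq, hS0, fun k x => hle _ _ ?_ fun i hi t => ?_⟩
  · have := apply_nonneg q x
    positivity
  · change q (iteratedDeriv i (fun y => g y * h y ^ k) t • x) ≤ _
    rw [map_smul_eq_mul]
    have hk1 : (1 : ℝ) ≤ ((1 + k : ℕ) : ℝ) := by push_cast; linarith [Nat.cast_nonneg (α := ℝ) k]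
    refine mul_le_mul_of_nonneg_right ((hC i k t t.2).trans ?_) (apply_nonneg q x)
    refine mul_le_mul ?_ (pow_le_pow_right₀ hk1 hi) (by positivity) hS0
    exact Finset.single_le_sum (fun j _ => hC0 j) (Finset.mem_range.2 (Nat.lt_succ_of_le hi))

/-- The constant paths. -/
noncomputable def constPath (B : LCAlg.{u}) : B ⟶ Z B :=
  mkHom (B := Z B)
    { toFun := fun x => flatPath (IsFlat.const 1) x
      map_smul' := fun c x => Z_ext fun t => by
        change _ = c • (flatPath (IsFlat.const 1) x).1 0 t
        rw [flatPath_apply, flatPath_apply, smul_comm]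
      map_zero' := Z_ext fun t => by rw [flatPath_apply, smul_zero]; rfl
      map_add' := fun x y => Z_ext fun t => by
        rw [Z_add_apply, flatPath_apply, flatPath_apply, flatPath_apply, smul_add]
      map_mul' := fun x y => Z_ext fun t => by
        rw [Z_mul_apply, flatPath_apply, flatPath_apply, flatPath_apply, one_smul, one_smul,
          one_smul] }
    (Continuous.subtype_mk (continuous_pi fun n =>
      ContinuousMap.continuous_of_continuous_uncurry _
        (((((IsFlat.const 1).continuous_iteratedDeriv n).comp continuous_subtype_val).comp
          continuous_snd).smul continuous_fst)) _)

theorem constPath_apply (x : B) (t : I) : (ap (constPath B) x).1 0 t = x :=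
  (flatPath_apply (IsFlat.const 1) x t).trans (one_smul ℂ x)

theorem continuous_path_eval {A : LCAlg.{u}} (f : A ⟶ Z B) (n : ℕ) :
    Continuous fun p : A × I => (ap f p.1).1 n p.2 :=
  ContinuousEval.continuous_eval.comp
    ((((continuous_apply n).comp (continuous_subtype_val.comp (ap_continuous f))).comp
      continuous_fst).prodMk continuous_snd)

/-- Each derivative is a limit of difference quotients of the preceding one, and these stay in the
closed subalgebra. -/
theorem path_mem_of_closed {S : NonUnitalSubalgebra ℂ B} (hS : IsClosed (S : Set B)) (F : Z B)
    (h : ∀ t, F.1 0 t ∈ S) (n : ℕ) (t : I) : F.1 n t ∈ S := by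
  induction n generalizing t with
  | zero => exact h t
  | succ n ih =>
    have : (𝓝[≠] t).NeBot := ConnectedSpace.neBot_nhdsWithin_compl_of_nontrivial_of_t1space t
    exact hS.mem_of_tendsto ((F.2 n).1 t)
      (Eventually.of_forall fun s => S.smul_mem _ (sub_mem (ih s) (ih t)))

/-- A family of paths with values in a closed subalgebra. -/
def pathCodRestrict {A : LCAlg.{u}} (f : A ⟶ Z B) (S : NonUnitalSubalgebra ℂ B)
    (hS : IsClosed (S : Set B)) (h : ∀ a t, (ap f a).1 0 t ∈ S) : A ⟶ Z (ofClosed B S hS) :=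
  mkHom (B := Z (ofClosed B S hS))
    { toFun := fun a => ⟨fun n => ⟨fun t => ⟨(ap f a).1 n t, path_mem_of_closed hS _ (h a) n t⟩,
        ((ap f a).1 n).continuous.subtype_mk _⟩, fun n =>
          ⟨fun t => tendsto_subtype_rng.2 (((ap f a).2 n).1 t),
            Subtype.ext ((ap f a).2 n).2.1, Subtype.ext ((ap f a).2 n).2.2⟩⟩
      map_smul' := fun c a => Z_ext fun t => Subtype.ext
        (congrArg (fun F : Z B => F.1 0 t) (ap_smul f c a))
      map_zero' := Z_ext fun t => Subtype.ext (congrArg (fun F : Z B => F.1 0 t) (ap_zero f))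
      map_add' := fun a b => Z_ext fun t => Subtype.ext
        (congrArg (fun F : Z B => F.1 0 t) (ap_add f a b))
      map_mul' := fun a b => Z_ext fun t => Subtype.ext
        (congrArg (fun F : Z B => F.1 0 t) (ap_mul f a b)) }
    (Continuous.subtype_mk (continuous_pi fun n =>
      ContinuousMap.continuous_of_continuous_uncurry _
        ((continuous_path_eval f n).subtype_mk _)) _)

/-- A pair of families of paths is a family of paths in the product. -/
def pathPair {A C : LCAlg.{u}} (f : A ⟶ Z B) (g : A ⟶ Z C) : A ⟶ Z (LCAlg.prod B C) :=
  mkHom (B := Z (LCAlg.prod B C))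
    { toFun := fun a => ⟨fun n => ⟨fun t => ((ap f a).1 n t, (ap g a).1 n t),
        ((ap f a).1 n).continuous.prodMk ((ap g a).1 n).continuous⟩, fun n =>
          ⟨fun t => (((ap f a).2 n).1 t).prodMk_nhds (((ap g a).2 n).1 t),
            Prod.ext ((ap f a).2 n).2.1 ((ap g a).2 n).2.1,
            Prod.ext ((ap f a).2 n).2.2 ((ap g a).2 n).2.2⟩⟩
      map_smul' := fun c a => Z_ext fun t => Prod.ext
        (congrArg (fun F : Z B => F.1 0 t) (ap_smul f c a))
        (congrArg (fun F : Z C => F.1 0 t) (ap_smul g c a))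
      map_zero' := Z_ext fun t => Prod.ext
        (congrArg (fun F : Z B => F.1 0 t) (ap_zero f))
        (congrArg (fun F : Z C => F.1 0 t) (ap_zero g))
      map_add' := fun a b => Z_ext fun t => Prod.ext
        (congrArg (fun F : Z B => F.1 0 t) (ap_add f a b))
        (congrArg (fun F : Z C => F.1 0 t) (ap_add g a b))
      map_mul' := fun a b => Z_ext fun t => Prod.ext
        (congrArg (fun F : Z B => F.1 0 t) (ap_mul f a b))
        (congrArg (fun F : Z C => F.1 0 t) (ap_mul g a b)) }
    (Continuous.subtype_mk (continuous_pi fun n =>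
      ContinuousMap.continuous_of_continuous_uncurry _
        ((continuous_path_eval f n).prodMk (continuous_path_eval g n))) _)

end Paths
end LCAlg

/-! ### A smooth path of isometries and the growth of its powers -/

namespace SmoothToeplitz
open LCAlg

section TwistedPowers
variable {X : Type*} [NonUnitalRing X] [Module ℂ X] [IsScalarTower ℂ X X] [SMulCommClass ℂ X X]
  {o ρ ρ' τ τ' : X}

/-- Put ε = o - ρ ρ' and let V be the element whose powers are taken. Then V ρ = ρ ρ and V ε = a ρ ε
+ b ε τ. On the range of ε a power of V thus stays for some k steps, each contributing b τ, leaves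
once with factor a, and from then on acts as ρ; the sum runs over k. Only powers of the scalar b
accumulate, so |b| ≤ 1 keeps the growth polynomial. -/
theorem npw_twisted (ho : ∀ y, o * y = y) (ho' : ∀ y, y * o = y) (hρ : ρ' * ρ = o)
    (h1 : τ * ρ = ρ * τ) (h2 : τ * ρ' = ρ' * τ) (a b : ℂ) (n : ℕ) :
    npw o (ρ * ρ * ρ' + a • (ρ * (o - ρ * ρ')) + b • ((o - ρ * ρ') * τ)) n =
      npw o ρ n * (ρ * ρ') + b ^ n • (npw o ρ 0 * ((o - ρ * ρ') * npw o τ n)) +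
        ∑ k ∈ Finset.range n, (a * b ^ k) • (npw o ρ (n - k) * ((o - ρ * ρ') * npw o τ k)) := by
  set ε := o - ρ * ρ' with hε
  have e1 : ρ' * ε = 0 := by rw [hε, mul_sub, ho', ← mul_assoc, hρ, ho, sub_self]
  have e2 : ε * ρ = 0 := by rw [hε, sub_mul, ho, mul_assoc, hρ, ho', sub_self]
  have e3 : ε * ε = ε := by
    nth_rw 1 [hε]
    rw [sub_mul, ho, mul_assoc, e1, mul_zero, sub_zero]
  have e4 : τ * ε = ε * τ := by
    rw [hε, mul_sub, sub_mul, ho, ho', ← mul_assoc, h1, mul_assoc, h2, mul_assoc]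
  set V := ρ * ρ * ρ' + a • (ρ * ε) + b • (ε * τ) with hV
  have v1 : V * ρ = ρ * ρ := by
    rw [hV, add_mul, add_mul, mul_assoc (ρ * ρ), hρ, ho', smul_mul_assoc, mul_assoc ρ, e2,
      mul_zero, smul_zero, smul_mul_assoc, mul_assoc ε, h1, ← mul_assoc, e2, zero_mul, smul_zero,
      add_zero, add_zero]
  have v2 : V * ε = a • (ρ * ε) + b • (ε * τ) := by
    rw [hV, add_mul, add_mul, mul_assoc (ρ * ρ), e1, mul_zero, zero_add, smul_mul_assoc,
      mul_assoc ρ, e3, smul_mul_assoc, mul_assoc ε, e4, ← mul_assoc, e3]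
  induction n with
  | zero =>
    simp only [npw, Finset.range_zero, Finset.sum_empty, add_zero, pow_zero, one_smul, ho, ho']
    rw [hε, add_sub_cancel]
  | succ n ih =>
    have t1 : V * (npw o ρ n * (ρ * ρ')) = npw o ρ (n + 1) * (ρ * ρ') := by
      rw [← mul_assoc (npw o ρ n), npw_succ' ho ho']
      simp only [npw]
      rw [mul_assoc ρ, ← mul_assoc V, v1, mul_assoc ρ (npw o ρ n), ← mul_assoc (npw o ρ n),
        npw_succ' ho ho']
      simp only [npw, mul_assoc]
    have t2 : V * (npw o ρ 0 * (ε * npw o τ n)) =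
        a • (npw o ρ 1 * (ε * npw o τ n)) + b • (npw o ρ 0 * (ε * npw o τ (n + 1))) := by
      simp only [npw]
      rw [ho, ho, ho', ← mul_assoc V, v2, add_mul, smul_mul_assoc, smul_mul_assoc, mul_assoc,
        mul_assoc]
    have t3 : ∀ m (y : X), V * (npw o ρ (m + 1) * y) = npw o ρ (m + 1 + 1) * y := by
      intro m y
      simp only [npw]
      rw [mul_assoc ρ, ← mul_assoc V, v1]
      simp only [mul_assoc]
    change V * npw o V n = _
    rw [ih, mul_add, mul_add, t1, mul_smul_comm, t2, Finset.mul_sum, Finset.sum_range_succ,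
      smul_add, smul_smul, smul_smul]
    have hs : ∑ k ∈ Finset.range n, V * ((a * b ^ k) • (npw o ρ (n - k) * (ε * npw o τ k))) =
        ∑ k ∈ Finset.range n, (a * b ^ k) • (npw o ρ (n + 1 - k) * (ε * npw o τ k)) := by
      refine Finset.sum_congr rfl fun k hk => ?_
      have hk' := Finset.mem_range.1 hk
      obtain ⟨m, hm⟩ : ∃ m, n - k = m + 1 := ⟨n - k - 1, by omega⟩
      rw [mul_smul_comm, hm, t3, show n + 1 - k = m + 1 + 1 by omega]
    rw [hs, show n + 1 - n = 1 by omega, mul_comm (b ^ n) a, ← pow_succ]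
    abel

/-- The mirror image of `npw_twisted`: here ρ' V = ρ' ρ' and ε V = a ε ρ' + b τ' ε, so the induction
multiplies by V on the right. -/
theorem npw_twisted' (ho : ∀ y, o * y = y) (ho' : ∀ y, y * o = y) (hρ : ρ' * ρ = o)
    (h1 : τ' * ρ = ρ * τ') (h2 : τ' * ρ' = ρ' * τ') (a b : ℂ) (n : ℕ) :
    npw o (ρ * ρ' * ρ' + a • ((o - ρ * ρ') * ρ') + b • ((o - ρ * ρ') * τ')) n =
      (ρ * ρ') * npw o ρ' n + b ^ n • ((npw o τ' n * (o - ρ * ρ')) * npw o ρ' 0) +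
        ∑ k ∈ Finset.range n, (a * b ^ k) • ((npw o τ' k * (o - ρ * ρ')) * npw o ρ' (n - k)) := by
  set ε := o - ρ * ρ' with hε
  have e1 : ρ' * ε = 0 := by rw [hε, mul_sub, ho', ← mul_assoc, hρ, ho, sub_self]
  have e3 : ε * ε = ε := by
    nth_rw 1 [hε]
    rw [sub_mul, ho, mul_assoc, e1, mul_zero, sub_zero]
  have e4 : τ' * ε = ε * τ' := by
    rw [hε, mul_sub, sub_mul, ho, ho', ← mul_assoc, h1, mul_assoc, h2, mul_assoc]
  set V := ρ * ρ' * ρ' + a • (ε * ρ') + b • (ε * τ') with hV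
  have v1 : ρ' * V = ρ' * ρ' := by
    rw [hV, mul_add, mul_add, ← mul_assoc, ← mul_assoc, hρ, ho, mul_smul_comm, ← mul_assoc, e1,
      zero_mul, smul_zero, mul_smul_comm, ← mul_assoc, e1, zero_mul, smul_zero,
      add_zero, add_zero]
  have e5 : ε * ρ = 0 := by rw [hε, sub_mul, ho, mul_assoc, hρ, ho', sub_self]
  have v2 : ε * V = a • (ε * ρ') + b • (τ' * ε) := by
    rw [hV, mul_add, mul_add, ← mul_assoc, ← mul_assoc, e5, zero_mul, zero_mul, zero_add,
      mul_smul_comm, ← mul_assoc, e3, mul_smul_comm, ← mul_assoc, e3, e4]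
  induction n with
  | zero =>
    simp only [npw, Finset.range_zero, Finset.sum_empty, add_zero, pow_zero, one_smul, ho, ho']
    rw [hε, add_sub_cancel]
  | succ n ih =>
    have hsucc : ∀ m, npw o ρ' (m + 1) = npw o ρ' m * ρ' := fun m => (npw_succ' ho ho' m).symm
    have t3 : ∀ m (y : X), y * npw o ρ' (m + 1) * V = y * npw o ρ' (m + 1 + 1) := by
      intro m y
      rw [hsucc (m + 1), hsucc m, mul_assoc, mul_assoc, v1]
      simp only [mul_assoc]
    have t1 : ρ * ρ' * npw o ρ' n * V = ρ * ρ' * npw o ρ' (n + 1) := by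
      have := t3 n ρ
      simpa only [npw, mul_assoc] using this
    have t2 : npw o τ' n * ε * npw o ρ' 0 * V =
        a • (npw o τ' n * ε * npw o ρ' 1) + b • (npw o τ' (n + 1) * ε * npw o ρ' 0) := by
      rw [← npw_succ' ho ho' n]
      simp only [npw, ho']
      rw [mul_assoc, v2, mul_add, mul_smul_comm, mul_smul_comm]
      simp only [mul_assoc]
    rw [← npw_succ' ho ho', ih, add_mul, add_mul, t1, smul_mul_assoc, t2, Finset.sum_mul,
      Finset.sum_range_succ, smul_add, smul_smul, smul_smul]
    have hs : ∑ k ∈ Finset.range n, (a * b ^ k) • (npw o τ' k * ε * npw o ρ' (n - k)) * V =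
        ∑ k ∈ Finset.range n, (a * b ^ k) • (npw o τ' k * ε * npw o ρ' (n + 1 - k)) := by
      refine Finset.sum_congr rfl fun k hk => ?_
      have hk' := Finset.mem_range.1 hk
      obtain ⟨m, hm⟩ : ∃ m, n - k = m + 1 := ⟨n - k - 1, by omega⟩
      rw [smul_mul_assoc, hm, t3, show n + 1 - k = m + 1 + 1 by omega]
    rw [hs, show n + 1 - n = 1 by omega, mul_comm (b ^ n) a, ← pow_succ]
    abel

/-- Of the nine products only the diagonal ones survive, since ρ' ε = 0, ε ρ = 0 and τ' commutes
with ρ and ρ'. They add up to ρ ρ' + (a' a + b' b) ε. -/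
theorem twisted_mul (ho : ∀ y, o * y = y) (ho' : ∀ y, y * o = y) (hρ : ρ' * ρ = o)
    (hτ : τ' * τ = o) (h1 : τ' * ρ = ρ * τ') (h2 : τ' * ρ' = ρ' * τ') {a a' b b' : ℂ}
    (hab : a' * a + b' * b = 1) :
    (ρ * ρ' * ρ' + a' • ((o - ρ * ρ') * ρ') + b' • ((o - ρ * ρ') * τ')) *
      (ρ * ρ * ρ' + a • (ρ * (o - ρ * ρ')) + b • ((o - ρ * ρ') * τ)) = o := by
  set ε := o - ρ * ρ' with hε
  have e1 : ρ' * ε = 0 := by rw [hε, mul_sub, ho', ← mul_assoc, hρ, ho, sub_self]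
  have e2 : ε * ρ = 0 := by rw [hε, sub_mul, ho, mul_assoc, hρ, ho', sub_self]
  have e3 : ε * ε = ε := by
    nth_rw 1 [hε]
    rw [sub_mul, ho, mul_assoc, e1, mul_zero, sub_zero]
  have e4 : τ' * ε = ε * τ' := by
    rw [hε, mul_sub, sub_mul, ho, ho', ← mul_assoc, h1, mul_assoc, h2, mul_assoc]
  have p11 : ρ * ρ' * ρ' * (ρ * ρ * ρ') = ρ * ρ' := by
    calc _ = ρ * (ρ' * ((ρ' * ρ) * (ρ * ρ'))) := by simp only [mul_assoc]
      _ = ρ * ((ρ' * ρ) * ρ') := by rw [hρ, ho, ← mul_assoc ρ', hρ]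
      _ = _ := by rw [hρ, ho]
  have p12 : ρ * ρ' * ρ' * (ρ * ε) = 0 := by
    calc _ = ρ * (ρ' * ((ρ' * ρ) * ε)) := by simp only [mul_assoc]
      _ = 0 := by rw [hρ, ho, e1, mul_zero]
  have p13 : ρ * ρ' * ρ' * (ε * τ) = 0 := by
    calc _ = ρ * (ρ' * ((ρ' * ε) * τ)) := by simp only [mul_assoc]
      _ = 0 := by rw [e1, zero_mul, mul_zero, mul_zero]
  have p21 : ε * ρ' * (ρ * ρ * ρ') = 0 := by
    calc _ = ε * ((ρ' * ρ) * (ρ * ρ')) := by simp only [mul_assoc]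
      _ = 0 := by rw [hρ, ho, ← mul_assoc, e2, zero_mul]
  have p22 : ε * ρ' * (ρ * ε) = ε := by
    calc _ = ε * ((ρ' * ρ) * ε) := by simp only [mul_assoc]
      _ = ε := by rw [hρ, ho, e3]
  have p23 : ε * ρ' * (ε * τ) = 0 := by
    calc _ = ε * ((ρ' * ε) * τ) := by simp only [mul_assoc]
      _ = 0 := by rw [e1, zero_mul, mul_zero]
  have p31 : ε * τ' * (ρ * ρ * ρ') = 0 := by
    calc _ = ε * ((τ' * ρ) * (ρ * ρ')) := by simp only [mul_assoc]
      _ = (ε * ρ) * (τ' * (ρ * ρ')) := by rw [h1]; simp only [mul_assoc]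
      _ = 0 := by rw [e2, zero_mul]
  have p32 : ε * τ' * (ρ * ε) = 0 := by
    calc _ = ε * ((τ' * ρ) * ε) := by simp only [mul_assoc]
      _ = (ε * ρ) * (τ' * ε) := by rw [h1]; simp only [mul_assoc]
      _ = 0 := by rw [e2, zero_mul]
  have p33 : ε * τ' * (ε * τ) = ε := by
    calc _ = ε * ((τ' * ε) * τ) := by simp only [mul_assoc]
      _ = (ε * ε) * (τ' * τ) := by rw [e4]; simp only [mul_assoc]
      _ = ε := by rw [e3, hτ, ho']
  simp only [mul_add, add_mul, smul_mul_assoc, mul_smul_comm, p11, p12, p13, p21, p22, p23, p31,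
    p32, p33, smul_zero, add_zero, zero_add, smul_smul]
  rw [add_assoc, ← add_smul, mul_comm a a', mul_comm b b', hab, one_smul, hε, add_sub_cancel]

end TwistedPowers

/-- The derivatives of the scalar coefficient cost a power of 1 + k, and (1 + (n - k)) (1 + k) ≤ (1
+ n)² turns the growth of x into growth in n, uniformly in k < n. -/
theorem flatPath_sum_growth {X : LCAlg.{u}} {g h : ℝ → ℂ} (hg : IsFlat g) (hh : IsFlat h)
    (hb : ∀ t ∈ Set.Icc (0 : ℝ) 1, ‖h t‖ ≤ 1) {x : ℕ → ℕ → X}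
    (hx : PolyGrowth wK fun p : ℕ × ℕ => x p.1 p.2) :
    PolyGrowth (fun n => 1 + n) fun n =>
      ∑ k ∈ Finset.range n, (flatPath (hg.mul (hh.pow k)) (x (n - k) k) : Z X) := by
  refine PolyGrowth.sum_range fun P hP => ?_
  obtain ⟨q, N, C, hq, hC0, hC⟩ := flatPath_growth hg hh hb P hP
  obtain ⟨N', C', hC0', hC'⟩ := hx.exists_nonneg q hq
  refine ⟨N + 2 * N', C * C', by positivity, fun n k hk => ?_⟩
  have h1 := hC' (n - k, k)
  simp only at h1
  have h2 : (wK (n - k, k) : ℝ) ≤ ((1 + n : ℕ) : ℝ) ^ 2 := by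
    rw [sq]
    simp only [wK]
    push_cast [Nat.cast_sub hk.le]
    have : (k : ℝ) ≤ n := by exact_mod_cast hk.le
    have hk0 : (0 : ℝ) ≤ k := Nat.cast_nonneg k
    gcongr
    linarith
  calc P (flatPath (hg.mul (hh.pow k)) (x (n - k) k))
      ≤ C * ((1 + k : ℕ) : ℝ) ^ N * q (x (n - k) k) := hC k _
    _ ≤ C * ((1 + n : ℕ) : ℝ) ^ N * (C' * (((1 + n : ℕ) : ℝ) ^ 2) ^ N') := by
        have := apply_nonneg q (x (n - k) k)
        gcongr
        exact h1.trans (by gcongr)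
    _ = _ := by ring

theorem flatPath_diag_growth {X : LCAlg.{u}} {g h : ℝ → ℂ} (hg : IsFlat g) (hh : IsFlat h)
    (hb : ∀ t ∈ Set.Icc (0 : ℝ) 1, ‖h t‖ ≤ 1) {x : ℕ → X}
    (hx : PolyGrowth (fun n => 1 + n) x) :
    PolyGrowth (fun n => 1 + n) fun n => (flatPath (hg.mul (hh.pow n)) (x n) : Z X) := by
  intro P hP
  obtain ⟨q, N, C, hq, hC0, hC⟩ := flatPath_growth hg hh hb P hP
  obtain ⟨N', C', hC0', hC'⟩ := hx.exists_nonneg q hq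
  refine ⟨N + N', C * C', fun n => (hC n _).trans ?_⟩
  calc C * ((1 + n : ℕ) : ℝ) ^ N * q (x n)
      ≤ C * ((1 + n : ℕ) : ℝ) ^ N * (C' * ((1 + n : ℕ) : ℝ) ^ N') := by
        gcongr
        exact hC' n
    _ = _ := by ring

theorem npw_path_apply {X : LCAlg.{u}} (o v : Z X) (n : ℕ) (t : I) :
    (npw o v n).1 0 t = npw (o.1 0 t) (v.1 0 t) n := by
  induction n with
  | zero => rfl
  | succ n ih =>
    change (v * npw o v n).1 0 t = _
    rw [Z_mul_apply, ih]; rfl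

theorem polyGrowth_matrix {X : LCAlg.{u}} {x y : ℕ → X} (hx : PolyGrowth (fun n => 1 + n) x)
    (hy : PolyGrowth (fun n => 1 + n) y) (c : X) :
    PolyGrowth wK fun p : ℕ × ℕ => x p.1 * (c * y p.2) := by
  refine PolyGrowth.mul (x := fun p : ℕ × ℕ => x p.1) (y := fun p : ℕ × ℕ => c * y p.2)
    ((hx.comp Prod.fst).mono fun p => ?_)
    (((PolyGrowth.const c).mul hy |>.comp Prod.snd).mono fun p => ?_)
  · exact Nat.le_mul_of_pos_right _ (by omega)
  · exact Nat.le_mul_of_pos_left _ (by omega)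

/-- Flat functions that rotate `(1, 0)` to `(0, 1)`. -/
theorem exists_flat_rotation : ∃ a a' b : ℝ → ℂ, IsFlat a ∧ IsFlat a' ∧ IsFlat b ∧
    (∀ t, a' t * a t + b t * b t = 1) ∧ (∀ t, ‖b t‖ ≤ 1) ∧ a 0 = 1 ∧ a' 0 = 1 ∧ b 0 = 0 ∧
    a 1 = 0 ∧ a' 1 = 0 ∧ b 1 = 1 := by
  have fg : IsFlat fun x => 1 - smoothStep x := (IsFlat.const 1).sub isFlat_smoothStep
  -- With s = 1 - `smoothStep` the choice is a = s, a' = s (2 - s²), b = 1 - s², so that a' a + b² =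
  -- 1 identically. Being polynomial in s it avoids the square root of a genuine rotation; the price
  -- is a' ≠ a, which is harmless because only a left inverse is needed.
  refine ⟨fun x => 1 - smoothStep x, fun x => (1 - smoothStep x) * (2 - (1 - smoothStep x) ^ 2),
    fun x => 1 - (1 - smoothStep x) ^ 2, fg, fg.mul ((IsFlat.const 2).sub (fg.pow 2)),
    (IsFlat.const 1).sub (fg.pow 2), fun t => by ring, fun t => ?_, ?_, ?_, ?_, ?_, ?_, ?_⟩
  · have h0 := Real.smoothTransition.nonneg t
    have h1 := Real.smoothTransition.le_one t
    have e : (1 - (1 - smoothStep t) ^ 2 : ℂ) =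
        ((1 - (1 - Real.smoothTransition t) ^ 2 : ℝ) : ℂ) := by
      rw [smoothStep]; push_cast; ring
    change ‖(1 - (1 - smoothStep t) ^ 2 : ℂ)‖ ≤ 1
    rw [e, Complex.norm_real, Real.norm_eq_abs, abs_le]
    constructor <;> nlinarith
  all_goals simp only [smoothStep_zero, smoothStep_one]; norm_num

/-- Given commuting isometries `ρ` and `τ`, a path of representations of the smooth Toeplitz
algebra. With rotating coefficients it joins `S ↦ ρ` to `S ↦ ρ ρ ρ' + (1 - ρ ρ') τ`. -/
theorem exists_twisted_path {X : LCAlg.{u}} {o ρ ρ' τ τ' : X} (ho : ∀ y, o * y = y)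
    (ho' : ∀ y, y * o = y) (hρ : ρ' * ρ = o) (hτ : τ' * τ = o) (h1 : τ * ρ = ρ * τ)
    (h2 : τ * ρ' = ρ' * τ) (h3 : τ' * ρ = ρ * τ') (h4 : τ' * ρ' = ρ' * τ')
    (gρ : PolyGrowth (fun n => 1 + n) (npw o ρ)) (gρ' : PolyGrowth (fun n => 1 + n) (npw o ρ'))
    (gτ : PolyGrowth (fun n => 1 + n) (npw o τ)) (gτ' : PolyGrowth (fun n => 1 + n) (npw o τ'))
    {a a' b : ℝ → ℂ} (fa : IsFlat a) (fa' : IsFlat a') (fh : IsFlat b)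
    (hab : ∀ t, a' t * a t + b t * b t = 1) (hb' : ∀ t, ‖b t‖ ≤ 1) :
    ∃ f : alg →ₙₐ[ℂ] Z X, Continuous f ∧ (∀ t, (f one).1 0 t = o) ∧
      (∀ t : I, (f S).1 0 t = ρ * ρ * ρ' + a t • (ρ * (o - ρ * ρ')) +
        b t • ((o - ρ * ρ') * τ)) ∧
      ∀ t : I, (f Sbar).1 0 t = ρ * ρ' * ρ' + a' t • ((o - ρ * ρ') * ρ') +
        b t • ((o - ρ * ρ') * τ') := by
  set ε := o - ρ * ρ' with hε
  have f1 : IsFlat fun _ => (1 : ℂ) := IsFlat.const 1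
  have hb : ∀ t ∈ Set.Icc (0 : ℝ) 1, ‖b t‖ ≤ 1 := fun t _ => hb' t
  have hb1 : ∀ t ∈ Set.Icc (0 : ℝ) 1, ‖(1 : ℂ)‖ ≤ 1 := fun t _ => by simp
  let O : Z X := ap (constPath X) o
  have hO : ∀ t, O.1 0 t = o := constPath_apply o
  let V : Z X := flatPath f1 (ρ * ρ * ρ') + flatPath fa (ρ * ε) + flatPath fh (ε * τ)
  let V' : Z X := flatPath f1 (ρ * ρ' * ρ') + flatPath fa' (ε * ρ') + flatPath fh (ε * τ')
  have hV : ∀ t : I, V.1 0 t = ρ * ρ * ρ' + a t • (ρ * ε) + b t • (ε * τ) := by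
    intro t
    simp only [V]
    rw [Z_add_apply, Z_add_apply, flatPath_apply, flatPath_apply, flatPath_apply, one_smul]
  have hV' : ∀ t : I, V'.1 0 t = ρ * ρ' * ρ' + a' t • (ε * ρ') + b t • (ε * τ') := by
    intro t
    simp only [V']
    rw [Z_add_apply, Z_add_apply, flatPath_apply, flatPath_apply, flatPath_apply, one_smul]
  obtain ⟨f, hf, e1, e2, e3⟩ := exists_hom (Y := Z X) (o := O) (v := V) (v' := V')
    (fun F => Z_ext fun t => by rw [Z_mul_apply, hO, ho])
    (fun F => Z_ext fun t => by rw [Z_mul_apply, hO, ho'])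
    (Z_ext fun t => by
      rw [Z_mul_apply, hO, hV, hV']
      exact twisted_mul ho ho' hρ hτ h3 h4 (hab t))
    (by
      -- The powers in Z X are computed pointwise in t and then recognised as sums of flat paths,
      -- whose growth is known with all derivatives. The constant term is written with powers of the
      -- function 1 so that the same estimate covers it.
      have key : npw O V = fun n => (flatPath (f1.mul (f1.pow n)) (npw o ρ n * (ρ * ρ')) +
          flatPath (f1.mul (fh.pow n)) (npw o ρ 0 * (ε * npw o τ n))) +
          ∑ k ∈ Finset.range n,
            flatPath (fa.mul (fh.pow k)) (npw o ρ (n - k) * (ε * npw o τ k)) := by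
        funext n
        refine Z_ext fun t => ?_
        rw [npw_path_apply, hO, hV, npw_twisted ho ho' hρ h1 h2]
        rw [Z_add_apply, Z_add_apply, Z_sum_apply, flatPath_apply, flatPath_apply, one_pow,
          mul_one, one_smul, one_mul]
        congr 1
      rw [key]
      refine ((flatPath_diag_growth f1 f1 hb1 (gρ.mul (PolyGrowth.const _))).add (fun n => by omega)
        (flatPath_diag_growth f1 fh hb ?_)).add (fun n => by omega)
        (flatPath_sum_growth fa fh hb (x := fun m k => npw o ρ m * (ε * npw o τ k))
          (polyGrowth_matrix gρ gτ ε))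
      exact (PolyGrowth.const (npw o ρ 0)).mul ((PolyGrowth.const ε).mul gτ))
    (by
      have key : npw O V' = fun n => (flatPath (f1.mul (f1.pow n)) ((ρ * ρ') * npw o ρ' n) +
          flatPath (f1.mul (fh.pow n)) ((npw o τ' n * ε) * npw o ρ' 0)) +
          ∑ k ∈ Finset.range n,
            flatPath (fa'.mul (fh.pow k)) ((npw o τ' k * ε) * npw o ρ' (n - k)) := by
        funext n
        refine Z_ext fun t => ?_
        rw [npw_path_apply, hO, hV', npw_twisted' ho ho' hρ h3 h4]
        rw [Z_add_apply, Z_add_apply, Z_sum_apply, flatPath_apply, flatPath_apply, one_pow,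
          mul_one, one_smul, one_mul]
        congr 1
      rw [key]
      refine ((flatPath_diag_growth f1 f1 hb1 ((PolyGrowth.const _).mul gρ')).add
        (fun n => by omega)
        (flatPath_diag_growth f1 fh hb ?_)).add (fun n => by omega)
        (flatPath_sum_growth fa' fh hb (x := fun m k => (npw o τ' k * ε) * npw o ρ' m) ?_)
      · exact (gτ'.mul (PolyGrowth.const ε)).mul (PolyGrowth.const (npw o ρ' 0))
      -- In the mirrored formula the τ'-index comes first; the weight is symmetric, so the indices
      -- may be exchanged.
      · have := (polyGrowth_matrix gτ' gρ' ε).comp Prod.swap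
        have e : wK ∘ Prod.swap = wK := by
          funext p; simp only [Function.comp_apply, wK, Prod.fst_swap, Prod.snd_swap, mul_comm]
        rw [e] at this
        simpa only [Function.comp_def, Prod.fst_swap, Prod.snd_swap, mul_assoc] using this)
  refine ⟨f, hf, fun t => ?_, fun t => ?_, fun t => ?_⟩
  · rw [e1, hO]
  · rw [e2, hV]
  · rw [e3, hV']

end SmoothToeplitz

/-! ### Matrix units and matrix entries -/

namespace LCAlg
open SmoothToeplitz

section KMatrixUnits

/-- The matrix units in `𝒦^∞`. -/
noncomputable def K.mu (i j : ℕ) : K := ⟨SmoothToeplitz.mu i j, rfl⟩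

theorem K.mu_mul_mu (i j k l : ℕ) : K.mu i j * K.mu k l = if j = k then K.mu i l else 0 := by
  apply Subtype.ext
  have := SmoothToeplitz.mu_mul_mu i j k l
  split_ifs with h
  · rw [if_pos h] at this; exact this
  · rw [if_neg h] at this; exact this

theorem K.e_eq_mu : K.e = K.mu 0 0 := Subtype.ext SmoothToeplitz.e_eq_mu

/-- Matrix units are the unit vectors of `Rapid wK`, on which every continuous seminorm is bounded
by a power of the weight. -/
theorem K.growth_mu : PolyGrowth wK fun p : ℕ × ℕ => K.mu p.1 p.2 := by
  intro p hp
  let f : Rapid wK →ₗ[ℂ] K :=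
    { toFun := fun x => ⟨ofK x, rfl⟩
      map_add' := fun x y => Subtype.ext (map_add ofK x y)
      map_smul' := fun c x => Subtype.ext (map_smul ofK c x) }
  exact Rapid.exists_growth_single wK_pos (p.comp f) (hp.comp (continuous_ofK.subtype_mk _))

end KMatrixUnits

theorem growth_zp_nat : PolyGrowth (fun n : ℕ => 1 + n) fun n : ℕ => (zp n : alg) := by
  have h : PolyGrowth wZ fun n : ℤ => (zp n : alg) := fun p hp =>
    Rapid.exists_growth_single wZ_pos (p.comp ofZ) (hp.comp continuous_ofZ)
  exact (h.comp fun n : ℕ => (n : ℤ)).mono fun n => le_of_eq (by simp [wZ])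

theorem growth_zp_neg : PolyGrowth (fun n : ℕ => 1 + n) fun n : ℕ => (zp (-(n : ℤ)) : alg) := by
  have h : PolyGrowth wZ fun n : ℤ => (zp n : alg) := fun p hp =>
    Rapid.exists_growth_single wZ_pos (p.comp ofZ) (hp.comp continuous_ofZ)
  exact (h.comp fun n : ℕ => -(n : ℤ)).mono fun n => le_of_eq (by simp [wZ])

/-- The unit ball of r contains the trace of a unit ball of some q on the ambient algebra, and
scaling turns this inclusion into the inequality. -/
theorem exists_seminorm_ofClosed {B : LCAlg.{u}} {S : NonUnitalSubalgebra ℂ B}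
    {hS : IsClosed (S : Set B)} (r : Seminorm ℂ (ofClosed B S hS)) (hr : Continuous r) :
    ∃ q : Seminorm ℂ B, Continuous q ∧ ∀ x : ofClosed B S hS, r x ≤ q x.1 := by
  have h0 : {x : ofClosed B S hS | r x < 1} ∈ 𝓝 (0 : ofClosed B S hS) :=
    (isOpen_lt hr continuous_const).mem_nhds (by simp)
  rw [nhds_subtype_eq_comap] at h0
  obtain ⟨t, ht, hts⟩ := h0
  obtain ⟨q, hq, hqt⟩ := exists_seminorm_of_mem_nhds (E := B) ht
  refine ⟨q, hq, fun x => le_of_forall_pos_lt_add fun δ hδ => ?_⟩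
  have hpos : 0 < q x.1 + δ := add_pos_of_nonneg_of_pos (apply_nonneg q _) hδ
  have key : r (((q x.1 + δ : ℝ) : ℂ)⁻¹ • x) < 1 := by
    refine hts (hqt _ ?_)
    change q (((q x.1 + δ : ℝ) : ℂ)⁻¹ • x.1) < 1
    rw [map_smul_eq_mul, norm_inv, Complex.norm_real, Real.norm_of_nonneg hpos.le,
      inv_mul_lt_iff₀ hpos]
    linarith
  rwa [map_smul_eq_mul, norm_inv, Complex.norm_real, Real.norm_of_nonneg hpos.le,
    inv_mul_lt_iff₀ hpos, mul_one] at key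

section Bilinear
variable {A : LCAlg.{u}} {B : LCAlg.{w}}

/-- The bilinear map `(a, b) ↦ a ⊗ b`. -/
noncomputable def tmulBilin (A : LCAlg.{u}) (B : LCAlg.{w}) : A →ₗ[ℂ] B →ₗ[ℂ] tensor A B :=
  LinearMap.mk₂ ℂ tmul add_tmul smul_tmul tmul_add tmul_smul

theorem zero_tmul (b : B) : tmul (0 : A) b = 0 := LinearMap.map_zero₂ (tmulBilin A B) b
theorem tmul_zero (a : A) : tmul a (0 : B) = 0 := map_zero (tmulBilin A B a)
theorem tmul_sum {ι : Type*} (s : Finset ι) (a : A) (b : ι → B) :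
    tmul a (∑ i ∈ s, b i) = ∑ i ∈ s, tmul a (b i) := map_sum (tmulBilin A B a) b s

theorem tensor_mul_one {a : A} {b : B} (ha : ∀ x, x * a = x) (hb : ∀ x, x * b = x)
    (x : tensor A B) : x * tmul a b = x :=
  dense_span_tmul (f := AddMonoidHom.mulRight (tmul a b)) (g := AddMonoidHom.id _)
    (continuous_id.mul continuous_const) continuous_id
    (fun a' b' => by
      change tmul a' b' * tmul a b = tmul a' b'
      rw [tmul_mul, ha, hb]) x

/-- The tensor product map is bounded by products of seminorms. -/
theorem exists_seminorm_tmul (p : Seminorm ℂ (tensor A B)) (hp : Continuous p) :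
    ∃ (q : Seminorm ℂ A) (r : Seminorm ℂ B), Continuous q ∧ Continuous r ∧
      ∀ a b, p (tmul a b) ≤ q a * r b :=
  exists_seminorm_bilin (tmulBilin A B) continuous_tmul p hp

end Bilinear

/-- The coefficient maps `B ⊗ 𝒯^∞ → B` of the compact part. -/
theorem exists_entry (B : LCAlg.{u}) (n m : ℕ) : ∃ f : tensor.{u, 0} B alg →ₗ[ℂ] B,
    Continuous f ∧ ∀ (b : B) (s : SmoothToeplitz),
      f (tmul.{u, 0} b (show alg from s)) = Rapid.cf (kpart s) (n, m) • b := by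
  have hc : Continuous fun s : alg => Rapid.cf (kpart s) (n, m) :=
    (continuous_lp_apply (n, m)).comp
      ((continuous_apply 0).comp (continuous_subtype_val.comp continuous_kpart))
  exact exists_tensorLift (A := B) (B := alg)
    (LinearMap.mk₂ ℂ (fun b s => Rapid.cf (kpart s) (n, m) • b) (fun b b' s => smul_add _ _ _)
      (fun c b s => smul_comm _ _ _)
      (fun b s s' => by
        rw [← add_smul]; rfl)
      (fun c b s => by
        rw [smul_smul]; rfl))
    ((hc.comp continuous_snd).smul continuous_fst)

/-- The coefficients `B ⊗ 𝒯^∞ → B` of the compact part. -/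
noncomputable def entry (B : LCAlg.{u}) (n m : ℕ) : tensor.{u, 0} B alg →ₗ[ℂ] B :=
  (exists_entry B n m).choose

theorem continuous_entry (B : LCAlg.{u}) (n m : ℕ) : Continuous (entry B n m) :=
  (exists_entry B n m).choose_spec.1

theorem entry_mu {B : LCAlg.{u}} (n m i j : ℕ) (b : B) :
    entry B n m (tmul.{u, 0} b (show alg from mu i j)) = if n = i ∧ m = j then b else 0 := by
  rw [entry, (exists_entry B n m).choose_spec.2]
  have : Rapid.cf (kpart (mu i j)) (n, m) = if n = i ∧ m = j then 1 else 0 := by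
    have h : Rapid.cf (kpart (mu i j)) (n, m) = Rapid.cf (Rapid.single (i, j) : Rapid wK) (n, m) :=
      rfl
    rw [h, Rapid.cf_single]
    simp only [Prod.mk.injEq]
  rw [this]
  split_ifs
  · rw [one_smul]
  · rw [zero_smul]

/-- On pure tensors the weighted entry is at most the N-th weighted ℓ¹-norm of the compact part,
uniformly in the position. The uniform bound on pure tensors extends to the completion by
`exists_seminorm_tensor_bound`, so entries decay rapidly with one seminorm for all positions. -/
theorem exists_entry_bound {B : LCAlg.{u}} (r : Seminorm ℂ B) (hr : Continuous r) (N : ℕ) :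
    ∃ R : Seminorm ℂ (tensor.{u, 0} B alg), Continuous R ∧
      ∀ n m x, (wK (n, m) : ℝ) ^ N * r (entry B n m x) ≤ R x := by
  let q : Seminorm ℂ alg := (Rapid.seminorm wK N).comp (LinearMap.fst ℂ (Rapid wK) (Rapid wZ))
  have hq : Continuous q := (Rapid.continuous_seminorm N).comp continuous_kpart
  obtain ⟨R, hR, hle⟩ := exists_seminorm_tensor_bound (A := B) (B := alg)
    (g := fun p : ℕ × ℕ => ((wK p : NNReal) ^ N) • r.comp (entry B p.1 p.2))
    (fun p => continuous_const.mul (hr.comp (continuous_entry B _ _))) hr hq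
    (fun p b s => by
      have e : entry B p.1 p.2 (tmul.{u, 0} b s) = Rapid.cf (kpart s) (p.1, p.2) • b :=
        (exists_entry B p.1 p.2).choose_spec.2 b s
      have h : (((wK p : NNReal) ^ N) • r.comp (entry B p.1 p.2)) (tmul.{u, 0} b s) =
          ((wK p : ℝ) ^ N) * r (entry B p.1 p.2 (tmul.{u, 0} b s)) := by
        rw [smul_apply, NNReal.smul_def, NNReal.coe_pow, NNReal.coe_natCast, smul_eq_mul,
          Seminorm.comp_apply]
      rw [h, e, map_smul_eq_mul, ← mul_assoc, mul_comm]
      exact mul_le_mul_of_nonneg_left (Rapid.weight_mul_norm_cf_le (kpart s) N p)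
        (apply_nonneg r b))
  refine ⟨R, hR, fun n m x => ?_⟩
  have := hle (n, m) x
  rwa [smul_apply, NNReal.smul_def, NNReal.coe_pow, NNReal.coe_natCast, smul_eq_mul,
    Seminorm.comp_apply] at this

/-- A frame of polynomial growth over a closed subalgebra `B₀` of a unital algebra `B`: sequences
`V i`, `W i`, each of a degree, with `∑ W i * V i = 1` over each degree. -/
structure Frame (B : LCAlg.{u}) where
  B₀ : NonUnitalSubalgebra ℂ B
  isClosed : IsClosed (B₀ : Set B)
  o : B
  one_mul : ∀ b, o * b = b
  mul_one : ∀ b, b * o = b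
  V : ℕ → B
  W : ℕ → B
  deg : ℕ → ℕ
  fib : ℕ → Finset ℕ
  mem_fib : ∀ i n, i ∈ fib n ↔ deg i = n
  sum_fib : ∀ n, ∑ i ∈ fib n, W i * V i = o
  fib_zero : fib 0 = {0}
  V_zero : V 0 = o
  W_zero : W 0 = o
  L : ℕ
  le_deg : ∀ i, 1 + i ≤ L * (1 + deg i)
  growth_V : PolyGrowth (fun i => 1 + i) V
  growth_W : PolyGrowth (fun i => 1 + i) W

/-! ### Compact matrices over a frame and their coefficients -/

namespace Frame
variable {B : LCAlg.{u}} (F : Frame B)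

/-- The coefficient algebra. -/
abbrev coeff : LCAlg.{u} := ofClosed B F.B₀ F.isClosed

/-- The elements `b` that map degree `m` to degree `n`, with coefficients in `B₀`. -/
def Good (b : B) (n m : ℕ) : Prop := ∀ i j, F.deg i = n → F.deg j = m → F.V i * b * F.W j ∈ F.B₀

variable {F} in
-- Between the two factors one inserts o = ∑ W l * V l over the indices l of degree k.
theorem Good.mul {b b' : B} {n k m : ℕ} (h : F.Good b n k) (h' : F.Good b' k m) :
    F.Good (b * b') n m := by
  intro i j hi hj
  have e : F.V i * (b * b') * F.W j =
      ∑ l ∈ F.fib k, (F.V i * b * F.W l) * (F.V l * b' * F.W j) := by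
    calc F.V i * (b * b') * F.W j = F.V i * b * F.o * (b' * F.W j) := by
          rw [F.mul_one]; simp only [mul_assoc]
      _ = _ := by
          rw [← F.sum_fib k, Finset.mul_sum, Finset.sum_mul]
          refine Finset.sum_congr rfl fun l _ => ?_
          simp only [mul_assoc]
  rw [e]
  exact sum_mem fun l hl =>
    F.B₀.mul_mem (h i l hi ((F.mem_fib l k).1 hl)) (h' l j ((F.mem_fib l k).1 hl) hj)

theorem deg_zero : F.deg 0 = 0 := (F.mem_fib 0 0).1 (by rw [F.fib_zero]; simp)

/-- The index 0 is the only one of degree zero, and its V and W are the unit. This is what places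
the corner x ⊗ e among the compact matrices. -/
theorem good_zero_zero {b : B} (hb : b ∈ F.B₀) : F.Good b 0 0 := by
  intro i j hi hj
  have hi' := (F.mem_fib i 0).2 hi
  have hj' := (F.mem_fib j 0).2 hj
  rw [F.fib_zero, Finset.mem_singleton] at hi' hj'
  rw [hi', hj', F.V_zero, F.W_zero, F.one_mul, F.mul_one]
  exact hb

/-- The ambient algebra `B ⊗ 𝒯^∞`. -/
noncomputable abbrev amb (_ : Frame B) : LCAlg.{u} := tensor.{u, 0} B alg

/-- The elementary matrix `b ⊗ e_{n m}`. -/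
noncomputable def elem (b : B) (n m : ℕ) : F.amb := tmul.{u, 0} b (show alg from mu n m)

theorem elem_mul (b b' : B) (n m n' m' : ℕ) :
    F.elem b n m * F.elem b' n' m' = if m = n' then F.elem (b * b') n m' else 0 := by
  rw [elem, elem, tmul_mul]
  have := SmoothToeplitz.mu_mul_mu n m n' m'
  split_ifs with h
  · rw [if_pos h] at this
    exact congrArg (tmul.{u, 0} (b * b')) this
  · rw [if_neg h] at this
    exact (congrArg (tmul.{u, 0} (b * b')) this).trans (tmul_zero _)

/-- The elementary matrices with coefficients in `B₀`. -/
def elems : Set F.amb := {x | ∃ b n m, F.Good b n m ∧ x = F.elem b n m}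

/-- The algebra of finite matrices with coefficients in `B₀`. -/
noncomputable def finite : NonUnitalSubalgebra ℂ F.amb where
  __ := Submodule.span ℂ F.elems
  mul_mem' {x y} hx hy := by
    change x * y ∈ Submodule.span ℂ F.elems
    change x ∈ Submodule.span ℂ F.elems at hx
    change y ∈ Submodule.span ℂ F.elems at hy
    induction hx, hy using Submodule.span_induction₂ with
    | mem_mem x y hx hy =>
      obtain ⟨b, n, m, hb, rfl⟩ := hx
      obtain ⟨b', n', m', hb', rfl⟩ := hy
      rw [elem_mul]
      split_ifs with h
      · subst h
        exact Submodule.subset_span ⟨_, _, _, hb.mul hb', rfl⟩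
      · exact Submodule.zero_mem _
    | zero_left y hy => rw [zero_mul]; exact Submodule.zero_mem _
    | zero_right x hx => rw [mul_zero]; exact Submodule.zero_mem _
    | add_left x y z _ _ _ h1 h2 => rw [add_mul]; exact Submodule.add_mem _ h1 h2
    | add_right x y z _ _ _ h1 h2 => rw [mul_add]; exact Submodule.add_mem _ h1 h2
    | smul_left c x y _ _ h => rw [smul_mul_assoc]; exact Submodule.smul_mem _ _ h
    | smul_right c x y _ _ h => rw [mul_smul_comm]; exact Submodule.smul_mem _ _ h

/-- The algebra of smooth compact matrices with coefficients in `B₀`. -/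
noncomputable def compact : NonUnitalSubalgebra ℂ F.amb := F.finite.topologicalClosure

theorem isClosed_compact : IsClosed (F.compact : Set F.amb) :=
  NonUnitalSubalgebra.isClosed_topologicalClosure _

theorem elem_mem {b : B} {n m : ℕ} (h : F.Good b n m) : F.elem b n m ∈ F.compact :=
  NonUnitalSubalgebra.le_topologicalClosure _ (Submodule.subset_span ⟨b, n, m, h, rfl⟩)

theorem compact_le {V : Submodule ℂ F.amb} (hV : IsClosed (V : Set F.amb))
    (h : ∀ b n m, F.Good b n m → F.elem b n m ∈ V) {x : F.amb} (hx : x ∈ F.compact) : x ∈ V := by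
  have h1 : (Submodule.span ℂ F.elems : Set F.amb) ⊆ V := by
    rw [SetLike.coe_subset_coe, Submodule.span_le]
    rintro _ ⟨b, n, m, hb, rfl⟩
    exact h b n m hb
  exact closure_minimal h1 hV hx

/-- The algebra of smooth compact matrices, as a locally convex algebra. -/
noncomputable abbrev cpt : LCAlg.{u} := ofClosed F.amb F.compact F.isClosed_compact

theorem cpt_ext {E : Type*} [AddCommGroup E] [Module ℂ E] [TopologicalSpace E] [T2Space E]
    {f g : F.cpt →ₗ[ℂ] E} (hf : Continuous f) (hg : Continuous g)
    (h : ∀ b n m (hb : F.Good b n m), f ⟨F.elem b n m, F.elem_mem hb⟩ =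
      g ⟨F.elem b n m, F.elem_mem hb⟩) (x : F.cpt) : f x = g x := by
  have hle : F.finite ≤ F.compact := NonUnitalSubalgebra.le_topologicalClosure _
  have key : ∀ y (hy : y ∈ Submodule.span ℂ F.elems),
      f ⟨y, hle hy⟩ = g ⟨y, hle hy⟩ := by
    intro y hy
    induction hy using Submodule.span_induction with
    | mem y hy =>
      obtain ⟨b, n, m, hb, rfl⟩ := hy
      exact h b n m hb
    | zero => exact (map_zero f).trans (map_zero g).symm
    | add y z hy hz h1 h2 =>
      have := map_add f ⟨y, hle hy⟩ ⟨z, hle hz⟩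
      have h3 := map_add g ⟨y, hle hy⟩ ⟨z, hle hz⟩
      rw [h1, h2] at this
      exact this.trans h3.symm
    | smul c y hy h1 =>
      have := map_smul f c ⟨y, hle hy⟩
      have h3 := map_smul g c ⟨y, hle hy⟩
      rw [h1] at this
      exact this.trans h3.symm
  have hx : x ∈ closure {y : F.cpt | y.1 ∈ F.finite} := by
    rw [closure_subtype]
    refine closure_mono ?_ x.2
    intro y hy
    exact ⟨⟨y, hle hy⟩, hy, rfl⟩
  exact closure_minimal (s := {y : F.cpt | y.1 ∈ F.finite}) (t := {y | f y = g y})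
    (fun y hy => key y.1 hy) (isClosed_eq hf hg) hx

theorem entry_elem (n m i j : ℕ) (b : B) :
    entry B n m (F.elem b i j) = if n = i ∧ m = j then b else 0 := entry_mu n m i j b

/-- The condition on x is closed and linear, so it may be tested on elementary matrices. There the
entry vanishes or is the coefficient b itself, for which it is the definition of `Good`. -/
theorem matrix_mem (i j : ℕ) {x : F.amb} (hx : x ∈ F.compact) :
    F.V i * entry B (F.deg i) (F.deg j) x * F.W j ∈ F.B₀ := by
  let f : F.amb →ₗ[ℂ] B := (LinearMap.mulRight ℂ (F.W j)).comp
    ((LinearMap.mulLeft ℂ (F.V i)).comp (entry B (F.deg i) (F.deg j)))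
  have hf : Continuous f :=
    (continuous_const.mul (continuous_entry B _ _)).mul continuous_const
  refine F.compact_le (V := F.B₀.toSubmodule.comap f) (F.isClosed.preimage hf)
    (fun b n m hb => ?_) hx
  change F.V i * entry B (F.deg i) (F.deg j) (F.elem b n m) * F.W j ∈ F.B₀
  rw [entry_elem]
  split_ifs with h
  · exact hb i j h.1 h.2
  · rw [mul_zero, zero_mul]; exact F.B₀.zero_mem

/-- The matrix coefficients with respect to the frame. -/
noncomputable def matrix (i j : ℕ) : F.cpt →ₗ[ℂ] F.coeff where
  toFun x := ⟨F.V i * entry B (F.deg i) (F.deg j) x.1 * F.W j, F.matrix_mem i j x.2⟩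
  map_add' x y := Subtype.ext (by
    change F.V i * entry B (F.deg i) (F.deg j) (x.1 + y.1) * F.W j = _ + _
    rw [map_add, mul_add, add_mul])
  map_smul' c x := Subtype.ext (by
    change F.V i * entry B (F.deg i) (F.deg j) (c • x.1) * F.W j = c • _
    rw [map_smul, mul_smul_comm, smul_mul_assoc])

/-- Entries of x decay rapidly in the degrees, whereas the frame is indexed by i and j. By `le_deg`
an index is bounded linearly by its degree, so decay in degree is decay in the index, of an order
high enough to absorb the polynomial growth of V i and W j. -/
theorem matrix_bound (r : Seminorm ℂ F.coeff) (hr : Continuous r) (N : ℕ) :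
    ∃ R : Seminorm ℂ F.cpt, Continuous R ∧
      ∀ i j x, (wK (i, j) : ℝ) ^ N * r (F.matrix i j x) ≤ R x := by
  obtain ⟨p, hp, hrp⟩ := exists_seminorm_ofClosed r hr
  obtain ⟨q, hq, hpq⟩ := B.exists_seminorm_mul p hp
  obtain ⟨s, hs, hqs⟩ := B.exists_seminorm_mul q hq
  obtain ⟨N1, C1, hC10, hC1⟩ := F.growth_V.exists_nonneg s hs
  obtain ⟨N2, C2, hC20, hC2⟩ := F.growth_W.exists_nonneg q hq
  obtain ⟨R, hR, hRle⟩ := exists_entry_bound s hs (N + N1 + N2)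
  -- C1 and C2 come from the growth of V and W. The power of L is the cost of replacing indices by
  -- degrees in wK^(N + N1 + N2), where L² appears once for each factor wK.
  let c : NNReal := NNReal.mk (C1 * C2) (by positivity) * (F.L : NNReal) ^ (2 * (N + N1 + N2))
  refine ⟨c • R.comp F.compact.toSubmodule.subtype,
    continuous_const.mul (hR.comp continuous_subtype_val), fun i j x => ?_⟩
  have hc : (c • R.comp F.compact.toSubmodule.subtype) x =
      C1 * C2 * (F.L : ℝ) ^ (2 * (N + N1 + N2)) * R x.1 := by
    rw [smul_apply, NNReal.smul_def, smul_eq_mul, Seminorm.comp_apply]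
    simp only [c, NNReal.coe_mul, NNReal.coe_pow, NNReal.coe_natCast]
    rfl
  rw [hc]
  set b := entry B (F.deg i) (F.deg j) x.1 with hb
  have h1 : r (F.matrix i j x) ≤ (s (F.V i) * s b) * q (F.W j) :=
    (hrp _).trans ((hpq _ _).trans (mul_le_mul_of_nonneg_right (hqs _ _) (apply_nonneg _ _)))
  have sb := apply_nonneg s b
  have hi : (1 : ℝ) ≤ ((1 + i : ℕ) : ℝ) := by push_cast; linarith [Nat.cast_nonneg (α := ℝ) i]
  have hj : (1 : ℝ) ≤ ((1 + j : ℕ) : ℝ) := by push_cast; linarith [Nat.cast_nonneg (α := ℝ) j]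
  have hw : (wK (i, j) : ℝ) = ((1 + i : ℕ) : ℝ) * ((1 + j : ℕ) : ℝ) := by
    rw [wK, Nat.cast_mul]
  have hiw : ((1 + i : ℕ) : ℝ) ≤ wK (i, j) := by rw [hw]; nlinarith
  have hjw : ((1 + j : ℕ) : ℝ) ≤ wK (i, j) := by rw [hw]; nlinarith
  have hdeg : (wK (i, j) : ℝ) ≤ (F.L : ℝ) ^ 2 * wK (F.deg i, F.deg j) := by
    have h := Nat.mul_le_mul (F.le_deg i) (F.le_deg j)
    calc (wK (i, j) : ℝ) = (((1 + i) * (1 + j) : ℕ) : ℝ) := rfl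
      _ ≤ ((F.L * (1 + F.deg i) * (F.L * (1 + F.deg j)) : ℕ) : ℝ) := by exact_mod_cast h
      _ = _ := by simp only [wK]; push_cast; ring
  calc (wK (i, j) : ℝ) ^ N * r (F.matrix i j x)
      ≤ (wK (i, j) : ℝ) ^ N * ((C1 * (wK (i, j) : ℝ) ^ N1 * s b) * (C2 * (wK (i, j) : ℝ) ^ N2)) := by
        have e1 : s (F.V i) ≤ C1 * (wK (i, j) : ℝ) ^ N1 := (hC1 i).trans (by gcongr)
        have e2 : q (F.W j) ≤ C2 * (wK (i, j) : ℝ) ^ N2 := (hC2 j).trans (by gcongr)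
        refine mul_le_mul_of_nonneg_left (h1.trans ?_) (by positivity)
        gcongr
    _ = C1 * C2 * ((wK (i, j) : ℝ) ^ (N + N1 + N2) * s b) := by ring
    _ ≤ C1 * C2 * (((F.L : ℝ) ^ 2 * wK (F.deg i, F.deg j)) ^ (N + N1 + N2) * s b) := by gcongr
    _ = C1 * C2 * (F.L : ℝ) ^ (2 * (N + N1 + N2)) *
          ((wK (F.deg i, F.deg j) : ℝ) ^ (N + N1 + N2) * s b) := by
        rw [mul_pow, ← pow_mul]; ring
    _ ≤ _ := by
        gcongr
        exact hRle _ _ _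

open Classical in
/-- The matrix coefficient `V i * b * W j`, as an element of `B₀`. -/
noncomputable def co (b : B) (i j : ℕ) : F.coeff :=
  -- The default value is never relevant: coefficients are used only for `Good` b at indices of the
  -- matching degrees.
  if h : F.V i * b * F.W j ∈ F.B₀ then ⟨_, h⟩ else (0 : F.coeff)

theorem co_val {b : B} {i j : ℕ} (h : F.V i * b * F.W j ∈ F.B₀) :
    (F.co b i j).1 = F.V i * b * F.W j := by
  rw [co, dif_pos h]

/-- Again the unit is inserted as the sum over degree k, which is what makes passing to frame
coefficients multiplicative. -/
theorem co_mul {b b' : B} {n k m i j : ℕ} (h : F.Good b n k) (h' : F.Good b' k m)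
    (hi : F.deg i = n) (hj : F.deg j = m) :
    F.co (b * b') i j = ∑ l ∈ F.fib k, F.co b i l * F.co b' l j := by
  apply Subtype.ext
  have e := ap_sum (incl B F.B₀ F.isClosed) (F.fib k) fun l => F.co b i l * F.co b' l j
  refine Eq.trans ?_ e.symm
  rw [F.co_val (h.mul h' i j hi hj)]
  calc F.V i * (b * b') * F.W j = F.V i * b * F.o * (b' * F.W j) := by
        rw [F.mul_one]; simp only [mul_assoc]
    _ = ∑ l ∈ F.fib k, (F.V i * b * F.W l) * (F.V l * b' * F.W j) := by
        rw [← F.sum_fib k, Finset.mul_sum, Finset.sum_mul]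
        refine Finset.sum_congr rfl fun l _ => ?_
        simp only [mul_assoc]
    _ = _ := by
        refine Finset.sum_congr rfl fun l hl => ?_
        have hl' := (F.mem_fib l k).1 hl
        rw [ap_mul]
        exact (congrArg₂ (· * ·) (F.co_val (h i l hi hl')) (F.co_val (h' l j hl' hj))).symm

/-- The frame identifies the compact matrices over `B` with matrices over `B₀`. -/
theorem exists_frameHom : ∃ M : F.cpt ⟶ tensor.{0, u} K F.coeff,
    ∀ b n m (hb : F.Good b n m), ap M ⟨F.elem b n m, F.elem_mem hb⟩ =
      ∑ i ∈ F.fib n, ∑ j ∈ F.fib m, tmul.{0, u} (K.mu i j) (F.co b i j) := by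
  -- The homomorphism is the sum of e_{ij} ⊗ (coefficient at i, j) over all i and j. It converges
  -- absolutely: e_{ij} grows polynomially in the weight, the coefficient decays faster than every
  -- power, and two spare powers give summability.
  let u : ℕ × ℕ → F.cpt →ₗ[ℂ] tensor.{0, u} K F.coeff := fun p =>
    (tmulBilin K F.coeff (K.mu p.1 p.2)).comp (F.matrix p.1 p.2)
  obtain ⟨M, hM, hsum⟩ := exists_sum_linear u (fun p hp => by
    obtain ⟨q, r, hq, hr, hqr⟩ := exists_seminorm_tmul (A := K) (B := F.coeff) p hp
    obtain ⟨N, C, hC0, hC⟩ := K.growth_mu.exists_nonneg q hq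
    obtain ⟨R, hR, hRle⟩ := F.matrix_bound r hr (N + 2)
    refine ⟨R, fun i => C * ((wK i : ℝ) ^ 2)⁻¹, hR, summable_wK.mul_left C, fun i x => ?_⟩
    have hwi : (0 : ℝ) < wK i := by exact_mod_cast wK_pos i
    have r0 := apply_nonneg r (F.matrix i.1 i.2 x)
    calc p (u i x) ≤ q (K.mu i.1 i.2) * r (F.matrix i.1 i.2 x) := hqr _ _
      _ ≤ (C * (wK i : ℝ) ^ N) * r (F.matrix i.1 i.2 x) := by gcongr; exact hC i
      _ = C * ((wK i : ℝ) ^ 2)⁻¹ * ((wK i : ℝ) ^ (N + 2) * r (F.matrix i.1 i.2 x)) := by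
          rw [pow_add]; field_simp
      _ ≤ _ := by gcongr; exact hRle i.1 i.2 x)
  have hval : ∀ b n m (hb : F.Good b n m), M ⟨F.elem b n m, F.elem_mem hb⟩ =
      ∑ i ∈ F.fib n, ∑ j ∈ F.fib m, tmul.{0, u} (K.mu i j) (F.co b i j) := by
    intro b n m hb
    -- On an elementary matrix at (n, m) only indices of degrees n and m contribute, so the sum is
    -- finite.
    have h0 := hasSum_sum_of_ne_finset_zero (L := .unconditional (ℕ × ℕ))
      (f := fun p => u p ⟨F.elem b n m, F.elem_mem hb⟩)
      (s := F.fib n ×ˢ F.fib m) (fun p hp => by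
        have : F.matrix p.1 p.2 ⟨F.elem b n m, F.elem_mem hb⟩ = 0 := Subtype.ext (by
          change F.V p.1 * entry B (F.deg p.1) (F.deg p.2) (F.elem b n m) * F.W p.2 = 0
          rw [entry_elem, if_neg, mul_zero, zero_mul]
          rintro ⟨h1, h2⟩
          exact hp (Finset.mem_product.2 ⟨(F.mem_fib _ _).2 h1, (F.mem_fib _ _).2 h2⟩))
        change tmulBilin K F.coeff (K.mu p.1 p.2) (F.matrix p.1 p.2 _) = 0
        rw [this, map_zero])
    rw [(hsum _).unique h0, Finset.sum_product]
    refine Finset.sum_congr rfl fun i hi => Finset.sum_congr rfl fun j hj => ?_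
    have hi' := (F.mem_fib _ _).1 hi
    have hj' := (F.mem_fib _ _).1 hj
    have : F.matrix i j ⟨F.elem b n m, F.elem_mem hb⟩ = F.co b i j := Subtype.ext (by
      rw [F.co_val (hb i j hi' hj')]
      change F.V i * entry B (F.deg i) (F.deg j) (F.elem b n m) * F.W j = _
      rw [entry_elem, if_pos ⟨hi', hj'⟩])
    change tmulBilin K F.coeff (K.mu i j) (F.matrix i j _) = _
    rw [this]; rfl
  have hbase : ∀ b n k (hb : F.Good b n k) b' k' m (hb' : F.Good b' k' m),
      M (⟨F.elem b n k, F.elem_mem hb⟩ * ⟨F.elem b' k' m, F.elem_mem hb'⟩) =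
        M ⟨F.elem b n k, F.elem_mem hb⟩ * M ⟨F.elem b' k' m, F.elem_mem hb'⟩ := by
    intro b n k hb b' k' m hb'
    have hprod : ∀ i l l' j, tmul.{0, u} (K.mu i l) (F.co b i l) *
        tmul.{0, u} (K.mu l' j) (F.co b' l' j) =
          if l = l' then tmul.{0, u} (K.mu i j) (F.co b i l * F.co b' l' j) else 0 := by
      intro i l l' j
      rw [tmul_mul, K.mu_mul_mu]
      split_ifs with h
      · rfl
      · exact zero_tmul _
    rw [hval b n k hb, hval b' k' m hb', Finset.sum_mul]
    simp_rw [Finset.sum_mul, Finset.mul_sum, hprod]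
    by_cases hk : k = k'
    · subst hk
      have e : (⟨F.elem b n k, F.elem_mem hb⟩ * ⟨F.elem b' k m, F.elem_mem hb'⟩ : F.cpt) =
          ⟨F.elem (b * b') n m, F.elem_mem (hb.mul hb')⟩ := Subtype.ext (by
        change F.elem b n k * F.elem b' k m = _
        rw [elem_mul, if_pos rfl])
      rw [e, hval _ _ _ (hb.mul hb')]
      refine Finset.sum_congr rfl fun i hi => ?_
      calc ∑ j ∈ F.fib m, tmul.{0, u} (K.mu i j) (F.co (b * b') i j)
          = ∑ j ∈ F.fib m, ∑ l ∈ F.fib k,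
              tmul.{0, u} (K.mu i j) (F.co b i l * F.co b' l j) := by
            refine Finset.sum_congr rfl fun j hj => ?_
            rw [F.co_mul hb hb' ((F.mem_fib _ _).1 hi) ((F.mem_fib _ _).1 hj), tmul_sum]
        _ = _ := by
            rw [Finset.sum_comm]
            refine Finset.sum_congr rfl fun l hl => ?_
            rw [Finset.sum_eq_single_of_mem l hl]
            · refine Finset.sum_congr rfl fun j _ => ?_
              rw [if_pos rfl]
            · intro l' _ hne
              exact Finset.sum_eq_zero fun j _ => if_neg fun h => hne h.symm
    · have e : (⟨F.elem b n k, F.elem_mem hb⟩ * ⟨F.elem b' k' m, F.elem_mem hb'⟩ : F.cpt) = 0 :=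
        Subtype.ext (by
          change F.elem b n k * F.elem b' k' m = 0
          rw [elem_mul, if_neg hk])
      rw [e, map_zero]
      -- If k ≠ k', the inner indices l and l' have different degrees and never coincide, so all
      -- products of matrix units vanish.
      refine (Finset.sum_eq_zero fun i _ => Finset.sum_eq_zero fun l hl =>
        Finset.sum_eq_zero fun l' hl' => Finset.sum_eq_zero fun j _ => if_neg fun h => hk ?_).symm
      rw [← (F.mem_fib _ _).1 hl, ← (F.mem_fib _ _).1 hl', h]
  have hmul : ∀ x y, M (x * y) = M x * M y := by
    intro x y
    refine F.cpt_ext (f := M.comp (LinearMap.mulRight ℂ y))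
      (g := (LinearMap.mulRight ℂ (M y)).comp M)
      (hM.comp (continuous_id.mul continuous_const)) (hM.mul continuous_const)
      (fun b n k hb => ?_) x
    exact F.cpt_ext (f := M.comp (LinearMap.mulLeft ℂ ⟨F.elem b n k, F.elem_mem hb⟩))
      (g := (LinearMap.mulLeft ℂ (M ⟨F.elem b n k, F.elem_mem hb⟩)).comp M)
      (hM.comp (continuous_const.mul continuous_id)) (continuous_const.mul hM)
      (fun b' k' m hb' => hbase b n k hb b' k' m hb') y
  exact ⟨mkHom (A := F.cpt) (B := tensor.{0, u} K F.coeff)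
    { toFun := M, map_smul' := map_smul M, map_zero' := map_zero M,
      map_add' := map_add M, map_mul' := hmul } hM, hval⟩

end Frame
end LCAlg

/-! ### Multipliers of the compact matrices -/

namespace LCAlg.Frame
open SmoothToeplitz
variable {B : LCAlg.{u}} (F : Frame B)

/-- The multipliers of the smooth compact matrices. -/
noncomputable def multipliers : NonUnitalSubalgebra ℂ F.amb where
  carrier := {z | ∀ x ∈ F.compact, z * x ∈ F.compact ∧ x * z ∈ F.compact}
  add_mem' {z w} hz hw x hx := by
    rw [add_mul, mul_add]
    exact ⟨F.compact.add_mem (hz x hx).1 (hw x hx).1, F.compact.add_mem (hz x hx).2 (hw x hx).2⟩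
  zero_mem' x hx := by
    rw [zero_mul, mul_zero]
    exact ⟨F.compact.zero_mem, F.compact.zero_mem⟩
  mul_mem' {z w} hz hw x hx := by
    rw [mul_assoc, ← mul_assoc x]
    exact ⟨(hz _ (hw x hx).1).1, (hw _ (hz x hx).2).2⟩
  smul_mem' c z hz x hx := by
    rw [smul_mul_assoc, mul_smul_comm]
    exact ⟨F.compact.smul_mem c (hz x hx).1, F.compact.smul_mem c (hz x hx).2⟩

theorem isClosed_multipliers : IsClosed (F.multipliers : Set F.amb) := by
  have : (F.multipliers : Set F.amb) =
      ⋂ x ∈ F.compact, {z | z * x ∈ F.compact} ∩ {z | x * z ∈ F.compact} := by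
    ext z
    simp only [Set.mem_iInter]
    exact Iff.rfl
  rw [this]
  exact isClosed_biInter fun x _ =>
    (F.isClosed_compact.preimage (continuous_id.mul continuous_const)).inter
      (F.isClosed_compact.preimage (continuous_const.mul continuous_id))

theorem mem_multipliers {z : F.amb} (h : ∀ b n m, F.Good b n m →
    z * F.elem b n m ∈ F.compact ∧ F.elem b n m * z ∈ F.compact) : z ∈ F.multipliers := by
  intro x hx
  exact ⟨F.compact_le (V := F.compact.toSubmodule.comap (LinearMap.mulLeft ℂ z))
      (F.isClosed_compact.preimage (continuous_const.mul continuous_id))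
      (fun b n m hb => (h b n m hb).1) hx,
    F.compact_le (V := F.compact.toSubmodule.comap (LinearMap.mulRight ℂ z))
      (F.isClosed_compact.preimage (continuous_id.mul continuous_const))
      (fun b n m hb => (h b n m hb).2) hx⟩

theorem tmul_mul_elem (b b' : B) {s : SmoothToeplitz} {n m n' m' : ℕ} (h : s * mu n m = mu n' m') :
    tmul.{u, 0} b (show alg from s) * F.elem b' n m = F.elem (b * b') n' m' := by
  rw [elem, tmul_mul]
  exact congrArg (tmul.{u, 0} (b * b')) h

theorem elem_mul_tmul (b b' : B) {s : SmoothToeplitz} {n m n' m' : ℕ} (h : mu n m * s = mu n' m') :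
    F.elem b' n m * tmul.{u, 0} b (show alg from s) = F.elem (b' * b) n' m' := by
  rw [elem, tmul_mul]
  exact congrArg (tmul.{u, 0} (b' * b)) h

theorem tmul_one_mem {b : B} (h : ∀ n, F.Good b n n) :
    tmul.{u, 0} b (show alg from one) ∈ F.multipliers :=
  F.mem_multipliers fun b' n m hb' => by
    rw [F.tmul_mul_elem b b' (one_mul' _), F.elem_mul_tmul b b' (mul_one' _)]
    exact ⟨F.elem_mem ((h n).mul hb'), F.elem_mem (hb'.mul (h m))⟩

/-- On the left S raises the row, on the right it lowers the column, and in both cases b changes the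
degree accordingly. -/
theorem tmul_S_mem {b : B} (h : ∀ n, F.Good b (n + 1) n) :
    tmul.{u, 0} b (show alg from S) ∈ F.multipliers :=
  F.mem_multipliers fun b' n m hb' => by
    rw [F.tmul_mul_elem b b' (S_mul_mu n m)]
    refine ⟨F.elem_mem ((h n).mul hb'), ?_⟩
    -- Column 0 is separate, because e_{n0} S = 0.
    rcases m with _ | m
    · rw [elem, tmul_mul]
      have : tmul.{u, 0} (b' * b) (show alg from mu n 0 * S) = 0 := by
        rw [mu_zero_mul_S]; exact tmul_zero _
      exact this ▸ F.compact.zero_mem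
    · rw [F.elem_mul_tmul b b' (mu_succ_mul_S n m)]
      exact F.elem_mem (hb'.mul (h m))

theorem tmul_Sbar_mem {b : B} (h : ∀ n, F.Good b n (n + 1)) :
    tmul.{u, 0} b (show alg from Sbar) ∈ F.multipliers :=
  F.mem_multipliers fun b' n m hb' => by
    rw [F.elem_mul_tmul b b' (mu_mul_Sbar n m)]
    refine ⟨?_, F.elem_mem (hb'.mul (h m))⟩
    rcases n with _ | n
    · rw [elem, tmul_mul]
      have : tmul.{u, 0} (b * b') (show alg from Sbar * mu 0 m) = 0 := by
        rw [Sbar_mul_mu_zero]; exact tmul_zero _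
      exact this ▸ F.compact.zero_mem
    · rw [F.tmul_mul_elem b b' (Sbar_mul_mu_succ n m)]
      exact F.elem_mem ((h n).mul hb')

/-- Two morphisms that differ by compact matrices on generators do so everywhere. -/
theorem diff_mem {Y : LCAlg.{u}} (f g : Y ⟶ F.amb) {s : Set Y}
    (hs : ∀ x ∈ s, ap f x ∈ F.multipliers ∧ ap f x - ap g x ∈ F.compact) {x : Y}
    (hx : x ∈ (NonUnitalAlgebra.adjoin ℂ s).topologicalClosure) :
    ap f x ∈ F.multipliers ∧ ap f x - ap g x ∈ F.compact := by
  let T : NonUnitalSubalgebra ℂ Y :=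
    { carrier := {x | ap f x ∈ F.multipliers ∧ ap f x - ap g x ∈ F.compact}
      add_mem' := fun {x y} hx hy => by
        refine ⟨?_, ?_⟩
        · rw [ap_add]; exact F.multipliers.add_mem hx.1 hy.1
        · rw [ap_add, ap_add, add_sub_add_comm]; exact F.compact.add_mem hx.2 hy.2
      zero_mem' := by
        refine ⟨?_, ?_⟩
        · rw [ap_zero]; exact F.multipliers.zero_mem
        · rw [ap_zero, ap_zero, sub_zero]; exact F.compact.zero_mem
      mul_mem' := fun {x y} hx hy => by
        refine ⟨?_, ?_⟩
        · rw [ap_mul]; exact F.multipliers.mul_mem hx.1 hy.1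
        -- In this form of the product rule only values of f multiply the differences, so nothing
        -- has to be known about g being a multiplier.
        · have e : ap f (x * y) - ap g (x * y) = ap f x * (ap f y - ap g y) +
              (ap f x - ap g x) * ap f y - (ap f x - ap g x) * (ap f y - ap g y) := by
            rw [ap_mul, ap_mul]; noncomm_ring
          rw [e]
          exact sub_mem (F.compact.add_mem (hx.1 _ hy.2).1 (hy.1 _ hx.2).2)
            (F.compact.mul_mem hx.2 hy.2)
      smul_mem' := fun c x hx => by
        refine ⟨?_, ?_⟩
        · rw [ap_smul]; exact F.multipliers.smul_mem c hx.1
        · rw [ap_smul, ap_smul, ← smul_sub]; exact F.compact.smul_mem c hx.2 }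
  have hT : IsClosed (T : Set Y) :=
    (F.isClosed_multipliers.preimage (ap_continuous f)).inter
      (F.isClosed_compact.preimage ((ap_continuous f).sub (ap_continuous g)))
  have hle : NonUnitalAlgebra.adjoin ℂ s ≤ T := NonUnitalAlgebra.adjoin_le hs
  exact closure_minimal (show (NonUnitalAlgebra.adjoin ℂ s : Set Y) ⊆ T from hle) hT hx

end LCAlg.Frame

/-! ### The frame of a tame family -/

namespace PimsnerSubalgebra
open LCAlg
variable {A E : Type u} [CStarAlgebra A] [PartialOrder A] [StarOrderedRing A]
    [NormedAddCommGroup E] [NormedSpace ℂ E] [Module Aᵐᵒᵖ E] [CStarModule Aᵐᵒᵖ E]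
    {c : Correspondence A E} (P : PimsnerSubalgebra c)

theorem incl_S (ξ : P.calE) : P.incl (P.S ξ) = c.S ξ.1 := ξ.2.choose_spec

theorem incl_Sbar (ξ : P.calE) : P.incl (P.Sbar ξ) = star (c.S ξ.1) := by
  rw [Sbar, (P.star_mem (P.S ξ)).choose_spec, incl_S]

theorem one_mem : P.one ∈ P.calASub := ⟨1, P.incl_one.symm⟩

/-- The relation S_ξ⋆ a S_η = ⟨ξ, a η⟩ of the Pimsner algebra, verified in every covariant
representation, shows that the product comes from A; it lies in D by construction. -/
theorem Sbar_mul_mul_S {a : P.D} (ha : a ∈ P.calASub) (ξ η : P.calE) :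
    P.Sbar ξ * a * P.S η ∈ P.calASub := by
  obtain ⟨a', ha'⟩ := ha
  refine ⟨Correspondence.ip ξ.1 (c.φ a' η.1), ?_⟩
  rw [map_mul, map_mul, incl_S, incl_Sbar, ← ha']
  refine Subtype.ext (lp.ext (funext fun ρ => ?_))
  change ρ.π (Correspondence.ip ξ.1 (c.φ a' η.1)) = star (ρ.t ξ.1) * ρ.π a' * ρ.t η.1
  rw [← ρ.t_inner, ρ.t_left, mul_assoc]

theorem Smulti_cons (ζ : P.calE) (ξ : List P.calE) : P.Smulti (ζ :: ξ) = P.S ζ * P.Smulti ξ := rfl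

theorem Sbarmulti_cons (ζ : P.calE) (ξ : List P.calE) :
    P.Sbarmulti (ζ :: ξ) = P.Sbarmulti ξ * P.Sbar ζ := by
  -- The left fold starts from an accumulator that changes along the list, so the induction needs an
  -- arbitrary initial value.
  have key : ∀ (ξ : List P.calE) (d : P.D),
      ξ.foldl (fun d η => P.Sbar η * d) d = P.Sbarmulti ξ * d := by
    intro ξ
    induction ξ with
    | nil => intro d; exact (P.one_mul d).symm
    | cons η ξ ih =>
      intro d
      have h1 : P.Sbarmulti (η :: ξ) = P.Sbarmulti ξ * (P.Sbar η * P.one) := ih _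
      rw [h1, P.mul_one, mul_assoc]
      exact ih _
  have h := key ξ (P.Sbar ζ * P.one)
  rw [P.mul_one] at h
  rw [← h]
  simp only [Sbarmulti, List.foldl_cons, P.mul_one]

/-- The innermost factors S̄_ζ a S_θ form an element of 𝒜 again, which takes the place of a; equal
lengths ensure that nothing is left over. -/
theorem Sbarmulti_mul_mul_Smulti : ∀ (ξ η : List P.calE) (_ : ξ.length = η.length) {a : P.D}
    (_ : a ∈ P.calASub), P.Sbarmulti ξ * a * P.Smulti η ∈ P.calASub
  | [], [], _, a, ha => by
    change P.one * a * P.one ∈ P.calASub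
    rwa [P.one_mul, P.mul_one]
  | ζ :: ξ, θ :: η, h, a, ha => by
    have := Sbarmulti_mul_mul_Smulti ξ η (by simpa using h) (P.Sbar_mul_mul_S ha ζ θ)
    rw [Sbarmulti_cons, Smulti_cons]
    simpa only [mul_assoc] using this

/-- The families of multivectors that make `D` tame. -/
structure TameFamily where
  l : ℕ
  ξ : ℕ → List P.calE
  l_pos : 0 < l
  length_eq : ∀ i, (ξ i).length = i / l + 1
  sum_eq : ∀ k, ∑ r ∈ Finset.range l,
    P.Smulti (ξ (l * k + r)) * P.Sbarmulti (ξ (l * k + r)) = P.one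
  growth : ∀ p : Seminorm ℂ P.D, Continuous p → ∃ (N : ℕ) (M : ℝ), ∀ i : ℕ,
    p (P.Smulti (ξ i)) ≤ M * (1 + i) ^ N ∧ p (P.Sbarmulti (ξ i)) ≤ M * (1 + i) ^ N

theorem Tame.nonempty {P : PimsnerSubalgebra c} (h : P.Tame) : Nonempty P.TameFamily := by
  obtain ⟨l, ξ, h1, h2, h3, h4⟩ := h
  exact ⟨⟨l, ξ, h1, h2, h3, h4⟩⟩

namespace TameFamily
variable {P} (T : P.TameFamily)

/-- The multivectors, starting with the one of degree zero. -/
def Ξ : ℕ → List P.calE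
  | 0 => []
  | i + 1 => T.ξ i

/-- The indices of the multivectors of a given degree. -/
def fib : ℕ → Finset ℕ
  | 0 => {0}
  | k + 1 => (Finset.range T.l).image fun r => T.l * k + r + 1

theorem mem_fib (i n : ℕ) : i ∈ T.fib n ↔ (T.Ξ i).length = n := by
  rcases i with _ | j <;> rcases n with _ | k
  · simp [fib, Ξ]
  · simp [fib, Ξ]
  · simp [fib, Ξ, T.length_eq]
  · simp only [fib, Ξ, T.length_eq, Finset.mem_image, Finset.mem_range, Nat.add_right_cancel_iff]
    constructor
    · rintro ⟨r, hr, rfl⟩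
      rw [Nat.mul_add_div T.l_pos, Nat.div_eq_of_lt hr, add_zero]
    · rintro rfl
      exact ⟨j % T.l, Nat.mod_lt _ T.l_pos, Nat.div_add_mod j T.l⟩

/-- Prepending the empty multivector shifts indices by one and adds one value, which the constant p
(x []) absorbs. -/
theorem growth_cons {x : List P.calE → P.D}
    (h : ∀ p : Seminorm ℂ P.D, Continuous p → ∃ (N : ℕ) (M : ℝ), ∀ i : ℕ,
      p (x (T.ξ i)) ≤ M * (1 + i) ^ N) : PolyGrowth (fun i => 1 + i) fun i => x (T.Ξ i) := by
  intro p hp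
  obtain ⟨N, M, hM⟩ := h p hp
  refine ⟨N, |M| + p (x []), fun i => ?_⟩
  have h0 := apply_nonneg p (x [])
  rcases i with _ | i
  · change p (x []) ≤ _
    simp only [add_zero, Nat.cast_one, one_pow]
    linarith [abs_nonneg M]
  · change p (x (T.ξ i)) ≤ _
    calc p (x (T.ξ i)) ≤ M * (1 + i) ^ N := hM i
      _ ≤ (|M| + p (x [])) * ((1 + (i + 1) : ℕ) : ℝ) ^ N := by
        have : M ≤ |M| + p (x []) := by linarith [le_abs_self M]
        gcongr
        push_cast
        linarith

variable {B : LCAlg.{u}} (η : P.D ⟶ B) (B₀ : NonUnitalSubalgebra ℂ B)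
  (hB : IsClosed (B₀ : Set B)) (h1 : ∀ b, ap η P.one * b = b) (h2 : ∀ b, b * ap η P.one = b)

/-- The frame defined by a tame family, in any unital algebra over `D`. -/
noncomputable def frame : Frame B where
  B₀ := B₀
  isClosed := hB
  o := ap η P.one
  one_mul := h1
  mul_one := h2
  V i := ap η (P.Sbarmulti (T.Ξ i))
  W i := ap η (P.Smulti (T.Ξ i))
  deg i := (T.Ξ i).length
  fib := T.fib
  mem_fib := T.mem_fib
  sum_fib n := by
    rcases n with _ | k
    · rw [fib, Finset.sum_singleton]
      exact h1 _
    · rw [fib, Finset.sum_image (by intro r _ r' _ h; simpa using h), ← T.sum_eq k, ap_sum]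
      exact Finset.sum_congr rfl fun r _ => (ap_mul η _ _).symm
  fib_zero := rfl
  V_zero := rfl
  W_zero := rfl
  -- Each positive degree occupies l consecutive indices, so indices grow at most linearly in the
  -- degree; l + 1 is a convenient slope.
  L := T.l + 1
  le_deg i := by
    rcases i with _ | j
    · simp [Ξ]
    · change 1 + (j + 1) ≤ (T.l + 1) * (1 + (T.ξ j).length)
      rw [T.length_eq]
      have h3 := Nat.div_add_mod j T.l
      have h4 := Nat.mod_lt j T.l_pos
      have h5 : (T.l + 1) * (1 + (j / T.l + 1)) = T.l * (j / T.l) + 2 * T.l + j / T.l + 2 := by ring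
      rw [h5]
      clear h5
      generalize j / T.l = q at *
      generalize T.l * q = m at *
      generalize j % T.l = r at *
      omega
  growth_V := (T.growth_cons fun p hp => by
    obtain ⟨N, M, h⟩ := T.growth p hp
    exact ⟨N, M, fun i => (h i).2⟩).map (η.toAlgHom : P.D →ₗ[ℂ] B) η.cont
  growth_W := (T.growth_cons fun p hp => by
    obtain ⟨N, M, h⟩ := T.growth p hp
    exact ⟨N, M, fun i => (h i).1⟩).map (η.toAlgHom : P.D →ₗ[ℂ] B) η.cont

theorem good_calA (hη : ∀ a ∈ P.calASub, ap η a ∈ B₀) {a : P.D} (ha : a ∈ P.calASub) (n : ℕ) :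
    (T.frame η B₀ hB h1 h2).Good (ap η a) n n := by
  intro i j hi hj
  have := hη _ (P.Sbarmulti_mul_mul_Smulti (T.Ξ i) (T.Ξ j) (hi.trans hj.symm) ha)
  rwa [ap_mul, ap_mul] at this

/-- The factor S_ξ is absorbed into the multivector on its right, which then has the same length n +
1 as the one on the left. The middle element of 𝒜 is the unit. -/
theorem good_S (hη : ∀ a ∈ P.calASub, ap η a ∈ B₀) (ξ : P.calE) (n : ℕ) :
    (T.frame η B₀ hB h1 h2).Good (ap η (P.S ξ)) (n + 1) n := by
  intro i j hi hj
  have hi' : (T.Ξ i).length = n + 1 := hi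
  have hj' : (T.Ξ j).length = n := hj
  have := hη _ (P.Sbarmulti_mul_mul_Smulti (T.Ξ i) (ξ :: T.Ξ j) (by simp [hi', hj']) P.one_mem)
  rw [P.mul_one, Smulti_cons, ← mul_assoc, ap_mul, ap_mul] at this
  exact this

theorem good_Sbar (hη : ∀ a ∈ P.calASub, ap η a ∈ B₀) (ξ : P.calE) (n : ℕ) :
    (T.frame η B₀ hB h1 h2).Good (ap η (P.Sbar ξ)) n (n + 1) := by
  intro i j hi hj
  have hi' : (T.Ξ i).length = n := hi
  have hj' : (T.Ξ j).length = n + 1 := hj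
  have := hη _ (P.Sbarmulti_mul_mul_Smulti (ξ :: T.Ξ i) (T.Ξ j) (by simp [hi', hj']) P.one_mem)
  rw [P.mul_one, Sbarmulti_cons, ap_mul, ap_mul] at this
  exact this

end TameFamily
end PimsnerSubalgebra

/-! ### Homomorphisms determined by generators -/

namespace LCAlg
open SmoothToeplitz

theorem mem_of_mem_closure_adjoin {Y : LCAlg.{u}} {s : Set Y} {T : NonUnitalSubalgebra ℂ Y}
    (hT : IsClosed (T : Set Y)) (hs : s ⊆ T) {x : Y}
    (hx : x ∈ (NonUnitalAlgebra.adjoin ℂ s).topologicalClosure) : x ∈ T :=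
  closure_minimal (show (NonUnitalAlgebra.adjoin ℂ s : Set Y) ⊆ T from
    NonUnitalAlgebra.adjoin_le hs) hT hx

theorem eq_of_generators {X Y : LCAlg.{u}} (k f : Y ⟶ X) {s : Set Y}
    (hs : ∀ x ∈ s, ap k x = ap f x) {x : Y}
    (hx : x ∈ (NonUnitalAlgebra.adjoin ℂ s).topologicalClosure) : ap k x = ap f x :=
  mem_of_mem_closure_adjoin (T := NonUnitalAlgHom.equalizer k.toAlgHom f.toAlgHom)
    (isClosed_eq (ap_continuous k) (ap_continuous f)) hs hx

/-- By orthogonality f + g is itself multiplicative, so the elements on which it agrees with k form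
a closed subalgebra. -/
theorem eq_add_of_generators {X Y : LCAlg.{u}} (k f g : Y ⟶ X)
    (hfg : ∀ x y, ap f x * ap g y = 0) (hgf : ∀ x y, ap g x * ap f y = 0) {s : Set Y}
    (hs : ∀ x ∈ s, ap k x = ap f x + ap g x) {x : Y}
    (hx : x ∈ (NonUnitalAlgebra.adjoin ℂ s).topologicalClosure) : ap k x = ap f x + ap g x := by
  let T : NonUnitalSubalgebra ℂ Y :=
    { carrier := {x | ap k x = ap f x + ap g x}
      add_mem' := fun {x y} hx hy => by
        change ap k (x + y) = ap f (x + y) + ap g (x + y)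
        rw [ap_add, ap_add, ap_add, hx, hy]; abel
      zero_mem' := by
        change ap k 0 = ap f 0 + ap g 0
        rw [ap_zero, ap_zero, ap_zero, add_zero]
      mul_mem' := fun {x y} hx hy => by
        change ap k (x * y) = ap f (x * y) + ap g (x * y)
        rw [ap_mul, ap_mul, ap_mul, hx, hy, add_mul, mul_add, mul_add, hfg, hgf, add_zero, zero_add]
      smul_mem' := fun c x hx => by
        change ap k (c • x) = ap f (c • x) + ap g (c • x)
        rw [ap_smul, ap_smul, ap_smul, hx, smul_add] }
  exact mem_of_mem_closure_adjoin (T := T)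
    (isClosed_eq (ap_continuous k) ((ap_continuous f).add (ap_continuous g))) hs hx

/-- The homomorphism `b ↦ a ⊗ b` for an idempotent `a`. -/
noncomputable def tmulLeftAlgHom {A : LCAlg.{u}} (a : A) (ha : a * a = a) (B : LCAlg.{w}) :
    B →ₙₐ[ℂ] tensor A B where
  toFun b := tmul a b
  map_smul' c b := tmul_smul c a b
  map_zero' := tmul_zero a
  map_add' b b' := tmul_add a b b'
  map_mul' b b' := by rw [tmul_mul, ha]

/-- Functoriality of the tensor product in the second variable. -/
theorem exists_tensorMap {A : LCAlg.{w}} {B C : LCAlg.{u}} (f : B ⟶ C) :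
    ∃ k : tensor.{w, u} A B ⟶ tensor.{w, u} A C, ∀ a b, ap k (tmul a b) = tmul a (ap f b) := by
  obtain ⟨k, hk, hk2⟩ := exists_tensorLift (A := A) (B := B)
    ((tmulBilin A C).compl₂ (f.toAlgHom : B →ₗ[ℂ] C))
    (continuous_tmul.comp (continuous_fst.prodMk ((ap_continuous f).comp continuous_snd)))
  have hk3 : ∀ a b, k (tmul a b) = tmul a (ap f b) := hk2
  have hmul : ∀ x y, k (x * y) = k x * k y := by
    intro x y
    refine dense_span_tmul (f := k.toAddMonoidHom.comp (AddMonoidHom.mulRight y))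
      (g := (AddMonoidHom.mulRight (k y)).comp k.toAddMonoidHom)
      (hk.comp (continuous_id.mul continuous_const)) (hk.mul continuous_const) (fun a b => ?_) x
    refine dense_span_tmul (f := k.toAddMonoidHom.comp (AddMonoidHom.mulLeft (tmul a b)))
      (g := (AddMonoidHom.mulLeft (k (tmul a b))).comp k.toAddMonoidHom)
      (hk.comp (continuous_const.mul continuous_id)) (continuous_const.mul hk) (fun a' b' => ?_) y
    change k (tmul a b * tmul a' b') = k (tmul a b) * k (tmul a' b')
    rw [tmul_mul, hk3, hk3, hk3, tmul_mul, ap_mul]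
  exact ⟨mkHom (A := tensor.{w, u} A B) (B := tensor.{w, u} A C)
    { toFun := k, map_smul' := map_smul k, map_zero' := map_zero k, map_add' := map_add k,
      map_mul' := hmul } hk, hk3⟩

end LCAlg

/-! ### The algebra D ⊗ 𝒯^∞ ⊗ 𝒯^∞ -/

namespace PimsnerSubalgebra
open LCAlg
variable {A E : Type u} [CStarAlgebra A] [PartialOrder A] [StarOrderedRing A]
    [NormedAddCommGroup E] [NormedSpace ℂ E] [Module Aᵐᵒᵖ E] [CStarModule Aᵐᵒᵖ E]
    {c : Correspondence A E} (P : PimsnerSubalgebra c)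

/-- The generators of the Toeplitz algebra. -/
def gens : Set P.DT := {x | ∃ a ∈ P.calASub, x = P.pure a SmoothToeplitz.one} ∪
    (Set.range fun ξ => P.pure (P.S ξ) SmoothToeplitz.S) ∪
    (Set.range fun ξ => P.pure (P.Sbar ξ) SmoothToeplitz.Sbar)

theorem gens_subset : P.gens ⊆ P.toeplitzSub := fun _ hx =>
  NonUnitalSubalgebra.le_topologicalClosure _ (NonUnitalAlgebra.subset_adjoin ℂ hx)

variable {P} in
theorem forall_gens {p : P.DT → Prop} (h1 : ∀ a ∈ P.calASub, p (P.pure a SmoothToeplitz.one))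
    (h2 : ∀ ξ, p (P.pure (P.S ξ) SmoothToeplitz.S))
    (h3 : ∀ ξ, p (P.pure (P.Sbar ξ) SmoothToeplitz.Sbar)) : ∀ x ∈ P.gens, p x := by
  rintro x ((⟨a, ha, rfl⟩ | ⟨ξ, rfl⟩) | ⟨ξ, rfl⟩)
  · exact h1 a ha
  · exact h2 ξ
  · exact h3 ξ

/-- The unit of `D ⊗ 𝒯^∞`. -/
noncomputable def unit : P.DT := P.pure P.one SmoothToeplitz.one

theorem unit_mul (x : P.DT) : P.unit * x = x := tensor_one_mul P.one_mul SmoothToeplitz.one_mul' x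

theorem mul_unit (x : P.DT) : x * P.unit = x := tensor_mul_one P.mul_one SmoothToeplitz.mul_one' x

/-- `D ⊗ 𝒯^∞ ⊗ 𝒯^∞`. -/
noncomputable abbrev DTT : LCAlg.{u} := tensor.{u, 0} P.DT SmoothToeplitz.alg

/-- The element `x ⊗ s` of `(D ⊗ 𝒯^∞) ⊗ 𝒯^∞`. -/
noncomputable def bipure (x : P.DT) (s : SmoothToeplitz) : P.DTT :=
  tmul.{u, 0} x (show SmoothToeplitz.alg from s)

theorem bipure_mul (x y : P.DT) (s t : SmoothToeplitz) :
    P.bipure x s * P.bipure y t = P.bipure (x * y) (s * t) := tmul_mul x y _ _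

theorem bipure_add (x : P.DT) (s t : SmoothToeplitz) :
    P.bipure x (s + t) = P.bipure x s + P.bipure x t := tmul_add x _ _

theorem bipure_sub (x : P.DT) (s t : SmoothToeplitz) :
    P.bipure x (s - t) = P.bipure x s - P.bipure x t := tmul_sub x _ _

theorem pure_sub (d : P.D) (s t : SmoothToeplitz) :
    P.pure d (s - t) = P.pure d s - P.pure d t := tmul_sub d _ _

theorem unit_bipure_mul (y : P.DTT) : P.bipure P.unit SmoothToeplitz.one * y = y :=
  tensor_one_mul P.unit_mul SmoothToeplitz.one_mul' y

theorem mul_unit_bipure (y : P.DTT) : y * P.bipure P.unit SmoothToeplitz.one = y :=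
  tensor_mul_one P.mul_unit SmoothToeplitz.mul_one' y

/-- `d ↦ d ⊗ 1`. -/
noncomputable def inD : P.D ⟶ P.DT :=
  tmulRight.{u, 0} (B := SmoothToeplitz.alg) P.D SmoothToeplitz.one (SmoothToeplitz.one_mul' _)

/-- `x ↦ x ⊗ 1`. -/
noncomputable def inDT : P.DT ⟶ P.DTT :=
  tmulRight.{u, 0} (B := SmoothToeplitz.alg) P.DT SmoothToeplitz.one (SmoothToeplitz.one_mul' _)

/-- The morphism `d ⊗ s ↦ d ⊗ 1 ⊗ s`. -/
theorem exists_theta : ∃ θ : P.DT ⟶ P.DTT, ∀ d s,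
    ap θ (P.pure d s) = P.bipure (P.pure d SmoothToeplitz.one) s := by
  obtain ⟨θ, h⟩ := exists_tensorLiftHom (A := P.D) (B := SmoothToeplitz.alg) (Y := P.DTT)
    (P.inD ≫ P.inDT).toAlgHom (P.inD ≫ P.inDT).cont
    (tmulLeftAlgHom P.unit (P.unit_mul _) SmoothToeplitz.alg)
    (continuous_tmul.comp (continuous_const.prodMk continuous_id)) (fun d s => by
      change P.bipure (P.pure d SmoothToeplitz.one) SmoothToeplitz.one * P.bipure P.unit s =
        P.bipure P.unit s * P.bipure (P.pure d SmoothToeplitz.one) SmoothToeplitz.one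
      rw [bipure_mul, bipure_mul, P.unit_mul, P.mul_unit, SmoothToeplitz.one_mul',
        SmoothToeplitz.mul_one'])
  refine ⟨θ, fun d s => (h d s).trans ?_⟩
  change P.bipure (P.pure d SmoothToeplitz.one) SmoothToeplitz.one * P.bipure P.unit s = _
  rw [bipure_mul, P.mul_unit, SmoothToeplitz.one_mul']

/-- The morphism `d ⊗ s ↦ d ⊗ 1 ⊗ s`. -/
noncomputable def θ : P.DT ⟶ P.DTT := P.exists_theta.choose

theorem θ_pure (d : P.D) (s : SmoothToeplitz) :
    ap P.θ (P.pure d s) = P.bipure (P.pure d SmoothToeplitz.one) s := P.exists_theta.choose_spec d s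

theorem npw_right (s : SmoothToeplitz) (n : ℕ) :
    SmoothToeplitz.npw (P.bipure P.unit SmoothToeplitz.one) (P.bipure P.unit s) n =
      P.bipure P.unit (SmoothToeplitz.npw SmoothToeplitz.one s n) := by
  induction n with
  | zero => rfl
  | succ n ih =>
    change P.bipure P.unit s * SmoothToeplitz.npw _ _ n = _
    rw [ih, bipure_mul, P.unit_mul]; rfl

theorem npw_left (s : SmoothToeplitz) (n : ℕ) :
    SmoothToeplitz.npw (P.bipure P.unit SmoothToeplitz.one)
      (P.bipure (P.pure P.one s) SmoothToeplitz.one) n =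
      P.bipure (P.pure P.one (SmoothToeplitz.npw SmoothToeplitz.one s n)) SmoothToeplitz.one := by
  induction n with
  | zero => rfl
  | succ n ih =>
    change P.bipure (P.pure P.one s) SmoothToeplitz.one * SmoothToeplitz.npw _ _ n = _
    rw [ih, bipure_mul, pure_mul, P.one_mul, SmoothToeplitz.one_mul']; rfl

theorem growth_right {x : ℕ → SmoothToeplitz.alg} (h : PolyGrowth (fun n => 1 + n) x) :
    PolyGrowth (fun n => 1 + n) fun n => P.bipure P.unit (x n) :=
  h.map (tmulBilin P.DT SmoothToeplitz.alg P.unit)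
    (continuous_tmul.comp (continuous_const.prodMk continuous_id))

theorem growth_left {x : ℕ → SmoothToeplitz.alg} (h : PolyGrowth (fun n => 1 + n) x) :
    PolyGrowth (fun n => 1 + n) fun n => P.bipure (P.pure P.one (x n)) SmoothToeplitz.one :=
  (h.map (tmulBilin P.D SmoothToeplitz.alg P.one)
    (continuous_tmul.comp (continuous_const.prodMk continuous_id))).map
    (P.inDT.toAlgHom : P.DT →ₗ[ℂ] P.DTT) P.inDT.cont

end PimsnerSubalgebra

/-! ### Powers of the shift and its products with e -/

namespace SmoothToeplitz
open LCAlg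

theorem npw_S (n : ℕ) : npw one S n = zp n := by
  induction n with
  | zero => exact zp_zero.symm
  | succ n ih => rw [npw, ih, S_mul_zp_nat]

theorem npw_Sbar (n : ℕ) : npw one Sbar n = zp (-(n : ℤ)) := by
  induction n with
  | zero => exact zp_zero.symm
  | succ n ih => rw [npw, ih, Sbar_mul_zp]; congr 1; push_cast; ring

theorem growth_npw_S : PolyGrowth (fun n => 1 + n) fun n => (npw one S n : alg) := by
  simpa only [npw_S] using growth_zp_nat

theorem growth_npw_Sbar : PolyGrowth (fun n => 1 + n) fun n => (npw one Sbar n : alg) := by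
  simpa only [npw_Sbar] using growth_zp_neg

theorem S_mul_e : S * e = mu 1 0 := by rw [e_eq_mu, S_mul_mu]
theorem e_mul_Sbar : e * Sbar = mu 0 1 := by rw [e_eq_mu, mu_mul_Sbar]
theorem e_mul_S : e * S = 0 := by rw [e_eq_mu, mu_zero_mul_S]
theorem Sbar_mul_e : Sbar * e = 0 := by rw [e_eq_mu, Sbar_mul_mu_zero]

theorem S_mul_S_mul_Sbar : S * S * Sbar = S - mu 1 0 := by
  rw [← S_mul_e, e, mul_sub, mul_one', mul_assoc, sub_sub_cancel]

theorem S_mul_Sbar_mul_Sbar : S * Sbar * Sbar = Sbar - mu 0 1 := by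
  rw [← e_mul_Sbar, e, sub_mul, one_mul', sub_sub_cancel]

end SmoothToeplitz

/-! ### The rotation path on D ⊗ 𝒯^∞ -/

namespace PimsnerSubalgebra
open LCAlg
variable {A E : Type u} [CStarAlgebra A] [PartialOrder A] [StarOrderedRing A]
    [NormedAddCommGroup E] [NormedSpace ℂ E] [Module Aᵐᵒᵖ E] [CStarModule Aᵐᵒᵖ E]
    {c : Correspondence A E} (P : PimsnerSubalgebra c)

/-- A path of morphisms that starts at `θ` and moves the first column of the Toeplitz algebra into
the inner factor. -/
theorem exists_rotation_path : ∃ (Φ : P.DT ⟶ Z P.DTT) (a a' b : ℝ → ℂ),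
    (a 0 = 1 ∧ a' 0 = 1 ∧ b 0 = 0 ∧ a 1 = 0 ∧ a' 1 = 0 ∧ b 1 = 1) ∧
    (∀ d (t : I), (ap Φ (P.pure d SmoothToeplitz.one)).1 0 t =
      P.bipure (P.pure d SmoothToeplitz.one) SmoothToeplitz.one) ∧
    (∀ d (t : I), (ap Φ (P.pure d SmoothToeplitz.S)).1 0 t =
      P.bipure (P.pure d SmoothToeplitz.one) (SmoothToeplitz.S - SmoothToeplitz.mu 1 0) +
      a t • P.bipure (P.pure d SmoothToeplitz.one) (SmoothToeplitz.mu 1 0) +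
      b t • P.bipure (P.pure d SmoothToeplitz.S) (SmoothToeplitz.mu 0 0)) ∧
    ∀ d (t : I), (ap Φ (P.pure d SmoothToeplitz.Sbar)).1 0 t =
      P.bipure (P.pure d SmoothToeplitz.one) (SmoothToeplitz.Sbar - SmoothToeplitz.mu 0 1) +
      a' t • P.bipure (P.pure d SmoothToeplitz.one) (SmoothToeplitz.mu 0 1) +
      b t • P.bipure (P.pure d SmoothToeplitz.Sbar) (SmoothToeplitz.mu 0 0) := by
  obtain ⟨a, a', b, fa, fa', fb, hab, hb, h0⟩ := SmoothToeplitz.exists_flat_rotation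
  have hu : P.unit = P.pure P.one SmoothToeplitz.one := rfl
  -- The commuting isometries are the two shifts: ρ acts in the outer factor 𝒯^∞ and τ in the inner
  -- one.
  obtain ⟨f, hf, f1, fS, fSbar⟩ := SmoothToeplitz.exists_twisted_path (X := P.DTT)
    (o := P.bipure P.unit SmoothToeplitz.one)
    (ρ := P.bipure P.unit SmoothToeplitz.S) (ρ' := P.bipure P.unit SmoothToeplitz.Sbar)
    (τ := P.bipure (P.pure P.one SmoothToeplitz.S) SmoothToeplitz.one)
    (τ' := P.bipure (P.pure P.one SmoothToeplitz.Sbar) SmoothToeplitz.one)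
    P.unit_bipure_mul P.mul_unit_bipure
    (by rw [bipure_mul, P.unit_mul, SmoothToeplitz.Sbar_mul_S])
    (by rw [bipure_mul, pure_mul, P.one_mul, SmoothToeplitz.Sbar_mul_S, SmoothToeplitz.one_mul',
      hu])
    (by rw [bipure_mul, bipure_mul, P.unit_mul, P.mul_unit, SmoothToeplitz.one_mul',
      SmoothToeplitz.mul_one'])
    (by rw [bipure_mul, bipure_mul, P.unit_mul, P.mul_unit, SmoothToeplitz.one_mul',
      SmoothToeplitz.mul_one'])
    (by rw [bipure_mul, bipure_mul, P.unit_mul, P.mul_unit, SmoothToeplitz.one_mul',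
      SmoothToeplitz.mul_one'])
    (by rw [bipure_mul, bipure_mul, P.unit_mul, P.mul_unit, SmoothToeplitz.one_mul',
      SmoothToeplitz.mul_one'])
    (by rw [funext (P.npw_right _)]; exact P.growth_right SmoothToeplitz.growth_npw_S)
    (by rw [funext (P.npw_right _)]; exact P.growth_right SmoothToeplitz.growth_npw_Sbar)
    (by rw [funext (P.npw_left _)]; exact P.growth_left SmoothToeplitz.growth_npw_S)
    (by rw [funext (P.npw_left _)]; exact P.growth_left SmoothToeplitz.growth_npw_Sbar)
    fa fa' fb hab hb
  have hε : P.bipure P.unit SmoothToeplitz.one -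
      P.bipure P.unit SmoothToeplitz.S * P.bipure P.unit SmoothToeplitz.Sbar =
      P.bipure P.unit SmoothToeplitz.e := by
    rw [bipure_mul, P.unit_mul, ← bipure_sub]; rfl
  -- Here o - ρ ρ' is the outer e. Hence ρ ρ ρ' is the outer S without its first column, ρ (o - ρ
  -- ρ') is that column e_{10}, and (o - ρ ρ') τ is the inner shift at position e_{00}.
  have fS' : ∀ t : I, (f SmoothToeplitz.S).1 0 t =
      P.bipure P.unit (SmoothToeplitz.S - SmoothToeplitz.mu 1 0) +
      a t • P.bipure P.unit (SmoothToeplitz.mu 1 0) +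
      b t • P.bipure (P.pure P.one SmoothToeplitz.S) (SmoothToeplitz.mu 0 0) := fun t => by
    rw [fS, hε, bipure_mul, bipure_mul, bipure_mul, bipure_mul, P.unit_mul, P.unit_mul, P.unit_mul,
      SmoothToeplitz.S_mul_S_mul_Sbar, SmoothToeplitz.S_mul_e, SmoothToeplitz.mul_one',
      SmoothToeplitz.e_eq_mu]
  have fSbar' : ∀ t : I, (f SmoothToeplitz.Sbar).1 0 t =
      P.bipure P.unit (SmoothToeplitz.Sbar - SmoothToeplitz.mu 0 1) +
      a' t • P.bipure P.unit (SmoothToeplitz.mu 0 1) +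
      b t • P.bipure (P.pure P.one SmoothToeplitz.Sbar) (SmoothToeplitz.mu 0 0) := fun t => by
    rw [fSbar, hε, bipure_mul, bipure_mul, bipure_mul, bipure_mul, P.unit_mul, P.unit_mul,
      P.unit_mul, SmoothToeplitz.S_mul_Sbar_mul_Sbar, SmoothToeplitz.e_mul_Sbar,
      SmoothToeplitz.mul_one', SmoothToeplitz.e_eq_mu]
  have hcomm : ∀ (d : P.D) (x : P.D) (hx : d * x = x * d) (s s' : SmoothToeplitz),
      Commute (P.bipure (P.pure d SmoothToeplitz.one) SmoothToeplitz.one)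
        (P.bipure (P.pure x s) s') := fun d x hx s s' => by
    rw [Commute, SemiconjBy, bipure_mul, bipure_mul, pure_mul, pure_mul, hx,
      SmoothToeplitz.one_mul', SmoothToeplitz.one_mul', SmoothToeplitz.mul_one',
      SmoothToeplitz.mul_one']
  have h1d : ∀ d : P.D, d * P.one = P.one * d := fun d => by rw [P.mul_one, P.one_mul]
  -- The path on 𝒯^∞ involves only the unit of D, so it commutes with d ⊗ 1 ⊗ 1; this is checked on
  -- the generators 1, S, S̄.
  have hfc : ∀ (d : P.D) (s : SmoothToeplitz) (t : I),
      Commute (P.bipure (P.pure d SmoothToeplitz.one) SmoothToeplitz.one) ((f s).1 0 t) := by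
    intro d s t
    let g : SmoothToeplitz.alg →ₙₐ[ℂ] P.DTT := (ev P.DTT t).toAlgHom.comp f
    have hg : Continuous g := (ev P.DTT t).cont.comp hf
    let V : NonUnitalSubalgebra ℂ SmoothToeplitz :=
      { carrier := {s | Commute (P.bipure (P.pure d SmoothToeplitz.one) SmoothToeplitz.one) (g s)}
        add_mem' := fun {x y} hx hy => by
          change Commute _ (g (x + y))
          rw [map_add g]; exact Commute.add_right hx hy
        zero_mem' := by
          change Commute _ (g 0)
          rw [map_zero g]; exact Commute.zero_right _
        mul_mem' := fun {x y} hx hy => by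
          change Commute _ (g (x * y))
          rw [map_mul g]; exact Commute.mul_right hx hy
        smul_mem' := fun z x hx => by
          change Commute _ (g (z • x))
          rw [map_smul g]; exact Commute.smul_right hx z }
    refine SmoothToeplitz.mem_of_generators (V := V)
      (isClosed_eq (continuous_const.mul hg) (hg.mul continuous_const)) ?_ ?_ ?_ s
    · change Commute _ ((f SmoothToeplitz.one).1 0 t)
      rw [f1]; exact hcomm d _ (h1d d) _ _
    · change Commute _ ((f SmoothToeplitz.S).1 0 t)
      rw [fS']
      exact ((hcomm d _ (h1d d) _ _).add_right ((hcomm d _ (h1d d) _ _).smul_right _)).add_right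
        ((hcomm d _ (h1d d) _ _).smul_right _)
    · change Commute _ ((f SmoothToeplitz.Sbar).1 0 t)
      rw [fSbar']
      exact ((hcomm d _ (h1d d) _ _).add_right ((hcomm d _ (h1d d) _ _).smul_right _)).add_right
        ((hcomm d _ (h1d d) _ _).smul_right _)
  -- Because the two families commute, d ⊗ s ↦ (d ⊗ 1 ⊗ 1) f(s) defines a homomorphism on the tensor
  -- product, with d sent to a constant path.
  obtain ⟨Φ, hΦ⟩ := exists_tensorLiftHom (A := P.D) (B := SmoothToeplitz.alg) (Y := Z P.DTT)
    ((P.inD ≫ P.inDT) ≫ constPath P.DTT).toAlgHom ((P.inD ≫ P.inDT) ≫ constPath P.DTT).cont f hf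
    (fun d s => Z_ext fun t => by
      rw [Z_mul_apply, Z_mul_apply]
      have : ((((P.inD ≫ P.inDT) ≫ constPath P.DTT).toAlgHom d : Z P.DTT)).1 0 t =
          P.bipure (P.pure d SmoothToeplitz.one) SmoothToeplitz.one := constPath_apply _ t
      rw [this]
      exact hfc d s t)
  have hΦ' : ∀ d s (t : I), (ap Φ (P.pure d s)).1 0 t =
      P.bipure (P.pure d SmoothToeplitz.one) SmoothToeplitz.one * (f s).1 0 t := fun d s t => by
    have h2 : ap Φ (P.pure d s) = _ := hΦ d s
    rw [h2, Z_mul_apply]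
    have : ((((P.inD ≫ P.inDT) ≫ constPath P.DTT).toAlgHom d : Z P.DTT)).1 0 t =
          P.bipure (P.pure d SmoothToeplitz.one) SmoothToeplitz.one := constPath_apply _ t
    rw [this]
  have hp : ∀ d (s : SmoothToeplitz), P.pure d SmoothToeplitz.one * P.pure P.one s = P.pure d s :=
    fun d s => by rw [pure_mul, P.mul_one, SmoothToeplitz.one_mul']
  refine ⟨Φ, a, a', b, h0, fun d t => ?_, fun d t => ?_, fun d t => ?_⟩
  · rw [hΦ', f1, P.mul_unit_bipure]
  · rw [hΦ', fS', mul_add, mul_add, mul_smul_comm, mul_smul_comm, bipure_mul, bipure_mul,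
      bipure_mul, P.mul_unit, hp, SmoothToeplitz.one_mul', SmoothToeplitz.one_mul',
      SmoothToeplitz.one_mul']
  · rw [hΦ', fSbar', mul_add, mul_add, mul_smul_comm, mul_smul_comm, bipure_mul, bipure_mul,
      bipure_mul, P.mul_unit, hp, SmoothToeplitz.one_mul', SmoothToeplitz.one_mul',
      SmoothToeplitz.one_mul']

end PimsnerSubalgebra

/-! ### The quasihomomorphism with values in compact matrices -/

namespace PimsnerSubalgebra
open LCAlg
variable {A E : Type u} [CStarAlgebra A] [PartialOrder A] [StarOrderedRing A]
    [NormedAddCommGroup E] [NormedSpace ℂ E] [Module Aᵐᵒᵖ E] [CStarModule Aᵐᵒᵖ E]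
    {c : Correspondence A E} {P : PimsnerSubalgebra c}

variable (P) in
/-- The morphism `Ad(1 ⊗ S)` of `D ⊗ 𝒯^∞`. -/
noncomputable def shift : P.DT ⟶ P.DT :=
  LCAlg.ad (P.pure P.one SmoothToeplitz.S) (P.pure P.one SmoothToeplitz.Sbar) (fun x => by
    rw [pure_mul, SmoothToeplitz.Sbar_mul_S, P.one_mul]
    exact tensor_one_mul P.one_mul SmoothToeplitz.one_mul' x)

variable (P) in
theorem shift_pure (d : P.D) (s : SmoothToeplitz) :
    ap P.shift (P.pure d s) = P.pure d (SmoothToeplitz.S * s * SmoothToeplitz.Sbar) := by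
  change P.pure P.one SmoothToeplitz.S * P.pure d s * P.pure P.one SmoothToeplitz.Sbar = _
  rw [pure_mul, pure_mul, P.one_mul, P.mul_one]

variable (P) in
/-- The morphism `x ↦ x ⊗ e`. -/
noncomputable def corner : P.DT ⟶ P.DTT :=
  tmulRight.{u, 0} (B := SmoothToeplitz.alg) P.DT SmoothToeplitz.e e_mul_e

variable (P) in
theorem θ_shift (x : P.DT) : ap P.θ (ap P.shift x) =
    P.bipure P.unit SmoothToeplitz.S * ap P.θ x * P.bipure P.unit SmoothToeplitz.Sbar := by
  change ap P.θ (P.pure P.one SmoothToeplitz.S * x * P.pure P.one SmoothToeplitz.Sbar) = _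
  rw [ap_mul, ap_mul, θ_pure, θ_pure]; rfl

variable (P) in
-- The image of the shift ends in the outer S̄, and S̄ e = 0.
theorem shift_mul_corner (x y : P.DT) : ap (P.shift ≫ P.θ) x * ap P.corner y = 0 := by
  change ap P.θ (ap P.shift x) * P.bipure y SmoothToeplitz.e = 0
  rw [θ_shift, mul_assoc, bipure_mul, SmoothToeplitz.Sbar_mul_e]
  exact (congrArg _ (tmul_zero (P.unit * y))).trans (mul_zero _)

variable (P) in
theorem corner_mul_shift (x y : P.DT) : ap P.corner x * ap (P.shift ≫ P.θ) y = 0 := by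
  change P.bipure x SmoothToeplitz.e * ap P.θ (ap P.shift y) = 0
  rw [θ_shift, ← mul_assoc, ← mul_assoc, bipure_mul, SmoothToeplitz.e_mul_S]
  have h : P.bipure (x * P.unit) 0 = 0 := tmul_zero _
  rw [h, zero_mul, zero_mul]

namespace TameFamily
variable (T : P.TameFamily)

/-- The frame over `𝒜` in `D`. -/
noncomputable def frameD : Frame P.D :=
  T.frame (𝟙 P.D) P.calASub P.isClosed_calASub P.one_mul P.mul_one

/-- The frame over `𝒯^∞_D` in `D ⊗ 𝒯^∞`. -/
noncomputable def frameDT : Frame P.DT :=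
  T.frame P.inD P.toeplitzSub P.isClosed_toeplitzSub P.unit_mul P.mul_unit

theorem inD_mem (a : P.D) (ha : a ∈ P.calASub) : ap P.inD a ∈ P.toeplitzSub :=
  P.gens_subset (Or.inl (Or.inl ⟨a, ha, rfl⟩))

/-- On generators the difference is a ⊗ e_{00}, S_ξ ⊗ e_{10} or S̄_ξ ⊗ e_{01}, elementary matrices
whose coefficients have the right degrees. `Frame.diff_mem` extends this to the closed algebra they
generate. -/
theorem sub_shift_mem {x : P.DT} (hx : x ∈ P.toeplitzSub) :
    x ∈ T.frameD.multipliers ∧ x - ap P.shift x ∈ T.frameD.compact := by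
  have g1 := fun {a : P.D} (ha : a ∈ P.calASub) => T.good_calA (𝟙 P.D) P.calASub
    P.isClosed_calASub P.one_mul P.mul_one (fun _ h => h) ha
  have g2 := T.good_S (𝟙 P.D) P.calASub P.isClosed_calASub P.one_mul P.mul_one (fun _ h => h)
  have g3 := T.good_Sbar (𝟙 P.D) P.calASub P.isClosed_calASub P.one_mul P.mul_one (fun _ h => h)
  refine T.frameD.diff_mem (𝟙 P.DT) P.shift (s := P.gens) (forall_gens ?_ ?_ ?_) hx
  · intro a ha
    refine ⟨T.frameD.tmul_one_mem (g1 ha), ?_⟩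
    change P.pure a SmoothToeplitz.one - ap P.shift (P.pure a SmoothToeplitz.one) ∈ _
    rw [shift_pure, SmoothToeplitz.mul_one', ← pure_sub]
    change P.pure a SmoothToeplitz.e ∈ _
    rw [SmoothToeplitz.e_eq_mu]
    exact T.frameD.elem_mem (g1 ha 0)
  · intro ξ
    refine ⟨T.frameD.tmul_S_mem (g2 ξ), ?_⟩
    change P.pure (P.S ξ) SmoothToeplitz.S - ap P.shift (P.pure (P.S ξ) SmoothToeplitz.S) ∈ _
    rw [shift_pure, SmoothToeplitz.S_mul_S_mul_Sbar, ← pure_sub, sub_sub_cancel]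
    exact T.frameD.elem_mem (g2 ξ 0)
  · intro ξ
    refine ⟨T.frameD.tmul_Sbar_mem (g3 ξ), ?_⟩
    change P.pure (P.Sbar ξ) SmoothToeplitz.Sbar -
      ap P.shift (P.pure (P.Sbar ξ) SmoothToeplitz.Sbar) ∈ _
    rw [shift_pure, SmoothToeplitz.S_mul_Sbar_mul_Sbar, ← pure_sub, sub_sub_cancel]
    exact T.frameD.elem_mem (g3 ξ 0)

/-- By minimality of C: the compact matrices contain all differences α(x) - ᾱ(x) and are stable
under 𝒯^∞_D, which acts by multipliers. -/
theorem quasi_le : P.quasi.B ≤ T.frameD.compact := by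
  refine sInf_le ⟨T.frameD.isClosed_compact, ?_, ?_⟩
  · rintro _ ⟨x, rfl⟩
    exact (T.sub_shift_mem x.2).2
  · rintro _ ⟨x, rfl⟩ y hy
    exact (T.sub_shift_mem x.2).1 y hy

/-- The inclusion of `C` in the compact matrices. -/
noncomputable def inclC : P.C ⟶ T.frameD.cpt :=
  codRestrict (LCAlg.incl P.DT P.quasi.B P.quasi.isClosed) T.frameD.compact
    T.frameD.isClosed_compact fun x => T.quasi_le x.2

theorem good_inD {b : P.D} {n m : ℕ} (h : T.frameD.Good b n m) :
    T.frameDT.Good (ap P.inD b) n m := by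
  intro i j hi hj
  have := inD_mem _ (h i j hi hj)
  rw [ap_mul, ap_mul] at this
  exact this

theorem θ_elem (b : P.D) (n m : ℕ) :
    ap P.θ (T.frameD.elem b n m) = T.frameDT.elem (ap P.inD b) n m := P.θ_pure b _

theorem θ_mem {x : P.DT} (hx : x ∈ T.frameD.compact) : ap P.θ x ∈ T.frameDT.compact := by
  refine T.frameD.compact_le
    (V := T.frameDT.compact.toSubmodule.comap (P.θ.toAlgHom : P.DT →ₗ[ℂ] P.DTT))
    (T.frameDT.isClosed_compact.preimage (ap_continuous P.θ)) (fun b n m hb => ?_) hx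
  change ap P.θ (T.frameD.elem b n m) ∈ T.frameDT.compact
  rw [θ_elem]
  exact T.frameDT.elem_mem (T.good_inD hb)

/-- The restriction of `θ` to the compact matrices. -/
noncomputable def θcpt : T.frameD.cpt ⟶ T.frameDT.cpt :=
  codRestrict (LCAlg.incl P.DT T.frameD.compact T.frameD.isClosed_compact ≫ P.θ)
    T.frameDT.compact T.frameDT.isClosed_compact fun x => T.θ_mem x.2

/-- The element x ⊗ e is the elementary matrix at position (0, 0), where the condition on the
coefficient is x ∈ 𝒯^∞_D. -/
theorem corner_mem {x : P.DT} (hx : x ∈ P.toeplitzSub) : ap P.corner x ∈ T.frameDT.compact := by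
  have h : ap P.corner x = T.frameDT.elem x 0 0 := by
    change P.bipure x SmoothToeplitz.e = P.bipure x (SmoothToeplitz.mu 0 0)
    rw [SmoothToeplitz.e_eq_mu]
  rw [h]
  exact T.frameDT.elem_mem (T.frameDT.good_zero_zero hx)

/-- The inclusion `x ↦ x ⊗ e` of the corner. -/
noncomputable def cornerCpt : P.toeplitz ⟶ T.frameDT.cpt :=
  codRestrict (P.α ≫ P.corner) T.frameDT.compact T.frameDT.isClosed_compact
    fun x => T.corner_mem x.2

/-- The path joins `θ` to `θ ∘ Ad(1 ⊗ S) ⊕ corner`, up to compact matrices. -/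
theorem exists_path : ∃ Φ : P.DT ⟶ Z P.DTT, ∀ x ∈ P.toeplitzSub,
    (∀ t : I, ap P.θ x ∈ T.frameDT.multipliers ∧
      ap P.θ x - (ap Φ x).1 0 t ∈ T.frameDT.compact) ∧
    (ap Φ x).1 0 0 = ap P.θ x ∧
    (ap Φ x).1 0 1 = ap P.θ (ap P.shift x) + ap P.corner x := by
  obtain ⟨Φ, a, a', b, ⟨ha0, ha0', hb0, ha1, ha1', hb1⟩, h1, h2, h3⟩ := P.exists_rotation_path
  have g1 := fun {a : P.D} (ha : a ∈ P.calASub) => T.good_calA P.inD P.toeplitzSub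
    P.isClosed_toeplitzSub P.unit_mul P.mul_unit inD_mem ha
  have g2 := T.good_S P.inD P.toeplitzSub P.isClosed_toeplitzSub P.unit_mul P.mul_unit inD_mem
  have g3 := T.good_Sbar P.inD P.toeplitzSub P.isClosed_toeplitzSub P.unit_mul P.mul_unit inD_mem
  refine ⟨Φ, fun x hx => ⟨fun t => ?_, ?_, ?_⟩⟩
  · refine T.frameDT.diff_mem P.θ (Φ ≫ P.DTT.ev t) (s := P.gens) (forall_gens ?_ ?_ ?_) hx
    · intro d hd
      change _ ∧ _ - (ap Φ _).1 0 t ∈ _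
      rw [h1, θ_pure, sub_self]
      exact ⟨T.frameDT.tmul_one_mem (g1 hd), T.frameDT.compact.zero_mem⟩
    · intro ξ
      change _ ∧ _ - (ap Φ _).1 0 t ∈ _
      rw [h2, θ_pure]
      refine ⟨T.frameDT.tmul_S_mem (g2 ξ), ?_⟩
      -- The path moves S_ξ ⊗ 1 ⊗ S only by multiples of S_ξ ⊗ 1 ⊗ e_{10} and S_ξ ⊗ S ⊗ e_{00}. The
      -- second is compact because S_ξ ⊗ S belongs to the coefficient algebra 𝒯^∞_D, which is why
      -- the coefficients are taken there and not in 𝒜.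
      have m1 : P.bipure (P.pure (P.S ξ) SmoothToeplitz.one) (SmoothToeplitz.mu 1 0) ∈
        T.frameDT.compact := T.frameDT.elem_mem (g2 ξ 0)
      have m2 : P.bipure (P.pure (P.S ξ) SmoothToeplitz.S) (SmoothToeplitz.mu 0 0) ∈
        T.frameDT.compact :=
        T.frameDT.elem_mem (T.frameDT.good_zero_zero (P.gens_subset (Or.inl (Or.inr ⟨ξ, rfl⟩))))
      rw [bipure_sub, sub_add, sub_add, sub_sub_cancel, sub_sub]
      exact sub_mem m1 (add_mem (T.frameDT.compact.smul_mem _ m1)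
        (T.frameDT.compact.smul_mem _ m2))
    · intro ξ
      change _ ∧ _ - (ap Φ _).1 0 t ∈ _
      rw [h3, θ_pure]
      refine ⟨T.frameDT.tmul_Sbar_mem (g3 ξ), ?_⟩
      have m1 : P.bipure (P.pure (P.Sbar ξ) SmoothToeplitz.one) (SmoothToeplitz.mu 0 1) ∈
        T.frameDT.compact := T.frameDT.elem_mem (g3 ξ 0)
      have m2 : P.bipure (P.pure (P.Sbar ξ) SmoothToeplitz.Sbar) (SmoothToeplitz.mu 0 0) ∈
        T.frameDT.compact :=
        T.frameDT.elem_mem (T.frameDT.good_zero_zero (P.gens_subset (Or.inr ⟨ξ, rfl⟩)))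
      rw [bipure_sub, sub_add, sub_add, sub_sub_cancel, sub_sub]
      exact sub_mem m1 (add_mem (T.frameDT.compact.smul_mem _ m1)
        (T.frameDT.compact.smul_mem _ m2))
  · refine eq_of_generators (Φ ≫ P.DTT.ev 0) P.θ (s := P.gens) (forall_gens ?_ ?_ ?_) hx
    · intro d _
      change (ap Φ _).1 0 0 = _
      rw [h1, θ_pure]
    · intro ξ
      change (ap Φ _).1 0 0 = _
      rw [h2, θ_pure, Set.Icc.coe_zero, ha0, hb0, one_smul, zero_smul, add_zero, bipure_sub,
        sub_add_cancel]
    · intro ξ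
      change (ap Φ _).1 0 0 = _
      rw [h3, θ_pure, Set.Icc.coe_zero, ha0', hb0, one_smul, zero_smul, add_zero, bipure_sub,
        sub_add_cancel]
  -- At t = 1 the column e_{10} has been replaced by the corner, leaving S_ξ ⊗ 1 ⊗ S S S̄ + S_ξ ⊗ S
  -- ⊗ e; on a ⊗ 1 the identity is 1 = S S̄ + e.
  · refine eq_add_of_generators (Φ ≫ P.DTT.ev 1) (P.shift ≫ P.θ) P.corner P.shift_mul_corner
      P.corner_mul_shift (s := P.gens) (forall_gens ?_ ?_ ?_) hx
    · intro d _
      change (ap Φ _).1 0 1 = ap P.θ (ap P.shift _) +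
        P.bipure (P.pure d SmoothToeplitz.one) SmoothToeplitz.e
      rw [h1, shift_pure, θ_pure, ← bipure_add, SmoothToeplitz.mul_one', SmoothToeplitz.e,
        add_sub_cancel]
    · intro ξ
      change (ap Φ _).1 0 1 = ap P.θ (ap P.shift _) +
        P.bipure (P.pure (P.S ξ) SmoothToeplitz.S) SmoothToeplitz.e
      rw [h2, shift_pure, θ_pure, Set.Icc.coe_one, ha1, hb1, one_smul, zero_smul, add_zero,
        SmoothToeplitz.S_mul_S_mul_Sbar, SmoothToeplitz.e_eq_mu]
    · intro ξ
      change (ap Φ _).1 0 1 = ap P.θ (ap P.shift _) +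
        P.bipure (P.pure (P.Sbar ξ) SmoothToeplitz.Sbar) SmoothToeplitz.e
      rw [h3, shift_pure, θ_pure, Set.Icc.coe_one, ha1', hb1, one_smul, zero_smul, add_zero,
        SmoothToeplitz.S_mul_Sbar_mul_Sbar, SmoothToeplitz.e_eq_mu]

theorem θ_mem_multipliers {x : P.DT} (hx : x ∈ P.toeplitzSub) :
    ap P.θ x ∈ T.frameDT.multipliers := by
  obtain ⟨Φ, h⟩ := T.exists_path
  exact ((h x hx).1 0).1

/-- The quasihomomorphism `(θ ∘ α, θ ∘ ᾱ)` into the compact matrices. -/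
noncomputable def quasiDT : QuasiHom P.toeplitz P.DTT where
  B := T.frameDT.compact
  isClosed := T.frameDT.isClosed_compact
  α := P.α ≫ P.θ
  β := P.αbar ≫ P.θ
  sub_mem x := by
    have := T.θ_mem (T.sub_shift_mem x.2).2
    rw [ap_sub] at this
    exact this
  mul_mem_left x y hy := (T.θ_mem_multipliers x.2 y hy).1
  mul_mem_right x y hy := (T.θ_mem_multipliers x.2 y hy).2

/-- The morphism of extensions `(x, z) ↦ (x, θ z)`. -/
noncomputable def extMap : P.quasi.ext ⟶ T.quasiDT.ext :=
  codRestrict (mkHom (A := P.quasi.ext) (B := LCAlg.prod P.toeplitz P.DTT)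
    ((NonUnitalAlgHom.prod (NonUnitalAlgHom.fst ℂ P.toeplitz P.DT)
      (P.θ.toAlgHom.comp (NonUnitalAlgHom.snd ℂ P.toeplitz P.DT))).comp
        (NonUnitalSubalgebraClass.subtype P.quasi.extSub))
    ((continuous_fst.comp continuous_subtype_val).prodMk
      (P.θ.cont.comp (continuous_snd.comp continuous_subtype_val)))) _ T.quasiDT.isClosed_extSub (by
    intro p
    have := T.θ_mem (T.quasi_le p.2)
    rw [ap_sub] at this
    exact this)

theorem secα_extMap : P.quasi.secα ≫ T.extMap = T.quasiDT.secα := rfl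

theorem secβ_extMap : P.quasi.secβ ≫ T.extMap = T.quasiDT.secβ := rfl

/-- The inclusion of the compact matrices in the extension. -/
noncomputable def inclExt : T.frameDT.cpt ⟶ T.quasiDT.ext := T.quasiDT.extIncl

theorem extIncl_extMap :
    P.quasi.extIncl ≫ T.extMap = (T.inclC ≫ T.θcpt) ≫ T.inclExt := rfl

variable {H : LCAlg.{u} ⥤ AddCommGrpCat.{v}}

/-- The rotation path yields a path of sections of the extension, from the section of θ α to the
orthogonal sum of the section of θ ᾱ and the corner. Diffotopy invariance and additivity then give
the difference. -/
theorem map_quasiDT (hH : SplitExact H) (hd : DiffotopyInvariant H) :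
    H.map T.quasiDT.secα - H.map T.quasiDT.secβ =
      H.map (T.cornerCpt ≫ T.inclExt) := by
  obtain ⟨Φ, hΦ⟩ := T.exists_path
  -- The path x ↦ (x, Φ(x)(t)) stays in the extension because Φ(x)(t) differs from θ(x) by compact
  -- matrices for every t.
  let k : P.toeplitz ⟶ Z T.quasiDT.ext :=
    pathCodRestrict (B := LCAlg.prod P.toeplitz P.DTT) (pathPair (constPath P.toeplitz) (P.α ≫ Φ))
      T.quasiDT.extSub T.quasiDT.isClosed_extSub (fun x t => by
        change (ap Φ x.1).1 0 t - ap P.θ ((ap (constPath P.toeplitz) x).1 0 t).1 ∈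
          T.frameDT.compact
        rw [constPath_apply, ← neg_sub]
        exact neg_mem ((hΦ x.1 x.2).1 t).2)
  have h0 : k ≫ ev _ 0 = T.quasiDT.secα := hom_ext fun x =>
    Subtype.ext (Prod.ext (constPath_apply x 0) (hΦ x.1 x.2).2.1)
  have h1 : H.map (k ≫ ev _ 1) =
      H.map T.quasiDT.secβ + H.map (T.cornerCpt ≫ T.inclExt) := by
    refine hH.map_add _ _ _ (fun x => Subtype.ext (Prod.ext ?_ ?_))
      (fun x y => Subtype.ext (Prod.ext ?_ ?_)) (fun x y => Subtype.ext (Prod.ext ?_ ?_))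
    · exact (constPath_apply x 1).trans (add_zero x).symm
    · exact (hΦ x.1 x.2).2.2
    · exact mul_zero x
    · exact P.shift_mul_corner x.1 y.1
    · exact zero_mul y
    · exact P.corner_mul_shift x.1 y.1
  rw [← h0, H.map_comp, hd _ 0 1, ← H.map_comp, h1, add_sub_cancel_left]

/-- The two sides are compared in the extension, into which the compact matrices inject under H by
split exactness. There the left side becomes the difference of the two sections, since θ carries the
extension of (α, ᾱ) to that of (θ α, θ ᾱ). -/
theorem map_inclC_θcpt (hH : SplitExact H) (hd : DiffotopyInvariant H) :
    P.quasi.map H hH ≫ H.map (T.inclC ≫ T.θcpt) = H.map T.cornerCpt := by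
  have key : (P.quasi.map H hH ≫ H.map (T.inclC ≫ T.θcpt)) ≫ H.map T.inclExt =
      H.map T.cornerCpt ≫ H.map T.inclExt := by
    rw [← H.map_comp, ← T.map_quasiDT hH hd, Category.assoc, ← H.map_comp, ← T.extIncl_extMap,
      H.map_comp, ← Category.assoc, P.quasi.map_extIncl, Preadditive.sub_comp, ← H.map_comp,
      ← H.map_comp, T.secα_extMap, T.secβ_extMap]
  ext x
  exact (T.quasiDT.exact_of_splitExact hH).1 (ConcreteCategory.congr_hom key x)

end TameFamily

/-- Since a ⊗ 1 = a ⊗ S S̄ + a ⊗ e is an orthogonal decomposition, the section of α along ι is the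
sum of the section of ᾱ along ι and ι_C. No tameness is involved, so part (i) follows from this
alone. -/
theorem map_ι_quasi {H : LCAlg.{u} ⥤ AddCommGrpCat.{v}} (hH : SplitExact H) :
    H.map P.ι ≫ P.quasi.map H hH = H.map P.ιC := by
  have h1 : H.map (P.ι ≫ P.quasi.secα) =
      H.map (P.ι ≫ P.quasi.secβ) + H.map (P.ιC ≫ P.quasi.extIncl) := by
    have hβ : ∀ a : P.calA, ap P.αbar (ap P.ι a) =
        P.pure a.1 (SmoothToeplitz.S * SmoothToeplitz.Sbar) := fun a => by
      refine (P.shift_pure a.1 SmoothToeplitz.one).trans ?_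
      rw [SmoothToeplitz.mul_one']
    refine hH.map_add _ _ _ (fun x => Subtype.ext (Prod.ext ?_ ?_))
      (fun x y => Subtype.ext (Prod.ext ?_ ?_)) (fun x y => Subtype.ext (Prod.ext ?_ ?_))
    · exact (add_zero (ap P.ι x)).symm
    · change P.pure x.1 SmoothToeplitz.one = ap P.αbar (ap P.ι x) + P.pure x.1 SmoothToeplitz.e
      rw [hβ, SmoothToeplitz.e, pure_sub, add_sub_cancel]
    · exact mul_zero (ap P.ι x)
    · change ap P.αbar (ap P.ι x) * P.pure y.1 SmoothToeplitz.e = 0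
      rw [hβ, pure_mul, mul_assoc, SmoothToeplitz.Sbar_mul_e, mul_zero]
      exact tmul_zero _
    · exact zero_mul (ap P.ι y)
    · change P.pure x.1 SmoothToeplitz.e * ap P.αbar (ap P.ι y) = 0
      rw [hβ, pure_mul, ← mul_assoc, SmoothToeplitz.e_mul_S, zero_mul]
      exact tmul_zero _
  have key : (H.map P.ι ≫ P.quasi.map H hH) ≫ H.map P.quasi.extIncl =
      H.map P.ιC ≫ H.map P.quasi.extIncl := by
    rw [Category.assoc, P.quasi.map_extIncl, Preadditive.comp_sub, ← H.map_comp, ← H.map_comp, h1,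
      add_sub_cancel_left, H.map_comp]
  ext x
  exact (P.quasi.exact_of_splitExact hH).1 (ConcreteCategory.congr_hom key x)

/-! ### The inverse of H(ι) and the theorem -/

namespace TameFamily

/-- The matrix coefficients with values in `𝒜`. -/
noncomputable def coD (T : P.TameFamily) (b : P.D) (i j : ℕ) : P.calA := T.frameD.co b i j

/-- The matrix coefficients with values in `𝒯^∞_D`. -/
noncomputable def coDT (T : P.TameFamily) (b : P.DT) (i j : ℕ) : P.toeplitz := T.frameDT.co b i j

end TameFamily

/-- For tame `D`, the quasihomomorphism followed by a suitable map is inverse to `ι`. -/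
theorem TameFamily.exists_inverse (T : P.TameFamily) {H : LCAlg.{u} ⥤ AddCommGrpCat.{v}}
    (hH : SplitExact H) (hd : DiffotopyInvariant H) (hK : KStable H) :
    ∃ g : H.obj P.C ⟶ H.obj P.calA, P.quasi.map H hH ≫ g ≫ H.map P.ι = 𝟙 (H.obj P.toeplitz) ∧
      H.map P.ι ≫ P.quasi.map H hH ≫ g = 𝟙 (H.obj P.calA) := by
  obtain ⟨M, hM⟩ : ∃ M : T.frameD.cpt ⟶ tensor.{0, u} K P.calA,
      ∀ b n m (hb : T.frameD.Good b n m), ap M ⟨T.frameD.elem b n m, T.frameD.elem_mem hb⟩ =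
        ∑ i ∈ T.fib n, ∑ j ∈ T.fib m, tmul.{0, u} (K.mu i j) (T.coD b i j) :=
    T.frameD.exists_frameHom
  obtain ⟨M', hM'⟩ : ∃ M : T.frameDT.cpt ⟶ tensor.{0, u} K P.toeplitz,
      ∀ b n m (hb : T.frameDT.Good b n m), ap M ⟨T.frameDT.elem b n m, T.frameDT.elem_mem hb⟩ =
        ∑ i ∈ T.fib n, ∑ j ∈ T.fib m, tmul.{0, u} (K.mu i j) (T.coDT b i j) :=
    T.frameDT.exists_frameHom
  obtain ⟨κ, hκ⟩ := exists_tensorMap (A := K) P.ι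
  -- The two frames are images of the same multivectors, so on elementary matrices both composites
  -- have the coefficients V_i b W_j ⊗ 1; density does the rest.
  have hsq : M ≫ κ = T.θcpt ≫ M' := by
    refine hom_ext fun x => T.frameD.cpt_ext
      (f := ((M ≫ κ).toAlgHom : T.frameD.cpt →ₗ[ℂ] tensor.{0, u} K P.toeplitz))
      (g := ((T.θcpt ≫ M').toAlgHom : T.frameD.cpt →ₗ[ℂ] tensor.{0, u} K P.toeplitz))
      (M ≫ κ).cont (T.θcpt ≫ M').cont (fun b n m hb => ?_) x
    change ap κ (ap M _) = ap M' (ap T.θcpt _)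
    have hθ : ap T.θcpt ⟨T.frameD.elem b n m, T.frameD.elem_mem hb⟩ =
        ⟨T.frameDT.elem (ap P.inD b) n m, T.frameDT.elem_mem (T.good_inD hb)⟩ :=
      Subtype.ext (T.θ_elem b n m)
    rw [hθ, hM _ _ _ hb, hM' _ _ _ (T.good_inD hb), ap_sum]
    refine Finset.sum_congr rfl fun i hi => ?_
    rw [ap_sum]
    refine Finset.sum_congr rfl fun j hj => (hκ _ _).trans ?_
    have hi' := (T.mem_fib _ _).1 hi
    have hj' := (T.mem_fib _ _).1 hj
    congr 1
    refine Subtype.ext ?_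
    refine Eq.trans ?_ (T.frameDT.co_val (T.good_inD hb i j hi' hj')).symm
    change ap P.inD (T.frameD.co b i j).1 = _
    rw [T.frameD.co_val (hb i j hi' hj'), ap_mul, ap_mul]
    rfl
  -- The element a ⊗ e sits in degree (0, 0), where the frame consists of the unit alone, so the
  -- coefficient is a itself at e_{00}.
  have hstab : P.ιC ≫ T.inclC ≫ M = stab P.calA := by
    refine hom_ext fun a => ?_
    have hg : T.frameD.Good a.1 0 0 := T.frameD.good_zero_zero a.2
    have h : ap T.inclC (ap P.ιC a) = ⟨T.frameD.elem a.1 0 0, T.frameD.elem_mem hg⟩ :=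
      Subtype.ext (congrArg (P.pure a.1) SmoothToeplitz.e_eq_mu)
    change ap M (ap T.inclC (ap P.ιC a)) = tmul.{0, u} K.e a
    rw [h, hM _ _ _ hg, fib, Finset.sum_singleton, Finset.sum_singleton, K.e_eq_mu]
    congr 1
    refine Subtype.ext ?_
    refine (T.frameD.co_val (hg 0 0 T.frameD.deg_zero T.frameD.deg_zero)).trans ?_
    rw [T.frameD.V_zero, T.frameD.W_zero, T.frameD.one_mul, T.frameD.mul_one]
  have hstab' : T.cornerCpt ≫ M' = stab P.toeplitz := by
    refine hom_ext fun x => ?_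
    have hg : T.frameDT.Good x.1 0 0 := T.frameDT.good_zero_zero x.2
    have h : ap T.cornerCpt x = ⟨T.frameDT.elem x.1 0 0, T.frameDT.elem_mem hg⟩ :=
      Subtype.ext (congrArg (P.bipure x.1) SmoothToeplitz.e_eq_mu)
    change ap M' (ap T.cornerCpt x) = tmul.{0, u} K.e x
    rw [h, hM' _ _ _ hg, fib, Finset.sum_singleton, Finset.sum_singleton, K.e_eq_mu]
    congr 1
    refine Subtype.ext ?_
    refine (T.frameDT.co_val (hg 0 0 T.frameDT.deg_zero T.frameDT.deg_zero)).trans ?_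
    rw [T.frameDT.V_zero, T.frameDT.W_zero, T.frameDT.one_mul, T.frameDT.mul_one]
  have hnat : stab P.calA ≫ κ = P.ι ≫ stab P.toeplitz := hom_ext fun a => hκ K.e a
  have := hK P.calA
  have := hK P.toeplitz
  -- The map g reads an element of C as a matrix over 𝒜 and undoes the stabilisation. In the first
  -- identity the naturality of stabilisation and of the frame homomorphism moves H(ι) past g, where
  -- the rotation result applies; the second uses only y ∘ H(ι) = H(ι_C).
  refine ⟨H.map T.inclC ≫ H.map M ≫ inv (H.map (stab P.calA)), ?_, ?_⟩
  · have hinv : inv (H.map (stab P.calA)) ≫ H.map P.ι =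
        H.map κ ≫ inv (H.map (stab P.toeplitz)) := by
      rw [IsIso.inv_comp_eq, ← Category.assoc, IsIso.eq_comp_inv, ← H.map_comp, ← H.map_comp, hnat]
    calc P.quasi.map H hH ≫ (H.map T.inclC ≫ H.map M ≫ inv (H.map (stab P.calA))) ≫ H.map P.ι
        = P.quasi.map H hH ≫ H.map T.inclC ≫ H.map (M ≫ κ) ≫ inv (H.map (stab P.toeplitz)) := by
          simp only [Category.assoc, H.map_comp, hinv]
      _ = (P.quasi.map H hH ≫ H.map (T.inclC ≫ T.θcpt)) ≫ H.map M' ≫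
            inv (H.map (stab P.toeplitz)) := by
          simp only [hsq, Category.assoc, H.map_comp]
      _ = 𝟙 _ := by
          rw [T.map_inclC_θcpt hH hd, ← Category.assoc, ← H.map_comp, hstab', IsIso.hom_inv_id]
  · rw [← Category.assoc, map_ι_quasi hH, ← Category.assoc (H.map T.inclC), ← Category.assoc,
      ← H.map_comp, ← H.map_comp, hstab, IsIso.hom_inv_id]

end PimsnerSubalgebra

theorem theorem8p4 {A E : Type u} [CStarAlgebra A] [PartialOrder A] [StarOrderedRing A]
    [NormedAddCommGroup E] [NormedSpace ℂ E] [CompleteSpace E] [Module Aᵐᵒᵖ E]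
    [CStarModule Aᵐᵒᵖ E] (c : Correspondence A E) (P : PimsnerSubalgebra c)
    (H : LCAlg.{u} ⥤ AddCommGrpCat.{v}) (hH : SplitExact H) :
    ((∃ z : H.obj P.C ⟶ H.obj P.calA, z ≫ H.map P.ιC = 𝟙 (H.obj P.C)) →
      ∃ w : H.obj P.C ⟶ H.obj P.toeplitz, w ≫ P.quasi.map H hH = 𝟙 (H.obj P.C)) ∧
    (DiffotopyInvariant H → KStable H → P.Tame →
      ∃ w : H.obj P.C ⟶ H.obj P.toeplitz, P.quasi.map H hH ≫ w = 𝟙 (H.obj P.toeplitz)) ∧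
    (DiffotopyInvariant H → KStable H → P.Tame → IsIso (H.map P.ι)) := by
  refine ⟨?_, fun hd hK hT => ?_, fun hd hK hT => ?_⟩
  -- The right inverse of y is H(ι) ∘ z, as y ∘ H(ι) = H(ι_C).
  · rintro ⟨z, hz⟩
    exact ⟨z ≫ H.map P.ι, by rw [Category.assoc, PimsnerSubalgebra.map_ι_quasi hH, hz]⟩
  · obtain ⟨T⟩ := hT.nonempty
    obtain ⟨g, hg, -⟩ := T.exists_inverse hH hd hK
    exact ⟨g ≫ H.map P.ι, hg⟩
  · obtain ⟨T⟩ := hT.nonempty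
    obtain ⟨g, hg, hg'⟩ := T.exists_inverse hH hd hK
    exact ⟨P.quasi.map H hH ≫ g, hg', by rw [Category.assoc, hg]⟩
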